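/- Let $k\in\mathbb N$, let $\mathbf n=(n_1,\dots,n_k)$ and $\mathbf m=(m_1,\dots,m_k)$ be tuples of positive integers, and let $\mathcal K$ be a separable complex Hilbert space. **Universal models.** For each $i$ let $\mathbb F_{n_i}^+$ be the free monoid on $g^i_1,\dots,g^i_{n_i}$ with length function $|\cdot|$, and let $F^2(H_{n_i})$ be the full Fock space with orthonormal basis $\{e^i_\alpha:\alpha\in\mathbb F_{n_i}^+\}$. On $F^2(H_{n_i})$ define the weighted left and right creation operators $$W_{i,j}e^i_\alpha=\sqrt{\tfrac{|\alpha|+1}{|\alpha|+m_i}}\;e^i_{g^i_j\alpha},\qquad \Lambda_{i,j}e^i_\alpha=\sqrt{\tfrac{|\alpha|+1}{|\alpha|+m_i}}\;e^i_{\alpha g^i_j},$$ and let $\mathbf W_{i,j}$, $\mathbf \Lambda_{i,j}$ be the operators on $\bigotimes_{s=1}^kF^2(H_{n_s})$ that act as $W_{i,j}$, $\Lambda_{i,j}$ on the $i$-th factor and as the identity on the others; put $\mathbf W=(\mathbf W_{i,j})$ and $\widetilde{\mathbf\Lambda}_{i,j}=I_{\mathcal K}\otimes\mathbf\Lambda_{i,j}$.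 For an operator tuple $\mathbf X=(X_{i,j})$ and $\alpha_i=g^i_{j_1}\cdots g^i_{j_p}$ write $X_{i,\alpha_i}=X_{i,j_1}\cdots X_{i,j_p}$, and $\mathbf X_{\boldsymbol\alpha}=X_{1,\alpha_1}\cdots X_{k,\alpha_k}$ for $\boldsymbol\alpha=(\alpha_1,\dots,\alpha_k)\in\mathbf F_{\mathbf n}^+:=\mathbb F_{n_1}^+\times\cdots\times\mathbb F_{n_k}^+$. Let $\mathcal J$ be the set of all pairs $(\boldsymbol\alpha,\boldsymbol\beta)\in\mathbf F_{\mathbf n}^+\times\mathbf F_{\mathbf n}^+$ for which there is $s\in\mathbb Z^k$ with $|\alpha_i|=s_i^+=\max\{s_i,0\}$ and $|\beta_i|=s_i^-=\max\{-s_i,0\}$ for all $i$. **Brown–Halmos condition.** Let $\widetilde{\mathbf\Lambda}_i=[\widetilde{\mathbf\Lambda}_{i,1}\cdots\widetilde{\mathbf\Lambda}_{i,n_i}]$ be the row operator from the direct sum of $n_i$ copies of $\mathcal K\otimes\bigotimes_{s}F^2(H_{n_s})$ to $\mathcal K\otimes\bigotimes_sF^2(H_{n_s})$, and let $\widetilde{\mathbf\Lambda}_i'=\widetilde{\mathbf\Lambda}_i(\widetilde{\mathbf\Lambda}_i^*\widetilde{\mathbf\Lambda}_i)^{-1}$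 be its Cauchy dual. For an operator $A$, $\mathbf{diag}_{n}(A)$ denotes the direct sum of $n$ copies of $A$. A bounded operator $T$ on $\mathcal K\otimes\bigotimes_sF^2(H_{n_s})$ satisfies the Brown–Halmos condition if, for every $i\in\{1,\dots,k\}$, $$\widetilde{\mathbf\Lambda}_i'^{*}\,T\,\widetilde{\mathbf\Lambda}_i'=\mathbf{diag}_{n_i}\Big(\sum_{j=0}^{m_i-1}(-1)^j\binom{m_i}{j+1}\sum_{\beta\in\mathbb F_{n_i}^+,\,|\beta|=j}\widetilde{\mathbf\Lambda}_{i,\beta}\,T\,\widetilde{\mathbf\Lambda}_{i,\beta}^*\Big).$$ **Free $k$-pluriharmonic functions.** For a Hilbert space $\mathcal H$ let $\mathbf D^{\mathbf m}_{\mathbf n}(\mathcal H)$ be the set of tuples $\mathbf X=(X_{i,j})_{1\le i\le k,\,1\le j\le n_i}$ in $B(\mathcal H)$ such that $X_{p,a}X_{q,b}=X_{q,b}X_{p,a}$ whenever $p\ne q$, and $(\mathrm{id}-\Phi_{X_1})^{p_1}\circ\cdots\circ(\mathrm{id}-\Phi_{X_k})^{p_k}(I)\ge0$ for all integers $0\le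 p_i\le m_i$, where $\Phi_{X_i}(Y)=\sum_{j}X_{i,j}YX_{i,j}^*$. Let $\mathbf D^{\mathbf m}_{\mathbf n,rad}(\mathcal H)=\bigcup_{0\le r<1}r\,\mathbf D^{\mathbf m}_{\mathbf n}(\mathcal H)$. A free $k$-pluriharmonic function $F$ on $\mathbf D^{\mathbf m}_{\mathbf n,rad}$ with coefficients in $B(\mathcal K)$ is a family of maps $F:\mathbf D^{\mathbf m}_{\mathbf n,rad}(\mathcal H)\to B(\mathcal K\otimes\mathcal H)$, one for each Hilbert space $\mathcal H$, for which there are operators $A_{(\boldsymbol\alpha,\boldsymbol\beta)}\in B(\mathcal K)$, $(\boldsymbol\alpha,\boldsymbol\beta)\in\mathcal J$, independent of $\mathcal H$, such that $$F(\mathbf X)=\sum_{s\in\mathbb Z^k}\ \sum_{|\alpha_i|=s_i^+,\ |\beta_i|=s_i^-\ (1\le i\le k)}A_{(\boldsymbol\alpha,\boldsymbol\beta)}\otimes\mathbf X_{\boldsymbol\alpha}\mathbf X_{\boldsymbol\beta}^*$$ for all $\mathcal H$ and all $\mathbf X\in\mathbf D^{\mathbf m}_{\mathbf n,rad}(\mathcal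 H)$, where the series over $\mathbb Z^k$ converges (unconditionally) in the operator norm. It is bounded if $\sup\|F(\mathbf X)\|<\infty$, the supremum being over all $\mathcal H$ and all $\mathbf X\in\mathbf D^{\mathbf m}_{\mathbf n,rad}(\mathcal H)$. **Theorem.** For every bounded operator $T\in B\big(\mathcal K\otimes\bigotimes_{s=1}^kF^2(H_{n_s})\big)$ the following statements are equivalent. (i) $T$ satisfies the Brown–Halmos condition. (ii) There is a unique bounded free $k$-pluriharmonic function $F$ on $\mathbf D^{\mathbf m}_{\mathbf n,rad}$ with coefficients in $B(\mathcal K)$ such that $T=\text{SOT-}\lim_{r\to1}F(r\mathbf W)$. (iii) $T$ belongs to the closure in the strong operator topology of $\mathrm{span}\{C\otimes\mathbf W_{\boldsymbol\alpha}\mathbf W_{\boldsymbol\beta}^*: C\in B(\mathcal K),\ (\boldsymbol\alpha,\boldsymbol\beta)\in\mathcal J\}$. (iv) $T$ belongs to the closure in the weak operator topology of $\mathrm{span}\{C\otimes\mathbf W_{\boldsymbol\alpha}\mathbf W_{\boldsymbol\beta}^*: C\in B(\mathcal K),\ (\boldsymbol\alpha,\boldsymbol\beta)\in\mathcal J\}$.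 -/

import Mathlib

open Filter Topology
open scoped TensorProduct InnerProductSpace

universe u v w

noncomputable section

/-! ## Hilbert space tensor products and direct sums -/

/-- The Hilbert space tensor product: the completion of the algebraic tensor product with respect
to the inner product `⟪x ⊗ y, x' ⊗ y'⟫ = ⟪x, x'⟫ ⟪y, y'⟫`. -/
abbrev HilbertTensor (K : Type v) (H : Type w) [NormedAddCommGroup K] [InnerProductSpace ℂ K]
    [NormedAddCommGroup H] [InnerProductSpace ℂ H] : Type (max v w) :=
  UniformSpace.Completion (K ⊗[ℂ] H)

/-- The operator `A ⊗ B` on the Hilbert space tensor product `K ⊗ H`. -/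
def tensorOp {K : Type v} {H : Type w} [NormedAddCommGroup K] [InnerProductSpace ℂ K]
    [NormedAddCommGroup H] [InnerProductSpace ℂ H] (A : K →L[ℂ] K) (B : H →L[ℂ] H) :
    HilbertTensor K H →L[ℂ] HilbertTensor K H :=
  (TensorProduct.mapL A B).completion

/-- The row operator `[X_1 ⋯ X_n] : E^{(n)} → E`, `(x_j)_j ↦ ∑_j X_j x_j`. -/
def rowOp {J : Type u} [Fintype J] {E : Type v} [NormedAddCommGroup E] [InnerProductSpace ℂ E]
    (X : J → E →L[ℂ] E) : PiLp 2 (fun _ : J => E) →L[ℂ] E :=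
  ∑ j, X j ∘L PiLp.proj 2 (fun _ : J => E) j

/-- The operator `diag_n(A)`: the direct sum of `n` copies of `A`, acting on `E^{(n)}`. -/
def diagOp (J : Type u) [Fintype J] {E : Type v} [NormedAddCommGroup E] [InnerProductSpace ℂ E]
    (A : E →L[ℂ] E) : PiLp 2 (fun _ : J => E) →L[ℂ] PiLp 2 (fun _ : J => E) :=
  (PiLp.continuousLinearEquiv 2 ℂ (fun _ : J => E)).symm.toContinuousLinearMap ∘L
    ContinuousLinearMap.pi (fun j => A ∘L PiLp.proj 2 (fun _ : J => E) j)

/-! ## Words -/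

/-- The (finite) set of words of length `l` in the free monoid on a finite set of generators. -/
def wordsOfLength (J : Type u) [Finite J] (l : ℕ) : Finset (FreeMonoid J) :=
  (List.finite_length_eq J l).toFinset

/-- The set `F_{n_1}^+ × ⋯ × F_{n_k}^+`; here `ι i` is the set of generators of the `i`-th free
monoid, so that `n_i` is the number of elements of `ι i`. -/
abbrev MultiWord {k : ℕ} (ι : Fin k → Type u) : Type u := ∀ i, FreeMonoid (ι i)

section Fock

variable {k : ℕ} (ι : Fin k → Type u)

/-- The set `J` of pairs `(α, β)` of multi-words for which there is `s ∈ ℤ^k` with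
`|α_i| = s_i⁺ = max (s_i, 0)` and `|β_i| = s_i⁻ = max (-s_i, 0)` for all `i`. -/
def pairsJ : Set (MultiWord ι × MultiWord ι) :=
  {p | ∃ s : Fin k → ℤ, ∀ i, (p.1 i).length = (s i).toNat ∧ (p.2 i).length = (-s i).toNat}

/-- The tensor product `F²(H_{n_1}) ⊗ ⋯ ⊗ F²(H_{n_k})` of full Fock spaces, as the Hilbert space
with orthonormal basis `e_α = e_{α_1} ⊗ ⋯ ⊗ e_{α_k}`, `α ∈ F_{n_1}^+ × ⋯ × F_{n_k}^+`. -/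
abbrev FockTensor : Type u := lp (fun _ : MultiWord ι => ℂ) 2

variable {ι}

open Classical in
/-- The basis vector `e_α`. -/
def fockBasis (α : MultiWord ι) : FockTensor ι := lp.single 2 α (1 : ℂ)

theorem orthonormal_fockBasis : Orthonormal ℂ (fockBasis (ι := ι)) := by
  classical
  rw [orthonormal_iff_ite]
  intro a b
  simp only [fockBasis, lp.inner_single_left, lp.single_apply]
  by_cases h : a = b
  · subst h; simp
  · simp [h]

/-- The isometry `e_α ↦ e_{φ(α)}` attached to an injective map `φ`. -/
def shiftIsometry (φ : MultiWord ι → MultiWord ι) (hφ : Function.Injective φ) :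
    FockTensor ι →ₗᵢ[ℂ] FockTensor ι :=
  (orthonormal_fockBasis.comp φ hφ).orthogonalFamily.linearIsometry

/-- The map `α ↦ (α_1, …, g_j α_i, …, α_k)`. -/
def prependLetter (i : Fin k) (j : ι i) (α : MultiWord ι) : MultiWord ι :=
  Function.update α i (FreeMonoid.of j * α i)

/-- The map `α ↦ (α_1, …, α_i g_j, …, α_k)`. -/
def appendLetter (i : Fin k) (j : ι i) (α : MultiWord ι) : MultiWord ι :=
  Function.update α i (α i * FreeMonoid.of j)

theorem prependLetter_injective (i : Fin k) (j : ι i) :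
    Function.Injective (prependLetter (ι := ι) i j) := by
  intro α β h
  funext l
  have hl := congrFun h l
  by_cases hli : l = i
  · subst hli
    simpa [prependLetter] using hl
  · simpa [prependLetter, hli] using hl

theorem appendLetter_injective (i : Fin k) (j : ι i) :
    Function.Injective (appendLetter (ι := ι) i j) := by
  intro α β h
  funext l
  have hl := congrFun h l
  by_cases hli : l = i
  · subst hli
    simpa [appendLetter] using hl
  · simpa [appendLetter, hli] using hl

/-- The weight `√((l + 1) / (l + m))`. -/
def weight (m l : ℕ) : ℝ := Real.sqrt (((l : ℝ) + 1) / ((l : ℝ) + m))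

theorem weight_bound (m l : ℕ) : ‖((weight m l : ℝ) : ℂ) • ContinuousLinearMap.id ℂ ℂ‖ ≤ 2 := by
  have h0 : 0 ≤ weight m l := Real.sqrt_nonneg _
  have h1 : weight m l ≤ 2 := by
    unfold weight
    rw [Real.sqrt_le_left (by norm_num)]
    rcases Nat.eq_zero_or_pos (l + m) with h | h
    · have h' : (l : ℝ) + m = 0 := by exact_mod_cast h
      rw [h']; norm_num
    · have h' : (1 : ℝ) ≤ (l : ℝ) + m := by exact_mod_cast h
      have hm : (0 : ℝ) ≤ m := Nat.cast_nonneg m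
      have hl : (0 : ℝ) ≤ l := Nat.cast_nonneg l
      rw [div_le_iff₀ (by linarith)]
      nlinarith
  rw [norm_smul, ContinuousLinearMap.norm_id, mul_one, Complex.norm_real, Real.norm_eq_abs,
    abs_of_nonneg h0]
  exact h1

variable (ι)

/-- The diagonal operator `I ⊗ ⋯ ⊗ D_i ⊗ ⋯ ⊗ I`:
`e_α ↦ √((|α_i| + 1) / (|α_i| + m_i)) e_α`. -/
def weightOp (m : Fin k → ℕ) (i : Fin k) : FockTensor ι →L[ℂ] FockTensor ι :=
  lp.mapCLM 2 (fun α : MultiWord ι =>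
    ((weight (m i) (α i).length : ℝ) : ℂ) • ContinuousLinearMap.id ℂ ℂ)
    (K := 2) (by norm_num) (fun _ => weight_bound _ _)

/-- The weighted left creation operators `W_{i,j}` on `F²(H_{n_1}) ⊗ ⋯ ⊗ F²(H_{n_k})`: the left
universal model. -/
def leftModel (m : Fin k → ℕ) (i : Fin k) (j : ι i) : FockTensor ι →L[ℂ] FockTensor ι :=
  (shiftIsometry (prependLetter i j) (prependLetter_injective i j)).toContinuousLinearMap ∘L
    weightOp ι m i

/-- The weighted right creation operators `Λ_{i,j}` on `F²(H_{n_1}) ⊗ ⋯ ⊗ F²(H_{n_k})`: the right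
universal model. -/
def rightModel (m : Fin k → ℕ) (i : Fin k) (j : ι i) : FockTensor ι →L[ℂ] FockTensor ι :=
  (shiftIsometry (appendLetter i j) (appendLetter_injective i j)).toContinuousLinearMap ∘L
    weightOp ι m i

end Fock

/-! ## Poly-hyperballs -/

section Ball

variable {k : ℕ} {ι : Fin k → Type u}

/-- `X_α = X_{1,α_1} ⋯ X_{k,α_k}`, where `X_{i,α_i} = X_{i,j_1} ⋯ X_{i,j_p}` for
`α_i = g_{j_1} ⋯ g_{j_p}`. -/
def monomialOp {H : Type w} [NormedAddCommGroup H] [InnerProductSpace ℂ H]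
    (X : ∀ i, ι i → H →L[ℂ] H) (α : MultiWord ι) : H →L[ℂ] H :=
  (List.ofFn fun i => FreeMonoid.lift (X i) (α i)).prod

variable [∀ i, Fintype (ι i)]

/-- The map `Φ_{X_i}(Y) = ∑_j X_{i,j} Y X_{i,j}^*` on `B(H)`. -/
def PhiMap {J : Type u} [Fintype J] {H : Type w} [NormedAddCommGroup H] [InnerProductSpace ℂ H]
    [CompleteSpace H] (X : J → H →L[ℂ] H) : Module.End ℂ (H →L[ℂ] H) :=
  ∑ j, LinearMap.mulLeftRight ℂ (X j, star (X j))

/-- The defect mapping `(id - Φ_{X_1})^{p_1} ∘ ⋯ ∘ (id - Φ_{X_k})^{p_k}`. -/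
def defectMap {H : Type w} [NormedAddCommGroup H] [InnerProductSpace ℂ H]
    [CompleteSpace H] (X : ∀ i, ι i → H →L[ℂ] H) (p : Fin k → ℕ) : Module.End ℂ (H →L[ℂ] H) :=
  (List.ofFn fun i => (1 - PhiMap (X i)) ^ p i).prod

variable (ι)

/-- The representation `D_n^m(H)` of the noncommutative poly-hyperball on the Hilbert space `H`:
all tuples `X` such that the entries of `X_p` and `X_q` commute for `p ≠ q`, and such that the
defect operators of `X` of all orders `0 ≤ p ≤ m` are positive. -/
def polyHyperball (m : Fin k → ℕ) (H : Type w) [NormedAddCommGroup H] [InnerProductSpace ℂ H]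
    [CompleteSpace H] : Set (∀ i, ι i → H →L[ℂ] H) :=
  {X | (∀ p q, p ≠ q → ∀ a b, Commute (X p a) (X q b)) ∧
    ∀ p : Fin k → ℕ, p ≤ m → (defectMap X p 1).IsPositive}

/-- The radial part of the poly-hyperball: the union of the sets `r D_n^m(H)` for `r ∈ [0,1)`. -/
def radialPolyHyperball (m : Fin k → ℕ) (H : Type w) [NormedAddCommGroup H]
    [InnerProductSpace ℂ H] [CompleteSpace H] : Set (∀ i, ι i → H →L[ℂ] H) :=
  {X | ∃ r : ℝ, 0 ≤ r ∧ r < 1 ∧ ∃ Y ∈ polyHyperball ι m H, X = fun i j => (r : ℂ) • Y i j}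

end Ball

/-! ## The left universal model belongs to the poly-hyperball -/

section Model

variable {k : ℕ} {ι : Fin k → Type u}

theorem shiftIsometry_apply_map (φ : MultiWord ι → MultiWord ι) (hφ : Function.Injective φ)
    (f : FockTensor ι) (α : MultiWord ι) : shiftIsometry φ hφ f (φ α) = f α := by
  classical
  have h1 : inner ℂ (fockBasis (φ α)) (shiftIsometry φ hφ f) = shiftIsometry φ hφ f (φ α) := by
    simp only [fockBasis]
    rw [lp.inner_single_left]
    simp
  have h2 : shiftIsometry φ hφ (fockBasis α) = fockBasis (φ α) := by
    unfold shiftIsometry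
    rw [fockBasis, OrthogonalFamily.linearIsometry_apply_single]
    simp
  rw [← h1, ← h2, LinearIsometry.inner_map_map]
  simp only [fockBasis]
  rw [lp.inner_single_left]
  simp

theorem shiftIsometry_apply_of_notMem (φ : MultiWord ι → MultiWord ι) (hφ : Function.Injective φ)
    (f : FockTensor ι) (β : MultiWord ι) (hβ : ∀ α, φ α ≠ β) : shiftIsometry φ hφ f β = 0 := by
  classical
  have h1 : inner ℂ (fockBasis β) (shiftIsometry φ hφ f) = shiftIsometry φ hφ f β := by
    simp only [fockBasis]
    rw [lp.inner_single_left]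
    simp
  rw [← h1]
  have hs := (orthonormal_fockBasis.comp φ hφ).orthogonalFamily.hasSum_linearIsometry f
  have hs' := (innerSL ℂ (fockBasis β)).hasSum hs
  refine hs'.unique ?_
  convert hasSum_zero with α
  simp only [Function.comp_apply, innerSL_apply_apply, LinearIsometry.toSpanSingleton_apply,
    inner_smul_right]
  rw [orthonormal_iff_ite.1 orthonormal_fockBasis, if_neg (fun h => hβ α h.symm), mul_zero]

theorem weightOp_apply (m : Fin k → ℕ) (i : Fin k) (f : FockTensor ι) (α : MultiWord ι) :
    weightOp ι m i f α = (weight (m i) (α i).length : ℂ) * f α := by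
  simp [weightOp]

theorem leftModel_fockBasis (m : Fin k → ℕ) (i : Fin k) (j : ι i) (α : MultiWord ι) :
    leftModel ι m i j (fockBasis α) =
      (weight (m i) (α i).length : ℂ) • fockBasis (prependLetter i j α) := by
  classical
  have h2 : shiftIsometry (prependLetter i j) (prependLetter_injective i j) (fockBasis α)
      = fockBasis (prependLetter i j α) := by
    unfold shiftIsometry
    rw [fockBasis, OrthogonalFamily.linearIsometry_apply_single]
    simp
  have h3 : weightOp ι m i (fockBasis α) = (weight (m i) (α i).length : ℂ) • fockBasis α := by
    ext β
    rw [weightOp_apply, lp.coeFn_smul, Pi.smul_apply, smul_eq_mul]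
    by_cases h : β = α
    · subst h; rfl
    · simp [fockBasis, h]
  simp only [leftModel, ContinuousLinearMap.comp_apply, h3, map_smul]
  congr 1

theorem leftModel_apply_map (m : Fin k → ℕ) (i : Fin k) (j : ι i) (f : FockTensor ι)
    (α : MultiWord ι) : leftModel ι m i j f (prependLetter i j α) =
      (weight (m i) (α i).length : ℂ) * f α := by
  simp only [leftModel, ContinuousLinearMap.comp_apply]
  exact (shiftIsometry_apply_map _ (prependLetter_injective i j) _ _).trans (weightOp_apply m i f α)

theorem leftModel_apply_of_notMem (m : Fin k → ℕ) (i : Fin k) (j : ι i) (f : FockTensor ι)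
    (β : MultiWord ι) (hβ : ∀ α, prependLetter i j α ≠ β) : leftModel ι m i j f β = 0 :=
  shiftIsometry_apply_of_notMem _ (prependLetter_injective i j) _ _ hβ

theorem star_leftModel_apply (m : Fin k → ℕ) (i : Fin k) (j : ι i) (f : FockTensor ι)
    (α : MultiWord ι) : (star (leftModel ι m i j)) f α =
      (weight (m i) (α i).length : ℂ) * f (prependLetter i j α) := by
  classical
  have key : ∀ (g : FockTensor ι) (β : MultiWord ι), inner ℂ (fockBasis β) g = g β := by
    intro g β
    simp only [fockBasis]
    rw [lp.inner_single_left]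
    simp
  rw [← key, ContinuousLinearMap.star_eq_adjoint, ContinuousLinearMap.adjoint_inner_right,
    leftModel_fockBasis, inner_smul_left, key]
  simp

theorem leftModel_commute (m : Fin k → ℕ) (p q : Fin k) (hpq : p ≠ q) (a : ι p) (b : ι q) :
    Commute (leftModel ι m p a) (leftModel ι m q b) := by
  have hb : ∀ (S T : FockTensor ι →L[ℂ] FockTensor ι),
      (∀ α, S (fockBasis α) = T (fockBasis α)) → S = T := by
    classical
    intro S T h
    ext f : 1
    have hs : HasSum (fun α => f α • fockBasis α) f := by
      have := lp.hasSum_single (p := 2) (by norm_num) f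
      convert this using 2 with α
      rw [fockBasis, ← lp.single_smul]; simp
    refine (S.hasSum hs).unique ?_
    convert T.hasSum hs using 2 with α
    simp [h]
  refine hb _ _ fun α => ?_
  simp only [mul_apply_eq_comp, leftModel_fockBasis, map_smul, smul_smul]
  have e1 : prependLetter p a (prependLetter q b α) = prependLetter q b (prependLetter p a α) := by
    simp only [prependLetter, Function.update_of_ne hpq, Function.update_of_ne hpq.symm]
    exact Function.update_comm hpq.symm _ _ _
  have e2 : prependLetter q b α p = α p := by simp [prependLetter, hpq]
  have e3 : prependLetter p a α q = α q := by simp [prependLetter, hpq.symm]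
  rw [e1, e2, e3, mul_comm]

/-- The eigenvalues `∏_i C(m_i - q_i, |α_i|) / C(m_i, |α_i|)` (in terms of multiset coefficients)
of the defect operators of the left universal model. -/
def defectEigenvalue (m q : Fin k → ℕ) (α : MultiWord ι) : ℝ :=
  ∏ i, ((Nat.multichoose (m i - q i) (α i).length : ℝ) / Nat.multichoose (m i) (α i).length)

variable [∀ i, Fintype (ι i)]

theorem PhiMap_leftModel_apply_one (m : Fin k → ℕ) (i : Fin k) (T : FockTensor ι →L[ℂ] FockTensor ι)
    (f : FockTensor ι) (α : MultiWord ι) (h : α i = 1) :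
    PhiMap (leftModel ι m i) T f α = 0 := by
  simp only [PhiMap, LinearMap.sum_apply, LinearMap.mulLeftRight_apply,
    sum_apply, lp.coeFn_sum, Finset.sum_apply]
  refine Finset.sum_eq_zero fun j _ => ?_
  refine leftModel_apply_of_notMem _ _ _ _ _ fun γ hγ => ?_
  have := congrArg FreeMonoid.length (congrFun hγ i)
  simp [prependLetter, h] at this

theorem PhiMap_leftModel_apply_prepend (m : Fin k → ℕ) (i : Fin k) (j : ι i)
    (T : FockTensor ι →L[ℂ] FockTensor ι) (g : MultiWord ι → ℂ)
    (hT : ∀ f α, T f α = g α * f α) (f : FockTensor ι) (α : MultiWord ι) :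
    PhiMap (leftModel ι m i) T f (prependLetter i j α) =
      (weight (m i) (α i).length : ℂ) ^ 2 * g α * f (prependLetter i j α) := by
  classical
  simp only [PhiMap, LinearMap.sum_apply, LinearMap.mulLeftRight_apply,
    sum_apply, lp.coeFn_sum, Finset.sum_apply]
  rw [Finset.sum_eq_single j]
  · simp only [mul_apply_eq_comp]
    rw [leftModel_apply_map, hT, star_leftModel_apply]
    ring
  · intro j' _ hj'
    refine leftModel_apply_of_notMem _ _ _ _ _ fun γ hγ => hj' ?_
    have := congrArg FreeMonoid.toList (congrFun hγ i)
    simp [prependLetter] at this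
    exact this.1
  · simp

theorem weight_sq_mul (m q l : ℕ) (hq : q + 1 ≤ m) :
    ((Nat.multichoose (m - q) (l + 1) : ℝ) / Nat.multichoose m (l + 1))
      - weight m l ^ 2 * ((Nat.multichoose (m - q) l : ℝ) / Nat.multichoose m l)
      = (Nat.multichoose (m - (q + 1)) (l + 1) : ℝ) / Nat.multichoose m (l + 1) := by
  obtain ⟨a, rfl⟩ : ∃ a, m = q + 1 + a := ⟨m - (q + 1), by omega⟩
  have e1 : q + 1 + a - q = a + 1 := by omega
  have e2 : q + 1 + a - (q + 1) = a := by omega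
  rw [e1, e2]
  have hw : weight (q + 1 + a) l ^ 2 = ((l : ℝ) + 1) / (l + (q + 1 + a : ℕ)) := by
    unfold weight
    rw [Real.sq_sqrt (by positivity)]
  have hc : Nat.multichoose (q + 1 + a) (l + 1) * (l + 1)
      = Nat.multichoose (q + 1 + a) l * (l + (q + 1 + a)) := by
    rw [Nat.multichoose_eq, Nat.multichoose_eq]
    have e3 : q + 1 + a + (l + 1) - 1 = (q + a + l) + 1 := by omega
    have e4 : q + 1 + a + l - 1 = q + a + l := by omega
    rw [e3, e4]
    have := Nat.add_one_mul_choose_eq (q + a + l) l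
    rw [← this]; ring
  have hp : 0 < Nat.multichoose (q + 1 + a) l := by
    rw [Nat.multichoose_eq]; exact Nat.choose_pos (by omega)
  have hp' : 0 < Nat.multichoose (q + 1 + a) (l + 1) := by
    rw [Nat.multichoose_eq]; exact Nat.choose_pos (by omega)
  have hcR : (Nat.multichoose (q + 1 + a) (l + 1) : ℝ) * (l + 1)
      = Nat.multichoose (q + 1 + a) l * (l + (q + 1 + a : ℕ)) := by exact_mod_cast hc
  have hpR : (Nat.multichoose (q + 1 + a) l : ℝ) ≠ 0 := by positivity
  have hpR' : (Nat.multichoose (q + 1 + a) (l + 1) : ℝ) ≠ 0 := by positivity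
  have hm : ((l : ℝ) + (q + 1 + a : ℕ)) ≠ 0 := by positivity
  rw [hw, Nat.multichoose_succ_succ a l]
  have h5 : ((l : ℝ) + 1) / (l + (q + 1 + a : ℕ)) =
      Nat.multichoose (q + 1 + a) l / Nat.multichoose (q + 1 + a) (l + 1) := by
    rw [div_eq_div_iff hm hpR']
    linarith
  rw [h5, Nat.cast_add]
  field_simp
  ring

theorem one_sub_PhiMap_leftModel (m q : Fin k → ℕ) (i : Fin k) (hq : q i + 1 ≤ m i)
    (T : FockTensor ι →L[ℂ] FockTensor ι)
    (hT : ∀ f α, T f α = (defectEigenvalue m q α : ℂ) * f α) (f : FockTensor ι) (α : MultiWord ι) :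
    (1 - PhiMap (leftModel ι m i)) T f α =
      (defectEigenvalue m (Function.update q i (q i + 1)) α : ℂ) * f α := by
  classical
  have hsplit : ∀ (q' : Fin k → ℕ) (β : MultiWord ι), defectEigenvalue m q' β =
      ((Nat.multichoose (m i - q' i) (β i).length : ℝ) / Nat.multichoose (m i) (β i).length) *
      ∏ l ∈ Finset.univ.erase i,
        ((Nat.multichoose (m l - q' l) (β l).length : ℝ) / Nat.multichoose (m l) (β l).length) :=
    fun q' β => (Finset.mul_prod_erase _ _ (Finset.mem_univ i)).symm
  have hrest : ∀ (β γ : MultiWord ι), (∀ l, l ≠ i → β l = γ l) →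
      ∏ l ∈ Finset.univ.erase i, ((Nat.multichoose (m l - q l) (β l).length : ℝ) /
          Nat.multichoose (m l) (β l).length) =
      ∏ l ∈ Finset.univ.erase i, ((Nat.multichoose (m l - Function.update q i (q i + 1) l)
          (γ l).length : ℝ) / Nat.multichoose (m l) (γ l).length) := by
    intro β γ h
    refine Finset.prod_congr rfl fun l hl => ?_
    have hl' := Finset.ne_of_mem_erase hl
    rw [Function.update_of_ne hl', h l hl']
  have hsub : (1 - PhiMap (leftModel ι m i)) T f α = T f α - PhiMap (leftModel ι m i) T f α := by
    simp
  rw [hsub]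
  rcases hα : FreeMonoid.toList (α i) with _ | ⟨j, t⟩
  · have h1 : α i = 1 := hα
    rw [PhiMap_leftModel_apply_one _ _ _ _ _ h1, sub_zero, hT, hsplit q, hsplit _ α,
      hrest α α (fun _ _ => rfl), h1]
    simp [Nat.multichoose_zero_right]
  · obtain ⟨γ, rfl⟩ : ∃ γ, α = prependLetter i j γ := by
      refine ⟨Function.update α i (FreeMonoid.ofList t), ?_⟩
      funext l
      by_cases hl : l = i
      · subst hl
        simp only [prependLetter, Function.update_self]
        exact hα
      · simp [prependLetter, hl]
    rw [PhiMap_leftModel_apply_prepend m i j T (fun α => (defectEigenvalue m q α : ℂ)) hT, hT,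
      ← sub_mul]
    congr 1
    have hlen : (prependLetter i j γ i).length = (γ i).length + 1 := by
      simp [prependLetter, add_comm]
    have hne : ∀ l, l ≠ i → prependLetter i j γ l = γ l := by
      intro l hl; simp [prependLetter, hl]
    rw [hsplit q (prependLetter i j γ), hsplit q γ,
      hsplit (Function.update q i (q i + 1)) (prependLetter i j γ),
      hrest (prependLetter i j γ) (prependLetter i j γ) (fun _ _ => rfl),
      hrest γ (prependLetter i j γ) (fun l hl => (hne l hl).symm), hlen, Function.update_self,
      ← weight_sq_mul (m i) (q i) (γ i).length hq]
    push_cast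
    ring

theorem pow_one_sub_PhiMap_leftModel (m q : Fin k → ℕ) (i : Fin k) (p : ℕ) (hq : q i + p ≤ m i)
    (T : FockTensor ι →L[ℂ] FockTensor ι)
    (hT : ∀ f α, T f α = (defectEigenvalue m q α : ℂ) * f α) (f : FockTensor ι) (α : MultiWord ι) :
    ((1 - PhiMap (leftModel ι m i)) ^ p) T f α =
      (defectEigenvalue m (Function.update q i (q i + p)) α : ℂ) * f α := by
  induction p generalizing f α with
  | zero => simpa using hT f α
  | succ p ih =>
    rw [pow_succ', Module.End.mul_apply]
    have := one_sub_PhiMap_leftModel m (Function.update q i (q i + p)) i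
      (by simpa using (by omega : q i + p + 1 ≤ m i)) _ (ih (by omega)) f α
    simpa [add_assoc] using this

theorem list_prod_leftModel (m p : Fin k → ℕ) (hp : p ≤ m) (L : List (Fin k)) (hL : L.Nodup)
    (hm : ∀ i, 1 ≤ m i) (f : FockTensor ι) (α : MultiWord ι) :
    ((L.map fun i => (1 - PhiMap (leftModel ι m i)) ^ p i).prod 1) f α =
      (defectEigenvalue m (fun i => if i ∈ L then p i else 0) α : ℂ) * f α := by
  induction L generalizing f α with
  | nil =>
    have : defectEigenvalue m (fun i => if i ∈ ([] : List (Fin k)) then p i else 0) α = 1 := by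
      refine Finset.prod_eq_one fun i _ => ?_
      have : 0 < Nat.multichoose (m i) (α i).length := by
        rw [Nat.multichoose_eq]; exact Nat.choose_pos (by have := hm i; omega)
      simp only [List.not_mem_nil, if_false, Nat.sub_zero]
      exact div_self (by positivity)
    rw [this]; simp
  | cons i L ih =>
    rw [List.nodup_cons] at hL
    rw [List.map_cons, List.prod_cons, Module.End.mul_apply]
    rw [pow_one_sub_PhiMap_leftModel m _ i (p i) (by simpa [hL.1] using hp i) _ (ih hL.2)]
    congr 3
    funext l
    by_cases hl : l = i
    · subst hl; simp [hL.1]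
    · simp [hl]

theorem leftModel_mem_polyHyperball (m : Fin k → ℕ) (hm : ∀ i, 1 ≤ m i) :
    leftModel ι m ∈ polyHyperball ι m (FockTensor ι) := by
  refine ⟨fun p q hpq a b => leftModel_commute m p q hpq a b, fun p hp => ?_⟩
  have hd : ∀ f α, (defectMap (leftModel ι m) p 1) f α = (defectEigenvalue m p α : ℂ) * f α := by
    intro f α
    have := list_prod_leftModel m p hp (List.finRange k) (List.nodup_finRange k) hm f α
    rw [← List.ofFn_eq_map] at this
    simpa [defectMap] using this
  have hpos : ∀ α : MultiWord ι, 0 ≤ defectEigenvalue m p α :=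
    fun α => Finset.prod_nonneg fun i _ => by positivity
  rw [ContinuousLinearMap.isPositive_iff_complex]
  intro f
  have hs := lp.hasSum_inner (𝕜 := ℂ) (defectMap (leftModel ι m) p 1 f) f
  have hr : HasSum (fun α => (((defectEigenvalue m p α * ‖f α‖ ^ 2 : ℝ)) : ℂ))
      (inner ℂ (defectMap (leftModel ι m) p 1 f) f) := by
    have he : (fun α => (((defectEigenvalue m p α * ‖f α‖ ^ 2 : ℝ)) : ℂ)) =
        fun α => inner ℂ (defectMap (leftModel ι m) p 1 f α) (f α) := by
      funext α
      rw [hd]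
      simp only [RCLike.inner_apply, map_mul, Complex.conj_ofReal]
      push_cast
      rw [← Complex.mul_conj']
      ring
    rw [he]
    exact hs
  have hre := Complex.hasSum_re hr
  have him := Complex.hasSum_im hr
  simp only [Complex.ofReal_re] at hre
  simp only [Complex.ofReal_im] at him
  refine ⟨?_, ?_⟩
  · have h0 : (inner ℂ (defectMap (leftModel ι m) p 1 f) f).im = 0 := him.unique hasSum_zero
    apply Complex.ext
    · simp
    · simp [h0]
  · exact hre.nonneg fun α => mul_nonneg (hpos α) (sq_nonneg _)

variable (ι)

/-- The element `r W` of the radial poly-hyperball, for `r ∈ [0,1)`. -/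
def radialModel (m : Fin k → ℕ) (hm : ∀ i, 1 ≤ m i) (r : Set.Ico (0 : ℝ) 1) :
    radialPolyHyperball ι m (FockTensor ι) :=
  ⟨fun i j => ((r : ℝ) : ℂ) • leftModel ι m i j,
    r, r.2.1, r.2.2, leftModel ι m, leftModel_mem_polyHyperball m hm, rfl⟩

end Model

/-! ## Free pluriharmonic functions -/

section Pluriharmonic

variable {k : ℕ} (ι : Fin k → Type u) [∀ i, Fintype (ι i)] (m : Fin k → ℕ)
  (K : Type v) [NormedAddCommGroup K] [InnerProductSpace ℂ K]

/-- Functions on the radial poly-hyperball with coefficients in `B(K)`: for every Hilbert space `H`,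
a map from the radial part of `D_n^m(H)` to `B(K ⊗ H)`. -/
abbrev RadialFunction : Type (max (u + 1) v) :=
  ∀ (H : Type u) [NormedAddCommGroup H] [InnerProductSpace ℂ H] [CompleteSpace H],
    radialPolyHyperball ι m H → (HilbertTensor K H →L[ℂ] HilbertTensor K H)

variable {ι K}

/-- The multi-homogeneous polynomial of degree `s ∈ ℤ^k`,
`q_s(X, X^*) = ∑ A_{(α,β)} ⊗ X_α X_β^*`, where the sum is over all `α`, `β` with `|α_i| = s_i⁺`
and `|β_i| = s_i⁻`. -/
def homogeneousPart {H : Type w} [NormedAddCommGroup H] [InnerProductSpace ℂ H] [CompleteSpace H]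
    (A : MultiWord ι → MultiWord ι → K →L[ℂ] K) (s : Fin k → ℤ) (X : ∀ i, ι i → H →L[ℂ] H) :
    HilbertTensor K H →L[ℂ] HilbertTensor K H :=
  ∑ α ∈ Fintype.piFinset fun i => wordsOfLength (ι i) (s i).toNat,
    ∑ β ∈ Fintype.piFinset fun i => wordsOfLength (ι i) (-s i).toNat,
      tensorOp (A α β) (monomialOp X α * star (monomialOp X β))

variable {m}

/-- `F` is a free `k`-pluriharmonic function: there are coefficients `A_{(α,β)} ∈ B(K)` such that
`F(X) = ∑_{s ∈ ℤ^k} q_s(X, X^*)`, with convergence in the operator norm, for every Hilbert space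
`H` and every `X` in the radial part of `D_n^m(H)`. -/
def IsFreePluriharmonic (F : RadialFunction ι m K) : Prop :=
  ∃ A : MultiWord ι → MultiWord ι → K →L[ℂ] K,
    ∀ (H : Type u) [NormedAddCommGroup H] [InnerProductSpace ℂ H] [CompleteSpace H]
      (X : radialPolyHyperball ι m H),
      HasSum (fun s : Fin k → ℤ => homogeneousPart A s X.1) (F H X)

/-- `F` is bounded: `sup ‖F(X)‖ < ∞`, the supremum being over all Hilbert spaces `H` and all `X` in
the radial part of `D_n^m(H)`. -/
def IsBoundedRadial (F : RadialFunction ι m K) : Prop :=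
  ∃ C : ℝ, ∀ (H : Type u) [NormedAddCommGroup H] [InnerProductSpace ℂ H] [CompleteSpace H]
    (X : radialPolyHyperball ι m H), ‖F H X‖ ≤ C

end Pluriharmonic

/-! ## The Brown–Halmos condition and operator topologies -/

section BrownHalmos

variable {k : ℕ} (ι : Fin k → Type u) [∀ i, Fintype (ι i)] (m : Fin k → ℕ)
  (K : Type v) [NormedAddCommGroup K] [InnerProductSpace ℂ K]

/-- The operators `I_K ⊗ Λ_{i,j}` on `K ⊗ F²(H_{n_1}) ⊗ ⋯ ⊗ F²(H_{n_k})`. -/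
def ampRightModel (i : Fin k) (j : ι i) :
    HilbertTensor K (FockTensor ι) →L[ℂ] HilbertTensor K (FockTensor ι) :=
  tensorOp 1 (rightModel ι m i j)

open ContinuousLinearMap in
/-- The Cauchy dual `Λ_i' = Λ_i (Λ_i^* Λ_i)⁻¹` of the row operator
`Λ_i = [I_K ⊗ Λ_{i,1} ⋯ I_K ⊗ Λ_{i,n_i}]`. Here `Λ_i^* Λ_i` is an invertible element of the algebra
of bounded operators on the direct sum, and `Ring.inverse` is its inverse. -/
def cauchyDual (i : Fin k) : PiLp 2 (fun _ : ι i => HilbertTensor K (FockTensor ι)) →L[ℂ]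
    HilbertTensor K (FockTensor ι) :=
  rowOp (ampRightModel ι m K i) ∘L
    Ring.inverse (adjoint (rowOp (ampRightModel ι m K i)) ∘L rowOp (ampRightModel ι m K i))

variable {ι K}

open ContinuousLinearMap in
/-- The Brown–Halmos condition
`Λ_i'^* T Λ_i' = diag_{n_i} (∑_{j=0}^{m_i-1} (-1)^j C(m_i, j+1) ∑_{|β|=j} Λ_{i,β} T Λ_{i,β}^*)` for
all `i`. -/
def BrownHalmos (T : HilbertTensor K (FockTensor ι) →L[ℂ] HilbertTensor K (FockTensor ι)) : Prop :=
  ∀ i : Fin k,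
    adjoint (cauchyDual ι m K i) ∘L T ∘L cauchyDual ι m K i =
      diagOp (ι i) (∑ j ∈ Finset.range (m i), ((-1 : ℂ) ^ j * ((m i).choose (j + 1) : ℂ)) •
        ∑ β ∈ wordsOfLength (ι i) j,
          FreeMonoid.lift (ampRightModel ι m K i) β * T *
            star (FreeMonoid.lift (ampRightModel ι m K i) β))

variable (ι K)

/-- The linear span of the operators `C ⊗ W_α W_β^*`, with `C ∈ B(K)` and `(α, β) ∈ J`. -/
def toeplitzSpan :
    Submodule ℂ (HilbertTensor K (FockTensor ι) →L[ℂ] HilbertTensor K (FockTensor ι)) :=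
  Submodule.span ℂ {S | ∃ (C : K →L[ℂ] K) (α β : MultiWord ι), (α, β) ∈ pairsJ ι ∧
    S = tensorOp C (monomialOp (leftModel ι m) α * star (monomialOp (leftModel ι m) β))}

end BrownHalmos

/-- The closure of a set of bounded operators in the strong operator topology. -/
def sotClosure {E : Type v} [NormedAddCommGroup E] [InnerProductSpace ℂ E] (S : Set (E →L[ℂ] E)) :
    Set (E →L[ℂ] E) :=
  {T | ContinuousLinearMap.toPointwiseConvergenceCLM ℂ (RingHom.id ℂ) E E T ∈
    closure (ContinuousLinearMap.toPointwiseConvergenceCLM ℂ (RingHom.id ℂ) E E '' S)}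

/-- The closure of a set of bounded operators in the weak operator topology. -/
def wotClosure {E : Type v} [NormedAddCommGroup E] [InnerProductSpace ℂ E] (S : Set (E →L[ℂ] E)) :
    Set (E →L[ℂ] E) :=
  {T | ContinuousLinearMapWOT.ofCLM T ∈ closure
    ((ContinuousLinearMapWOT.ofCLM : (E →L[ℂ] E) → (E →WOT[ℂ] E)) '' S)}

end

/-!
The theorem identifies four descriptions of the operators `T` on `K ⊗ F`, where `F` is the tensor
product of the full Fock spaces, by reducing each of them to one statement about matrix
coefficients.

Let `b_l` be the coefficients of `∏ (1 - x_i)^{-m_i}` and put `b_γ = b_{(|γ_1|, …, |γ_k|)}`. On the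
vectors `f_γ = e_γ / √b_γ` the weighted creation operators are plain shifts, so their adjoints, and
also the Cauchy duals of the right creation operators, act by adding or removing letters on the dual
basis `f'_γ = √b_γ e_γ`. Every pair of multi-words can be written `(α γ, β δ)` with `(α, β) ∈ J` and
`γ`, `δ` of equal multi-length, and `T` is called Toeplitz if its coefficients
`T_{α γ, β δ} = (f'_{α γ})^* T f'_{β δ}` vanish for `γ ≠ δ` and equal `b_γ A_{α, β}` for `γ = δ`
(`HasToeplitzCoeffs`).

* The Brown–Halmos condition is the recursion `b_{n+1} = ∑_l (-1)^l C(m_i, l+1) b_{n-l}`, which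
  comes from `(1 - x)^{m_i} ∑ b_n x^n = 1`, for the coefficients of `T` along the `i`-th coordinate.
  Solving it one coordinate at a time shows that it is equivalent to the Toeplitz property
  (`brownHalmos_iff_hasToeplitzCoeffs`).
* Let `T` be Toeplitz and `X` a point of the radial poly-hyperball, and write the defect operator of
  `X` as `B^* B`. The Berezin kernel `x ⊗ h ↦ ∑_α (x ⊗ f'_α) ⊗ B X_α^* h` is an isometry `V`, and the
  Toeplitz property turns the double series for `V^* (T ⊗ 1) V`, summed over the pairs of degrees
  with a fixed difference `s ∈ ℤ^k`, into the `s`-homogeneous part of the pluriharmonic series with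
  coefficients `A`. So that series converges, and its sum has norm at most `‖T‖`
  (`exists_hasSum_homogeneousPart`).
* The value of the series at `r W` has the coefficients of `T` damped by powers of `r`
  (`hasToeplitzCoeffs_of_hasSum`). By Parseval's identity and the uniform bound it tends strongly to
  `T` (`tendsto_of_hasToeplitzCoeffs`), and conversely a radial limit determines the coefficients of
  the series, which gives uniqueness (`existsUnique_of_hasToeplitzCoeffs`).
* The values at `r W` are norm limits of elements of the span of the operators `C ⊗ W_α W_β^*`, so
  radial limits lie in its strong closure and hence in its weak closure. The Toeplitz relations hold
  on the span and are equalities between weakly continuous functionals, so they hold on the weak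
  closure (`hasToeplitzCoeffs_of_mem_wotClosure`).
-/

noncomputable section

/-! ### Operators between Hilbert space tensor products -/

section Tensor

variable {K₁ K₂ K₃ H₁ H₂ H₃ : Type*}
  [NormedAddCommGroup K₁] [InnerProductSpace ℂ K₁] [NormedAddCommGroup K₂] [InnerProductSpace ℂ K₂]
  [NormedAddCommGroup K₃] [InnerProductSpace ℂ K₃] [NormedAddCommGroup H₁] [InnerProductSpace ℂ H₁]
  [NormedAddCommGroup H₂] [InnerProductSpace ℂ H₂] [NormedAddCommGroup H₃] [InnerProductSpace ℂ H₃]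

/-- The elementary tensor `x ⊗ y` in the Hilbert space tensor product. -/
def pureTensor (x : K₁) (y : H₁) : HilbertTensor K₁ H₁ := ((x ⊗ₜ[ℂ] y : K₁ ⊗[ℂ] H₁) : _)

theorem inner_pureTensor (x x' : K₁) (y y' : H₁) :
    inner ℂ (pureTensor x y) (pureTensor x' y') = inner ℂ x x' * inner ℂ y y' := by
  simp [pureTensor]

theorem norm_pureTensor (x : K₁) (y : H₁) : ‖pureTensor x y‖ = ‖x‖ * ‖y‖ := by
  simp [pureTensor]

theorem pureTensor_add_left (x x' : K₁) (y : H₁) :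
    pureTensor (x + x') y = pureTensor x y + pureTensor x' y := by
  rw [pureTensor, TensorProduct.add_tmul, UniformSpace.Completion.coe_add]; rfl

theorem pureTensor_add_right (x : K₁) (y y' : H₁) :
    pureTensor x (y + y') = pureTensor x y + pureTensor x y' := by
  rw [pureTensor, TensorProduct.tmul_add, UniformSpace.Completion.coe_add]; rfl

theorem pureTensor_smul_left (c : ℂ) (x : K₁) (y : H₁) :
    pureTensor (c • x) y = c • pureTensor x y := by
  rw [pureTensor, ← TensorProduct.smul_tmul', UniformSpace.Completion.coe_smul]; rfl

theorem pureTensor_smul_right (c : ℂ) (x : K₁) (y : H₁) :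
    pureTensor x (c • y) = c • pureTensor x y := by
  simp [pureTensor]

/-- The map `y ↦ x ⊗ y` as a bounded operator. -/
def pureTensorL (x : K₁) : H₁ →L[ℂ] HilbertTensor K₁ H₁ :=
  LinearMap.mkContinuous
    { toFun := pureTensor x
      map_add' := pureTensor_add_right x
      map_smul' := fun c y => pureTensor_smul_right c x y } ‖x‖
    fun y => (norm_pureTensor x y).le

@[simp] theorem pureTensorL_apply (x : K₁) (y : H₁) : pureTensorL x y = pureTensor x y := rfl

theorem hilbertTensor_ext {E : Type*} [NormedAddCommGroup E] [InnerProductSpace ℂ E]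
    {S T : HilbertTensor K₁ H₁ →L[ℂ] E}
    (h : ∀ x y, S (pureTensor x y) = T (pureTensor x y)) : S = T := by
  ext z
  induction z using UniformSpace.Completion.induction_on with
  | hp => exact isClosed_eq S.continuous T.continuous
  | ih z =>
    induction z using TensorProduct.induction_on with
    | zero => exact (map_zero S).trans (map_zero T).symm
    | tmul x y => exact h x y
    | add a b ha hb => rw [UniformSpace.Completion.coe_add, map_add, map_add, ha, hb]

/-- The operator `A ⊗ B : K₁ ⊗ H₁ → K₂ ⊗ H₂` between Hilbert space tensor products. -/
def tensorMap (A : K₁ →L[ℂ] K₂) (B : H₁ →L[ℂ] H₂) : HilbertTensor K₁ H₁ →L[ℂ] HilbertTensor K₂ H₂ :=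
  (TensorProduct.mapL A B).completion

theorem tensorOp_eq_tensorMap (A : K₁ →L[ℂ] K₁) (B : H₁ →L[ℂ] H₁) :
    tensorOp A B = tensorMap A B := rfl

@[simp] theorem tensorMap_pureTensor (A : K₁ →L[ℂ] K₂) (B : H₁ →L[ℂ] H₂) (x : K₁) (y : H₁) :
    tensorMap A B (pureTensor x y) = pureTensor (A x) (B y) := by
  simp [tensorMap, pureTensor]

@[simp] theorem tensorOp_pureTensor (A : K₁ →L[ℂ] K₁) (B : H₁ →L[ℂ] H₁) (x : K₁) (y : H₁) :
    tensorOp A B (pureTensor x y) = pureTensor (A x) (B y) :=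
  tensorMap_pureTensor A B x y

theorem tensorMap_comp (A : K₂ →L[ℂ] K₃) (A' : K₁ →L[ℂ] K₂) (B : H₂ →L[ℂ] H₃) (B' : H₁ →L[ℂ] H₂) :
    tensorMap A B ∘L tensorMap A' B' = tensorMap (A ∘L A') (B ∘L B') :=
  hilbertTensor_ext fun x y => by simp

theorem tensorMap_add_right (A : K₁ →L[ℂ] K₂) (B B' : H₁ →L[ℂ] H₂) :
    tensorMap A (B + B') = tensorMap A B + tensorMap A B' :=
  hilbertTensor_ext fun x y => by simp [pureTensor_add_right]

theorem tensorMap_smul_left (c : ℂ) (A : K₁ →L[ℂ] K₂) (B : H₁ →L[ℂ] H₂) :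
    tensorMap (c • A) B = c • tensorMap A B :=
  hilbertTensor_ext fun x y => by simp [pureTensor_smul_left]

theorem tensorMap_smul_right (c : ℂ) (A : K₁ →L[ℂ] K₂) (B : H₁ →L[ℂ] H₂) :
    tensorMap A (c • B) = c • tensorMap A B :=
  hilbertTensor_ext fun x y => by simp [pureTensor_smul_right]

@[simp] theorem tensorMap_zero_left (B : H₁ →L[ℂ] H₂) : tensorMap (0 : K₁ →L[ℂ] K₂) B = 0 := by
  simpa using tensorMap_smul_left 0 (0 : K₁ →L[ℂ] K₂) B

theorem tensorMap_one_one : tensorMap (1 : K₁ →L[ℂ] K₁) (1 : H₁ →L[ℂ] H₁) = 1 :=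
  hilbertTensor_ext fun x y => by simp

theorem tensorOp_one_mul (B B' : H₁ →L[ℂ] H₁) :
    tensorOp (1 : K₁ →L[ℂ] K₁) (B * B') = tensorOp 1 B * tensorOp 1 B' :=
  hilbertTensor_ext fun x y => by simp

theorem norm_tensorMap_le (A : K₁ →L[ℂ] K₂) (B : H₁ →L[ℂ] H₂) :
    ‖tensorMap A B‖ ≤ ‖A‖ * ‖B‖ := by
  refine ContinuousLinearMap.opNorm_le_bound _ (by positivity) fun z => ?_
  induction z using UniformSpace.Completion.induction_on with
  | hp => exact isClosed_le (by fun_prop) (by fun_prop)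
  | ih z =>
    simp only [tensorMap, ContinuousLinearMap.completion_apply_coe, UniformSpace.Completion.norm_coe]
    exact (ContinuousLinearMap.le_opNorm _ _).trans
      (mul_le_mul_of_nonneg_right (TensorProduct.norm_mapL_le A B) (norm_nonneg _))

@[simp] theorem tensorMap_zero_right (A : K₁ →L[ℂ] K₂) : tensorMap A (0 : H₁ →L[ℂ] H₂) = 0 := by
  simpa using tensorMap_smul_right 0 A (0 : H₁ →L[ℂ] H₂)

/-- The map `B ↦ A ⊗ B` as a homomorphism of additive groups. -/
def tensorMapHom (A : K₁ →L[ℂ] K₂) :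
    (H₁ →L[ℂ] H₂) →+ (HilbertTensor K₁ H₁ →L[ℂ] HilbertTensor K₂ H₂) where
  toFun := tensorMap A
  map_add' := fun B B' => tensorMap_add_right A B B'
  map_zero' := tensorMap_zero_right A

theorem continuous_tensorMapHom (A : K₁ →L[ℂ] K₂) :
    Continuous (tensorMapHom A : (H₁ →L[ℂ] H₂) →+ _) :=
  AddMonoidHomClass.continuous_of_bound (tensorMapHom A) ‖A‖ fun B => norm_tensorMap_le A B

theorem tensorMap_sum_right {J : Type*} (s : Finset J) (A : K₁ →L[ℂ] K₂) (B : J → H₁ →L[ℂ] H₂) :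
    tensorMap A (∑ j ∈ s, B j) = ∑ j ∈ s, tensorMap A (B j) :=
  map_sum (tensorMapHom A) B s

theorem HasSum.tensorMap_right {J : Type*} {B : J → H₁ →L[ℂ] H₂} {S : H₁ →L[ℂ] H₂}
    (h : HasSum B S) (A : K₁ →L[ℂ] K₂) : HasSum (fun j => tensorMap A (B j)) (tensorMap A S) :=
  h.map (tensorMapHom A) (continuous_tensorMapHom A)

variable [CompleteSpace K₁] [CompleteSpace K₂] [CompleteSpace H₁] [CompleteSpace H₂]

theorem adjoint_tensorMap (A : K₁ →L[ℂ] K₂) (B : H₁ →L[ℂ] H₂) :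
    ContinuousLinearMap.adjoint (tensorMap A B) =
      tensorMap (ContinuousLinearMap.adjoint A) (ContinuousLinearMap.adjoint B) := by
  refine hilbertTensor_ext fun x y => ?_
  -- Both vectors have the same inner product with each elementary tensor.
  have h : innerSL ℂ (ContinuousLinearMap.adjoint (tensorMap A B) (pureTensor x y)) =
      innerSL ℂ (tensorMap (ContinuousLinearMap.adjoint A) (ContinuousLinearMap.adjoint B)
        (pureTensor x y)) := by
    refine hilbertTensor_ext fun x' y' => ?_
    simp only [innerSL_apply_apply, ContinuousLinearMap.adjoint_inner_left, tensorMap_pureTensor,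
      inner_pureTensor]
  refine ext_inner_right ℂ fun z => ?_
  simpa using DFunLike.congr_fun h z

theorem star_tensorOp (A : K₁ →L[ℂ] K₁) (B : H₁ →L[ℂ] H₁) :
    star (tensorOp A B) = tensorOp (star A) (star B) :=
  adjoint_tensorMap A B

end Tensor

/-! ### Ordered products of commuting families -/

section OrderedProducts

theorem List.prod_ofFn_mul_prod_ofFn {R : Type*} [Monoid R] {k : ℕ} (a b : Fin k → R)
    (h : ∀ i j, i ≠ j → Commute (a i) (b j)) :
    (List.ofFn a).prod * (List.ofFn b).prod = (List.ofFn fun i => a i * b i).prod := by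
  induction k with
  | zero => simp
  | succ k ih =>
    simp only [List.ofFn_succ, List.prod_cons]
    rw [← ih _ _ fun i j hij => h _ _ (by simpa using hij)]
    have hc : Commute (List.ofFn fun i : Fin k => a i.succ).prod (b 0) := by
      refine Commute.list_prod_left _ _ fun x hx => ?_
      obtain ⟨i, rfl⟩ := List.mem_ofFn.1 hx
      exact h _ _ (Fin.succ_ne_zero i)
    rw [mul_assoc, ← mul_assoc _ (b 0), hc.eq]
    simp only [mul_assoc]

theorem List.prod_ofFn_eq_single {R : Type*} [Monoid R] {k : ℕ} (a : Fin k → R) (i : Fin k)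
    (h : ∀ l, l ≠ i → a l = 1) : (List.ofFn a).prod = a i := by
  induction k with
  | zero => exact i.elim0
  | succ k ih =>
    rw [List.ofFn_succ, List.prod_cons]
    rcases Fin.eq_zero_or_eq_succ i with rfl | ⟨i, rfl⟩
    · rw [List.prod_eq_one, mul_one]
      intro x hx
      obtain ⟨l, rfl⟩ := List.mem_ofFn.1 hx
      exact h _ (Fin.succ_ne_zero l)
    · rw [h 0 (Fin.succ_ne_zero i).symm, one_mul]
      exact ih _ i fun l hl => h _ (by simpa using hl)

theorem List.prod_ofFn_mulSingle {k : ℕ} {M : Fin k → Type*} [∀ i, Monoid (M i)] (x : ∀ i, M i) :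
    (List.ofFn fun i => Pi.mulSingle i (x i)).prod = x := by
  funext l
  change Pi.evalMonoidHom M l (List.ofFn fun i => Pi.mulSingle i (x i)).prod = x l
  rw [map_list_prod, List.map_ofFn, List.prod_ofFn_eq_single _ l]
  · simp
  · intro i hi
    simp [Ne.symm hi]

theorem List.prod_ofFn_sum {R : Type*} [Semiring R] {k : ℕ} {κ : Fin k → Type*}
    (f : ∀ i, κ i → R) (s : ∀ i, Finset (κ i)) :
    (List.ofFn fun i => ∑ j ∈ s i, f i j).prod =
      ∑ d ∈ Fintype.piFinset s, (List.ofFn fun i => f i (d i)).prod :=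
  (MultilinearMap.mkPiAlgebraFin ℕ k R).map_sum_finset f s

theorem List.prod_ofFn_smul {S R : Type*} [CommSemiring S] [Semiring R] [Algebra S R] {k : ℕ}
    (c : Fin k → S) (a : Fin k → R) :
    (List.ofFn fun i => c i • a i).prod = (∏ i, c i) • (List.ofFn a).prod :=
  (MultilinearMap.mkPiAlgebraFin S k R).map_smul_univ c a

theorem summable_pi_prod {k : ℕ} (f : Fin k → ℕ → ℝ) (h0 : ∀ i n, 0 ≤ f i n)
    (hf : ∀ i, Summable (f i)) : Summable fun d : Fin k → ℕ => ∏ i, f i (d i) := by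
  induction k with
  | zero => exact Summable.of_finite
  | succ k ih =>
    rw [← (Fin.consEquiv fun _ => ℕ).summable_iff]
    refine ((hf 0).mul_of_nonneg (ih (fun i => f i.succ) (fun i => h0 i.succ)
      fun i => hf i.succ) (h0 0) fun d => Finset.prod_nonneg fun i _ => h0 i.succ _).congr ?_
    intro p
    simp [Fin.prod_univ_succ, Fin.consEquiv]

theorem hasSum_pi_prod {R : Type*} [NormedRing R] [NormOneClass R] [CompleteSpace R] {k : ℕ}
    (f : Fin k → ℕ → R) (a : Fin k → R) (hf : ∀ i, HasSum (f i) (a i))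
    (hs : ∀ i, Summable fun n => ‖f i n‖) :
    HasSum (fun d : Fin k → ℕ => (List.ofFn fun i => f i (d i)).prod) (List.ofFn a).prod := by
  induction k with
  | zero => simp
  | succ k ih =>
    rw [← (Fin.consEquiv fun _ => ℕ).hasSum_iff, List.ofFn_succ, List.prod_cons]
    have hn : Summable fun d : Fin k → ℕ => ‖(List.ofFn fun i => f i.succ (d i)).prod‖ := by
      refine .of_nonneg_of_le (fun _ => norm_nonneg _) (fun d => ?_)
        (summable_pi_prod (fun (i : Fin k) n => ‖f i.succ n‖) (fun _ _ => norm_nonneg _)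
          fun i => hs i.succ)
      refine (List.norm_prod_le _).trans_eq ?_
      rw [List.map_ofFn, List.prod_ofFn]
      rfl
    have h2 : HasSum (fun d : Fin k → ℕ => (List.ofFn fun i => f i.succ (d i)).prod)
        (List.ofFn fun i => a i.succ).prod :=
      ih (fun i => f i.succ) (fun i => a i.succ) (fun i => hf i.succ) fun i => hs i.succ
    have h3 : Summable fun p : ℕ × (Fin k → ℕ) =>
        f 0 p.1 * (List.ofFn fun i => f i.succ (p.2 i)).prod :=
      summable_mul_of_summable_norm (f := f 0)
        (g := fun d : Fin k → ℕ => (List.ofFn fun i => f i.succ (d i)).prod) (hs 0) hn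
    have h4 : HasSum (fun p : ℕ × (Fin k → ℕ) =>
        f 0 p.1 * (List.ofFn fun i => f i.succ (p.2 i)).prod)
        (a 0 * (List.ofFn fun i => a i.succ).prod) := by
      rw [← (hf 0).tsum_eq, ← h2.tsum_eq, tsum_mul_tsum_of_summable_norm (f := f 0)
        (g := fun d : Fin k → ℕ => (List.ofFn fun i => f i.succ (d i)).prod) (hs 0) hn]
      exact h3.hasSum
    have h5 : (fun d : Fin (k + 1) → ℕ => (List.ofFn fun i => f i (d i)).prod) ∘
        (Fin.consEquiv fun _ => ℕ) =
        fun p : ℕ × (Fin k → ℕ) => f 0 p.1 * (List.ofFn fun i => f i.succ (p.2 i)).prod := by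
      funext p
      simp [Fin.consEquiv, List.ofFn_succ]
    rw [h5]
    exact h4

end OrderedProducts

/-! ### The completely positive maps of a row of operators -/

section PhiMap

theorem mem_wordsOfLength {J : Type*} [Finite J] {l : ℕ} {β : FreeMonoid J} :
    β ∈ wordsOfLength J l ↔ β.length = l :=
  (List.finite_length_eq J l).mem_toFinset

theorem sum_wordsOfLength_zero {J M : Type*} [Finite J] [AddCommMonoid M] (f : FreeMonoid J → M) :
    ∑ β ∈ wordsOfLength J 0, f β = f 1 := by
  have : wordsOfLength J 0 = {1} := by
    ext β
    rw [mem_wordsOfLength, Finset.mem_singleton]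
    exact List.length_eq_zero_iff
  rw [this, Finset.sum_singleton]

theorem sum_wordsOfLength_succ {J M : Type*} [Fintype J] [AddCommMonoid M] (l : ℕ)
    (f : FreeMonoid J → M) :
    ∑ β ∈ wordsOfLength J (l + 1), f β =
      ∑ j, ∑ β ∈ wordsOfLength J l, f (FreeMonoid.of j * β) := by
  rw [← Finset.sum_product']
  symm
  refine Finset.sum_bij (fun p _ => FreeMonoid.of p.1 * p.2) ?_ ?_ ?_ fun _ _ => rfl
  · rintro ⟨j, β⟩ h
    simp only [Finset.mem_product, mem_wordsOfLength] at h ⊢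
    rw [FreeMonoid.length_mul, h.2, FreeMonoid.length_of, add_comm]
  · rintro ⟨j, β⟩ - ⟨j', β'⟩ - h
    obtain ⟨h1, h2⟩ := List.cons.inj h
    exact Prod.ext h1 h2
  · intro β h
    rw [mem_wordsOfLength] at h
    obtain ⟨j, t, rfl⟩ := List.exists_cons_of_length_eq_add_one h
    refine ⟨(j, FreeMonoid.ofList t), ?_, rfl⟩
    simp only [Finset.mem_product, Finset.mem_univ, true_and, mem_wordsOfLength]
    exact Nat.succ.inj h

theorem mulLeftRight_mul {A : Type*} [Ring A] [Algebra ℂ A] (a b c d : A) :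
    LinearMap.mulLeftRight ℂ (a, b) * LinearMap.mulLeftRight ℂ (c, d) =
      LinearMap.mulLeftRight ℂ (a * c, d * b) := by
  ext1 Z
  simp [mul_assoc]

variable {J : Type u} [Fintype J] {H : Type w} [NormedAddCommGroup H] [InnerProductSpace ℂ H]
  [CompleteSpace H]

theorem PhiMap_apply (X : J → H →L[ℂ] H) (Z : H →L[ℂ] H) :
    PhiMap X Z = ∑ j, X j * Z * star (X j) := by
  simp [PhiMap]

/-- The `l`-th iterate of `Φ_X` is the sum of `Z ↦ X_β Z X_β^*` over the words of length `l`. -/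
theorem PhiMap_pow (X : J → H →L[ℂ] H) (l : ℕ) :
    PhiMap X ^ l = ∑ β ∈ wordsOfLength J l,
      LinearMap.mulLeftRight ℂ (FreeMonoid.lift X β, star (FreeMonoid.lift X β)) := by
  induction l with
  | zero =>
    rw [sum_wordsOfLength_zero, pow_zero]
    ext1 Z
    simp
  | succ l ih =>
    rw [sum_wordsOfLength_succ, pow_succ', ih]
    simp only [PhiMap, Finset.sum_mul, Finset.mul_sum, mulLeftRight_mul, map_mul, star_mul,
      FreeMonoid.lift_eval_of]
    exact Finset.sum_comm

theorem PhiMap_pow_apply (X : J → H →L[ℂ] H) (l : ℕ) (Z : H →L[ℂ] H) :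
    (PhiMap X ^ l) Z = ∑ β ∈ wordsOfLength J l,
      FreeMonoid.lift X β * Z * star (FreeMonoid.lift X β) := by
  simp [PhiMap_pow]

theorem PhiMap_smul (t : ℝ) (X : J → H →L[ℂ] H) :
    PhiMap (fun j => (t : ℂ) • X j) = ((t ^ 2 : ℝ) : ℂ) • PhiMap X := by
  ext1 Z
  simp only [PhiMap_apply, LinearMap.smul_apply, Finset.smul_sum]
  refine Finset.sum_congr rfl fun j _ => ?_
  simp only [star_smul, Complex.star_def, Complex.conj_ofReal, smul_mul_assoc, mul_smul_comm,
    smul_smul, Complex.ofReal_mul, sq]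

theorem PhiMap_commute {J' : Type*} [Fintype J'] (X : J → H →L[ℂ] H) (Y : J' → H →L[ℂ] H)
    (h : ∀ a b, Commute (X a) (Y b)) : Commute (PhiMap X) (PhiMap Y) := by
  refine Commute.sum_left _ _ _ fun a _ => Commute.sum_right _ _ _ fun b _ => ?_
  rw [Commute, SemiconjBy, mulLeftRight_mul, mulLeftRight_mul, (h a b).eq, ← star_mul, ← star_mul,
    (h a b).eq]

/-- If `Φ_X(I) ≤ I`, that is, if the row `X` is contractive, then `Φ_X` is contractive. -/
theorem norm_PhiMap_le (X : J → H →L[ℂ] H) (h : (1 - PhiMap X 1).IsPositive) (Z : H →L[ℂ] H) :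
    ‖PhiMap X Z‖ ≤ ‖Z‖ := by
  have hrow : ∀ x : H, ∑ j, ‖star (X j) x‖ ^ 2 ≤ ‖x‖ ^ 2 := by
    intro x
    have h1 := h.re_inner_nonneg_left x
    have h2 : inner ℂ (PhiMap X 1 x) x = ∑ j, ((‖star (X j) x‖ ^ 2 : ℝ) : ℂ) := by
      rw [PhiMap_apply, sum_apply, sum_inner]
      refine Finset.sum_congr rfl fun j _ => ?_
      rw [mul_one, mul_apply_eq_comp, ← ContinuousLinearMap.adjoint_inner_right,
        ← ContinuousLinearMap.star_eq_adjoint, inner_self_eq_norm_sq_to_K]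
      simp
    rw [sub_apply, inner_sub_left, h2, map_sub, one_apply_eq_self,
      inner_self_eq_norm_sq, ← Complex.ofReal_sum] at h1
    rw [RCLike.re_eq_complex_re, Complex.ofReal_re] at h1
    linarith
  refine ContinuousLinearMap.opNorm_le_bound _ (norm_nonneg _) fun x => ?_
  set y := PhiMap X Z x with hy
  have h1 : ‖y‖ * ‖y‖ ≤ ‖Z‖ * ‖x‖ * ‖y‖ := by
    calc ‖y‖ * ‖y‖ = ‖inner ℂ y y‖ := by rw [inner_self_eq_norm_sq_to_K]; simp [sq]
      _ = ‖∑ j, inner ℂ (Z (star (X j) x)) (star (X j) y)‖ := by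
        nth_rw 1 [hy]
        rw [PhiMap_apply, sum_apply, sum_inner]
        congr 1
        refine Finset.sum_congr rfl fun j _ => ?_
        rw [ContinuousLinearMap.star_eq_adjoint, ContinuousLinearMap.adjoint_inner_right]
        rfl
      _ ≤ ∑ j, ‖Z‖ * (‖star (X j) x‖ * ‖star (X j) y‖) := by
        refine norm_sum_le_of_le _ fun j _ => (norm_inner_le_norm _ _).trans ?_
        rw [← mul_assoc]
        exact mul_le_mul_of_nonneg_right (Z.le_opNorm _) (norm_nonneg _)
      _ ≤ ‖Z‖ * (√(∑ j, ‖star (X j) x‖ ^ 2) * √(∑ j, ‖star (X j) y‖ ^ 2)) := by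
        rw [← Finset.mul_sum]
        exact mul_le_mul_of_nonneg_left (Real.sum_mul_le_sqrt_mul_sqrt _ _ _) (norm_nonneg _)
      _ ≤ ‖Z‖ * (‖x‖ * ‖y‖) := by
        gcongr
        · exact Real.sqrt_le_iff.2 ⟨norm_nonneg _, hrow x⟩
        · exact Real.sqrt_le_iff.2 ⟨norm_nonneg _, hrow y⟩
      _ = ‖Z‖ * ‖x‖ * ‖y‖ := by ring
  rcases (norm_nonneg y).eq_or_lt with h0 | h0
  · rw [← h0]; positivity
  · exact le_of_mul_le_mul_right h1 h0

end PhiMap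

/-! ### The Neumann series of the defect mapping -/

section Neumann

variable {k : ℕ} {ι : Fin k → Type u} [∀ i, Fintype (ι i)] {m : Fin k → ℕ}
  {H : Type w} [NormedAddCommGroup H] [InnerProductSpace ℂ H] [CompleteSpace H]

theorem defectMap_single (X : ∀ i, ι i → H →L[ℂ] H) (i : Fin k) :
    defectMap X (Pi.single i 1) = 1 - PhiMap (X i) := by
  unfold defectMap
  rw [List.prod_ofFn_eq_single _ i fun l hl => by rw [Pi.single_eq_of_ne hl, pow_zero]]
  simp

/-- Positivity of the defect operator of order `ε_i`, which is at most `m` because `m_i ≥ 1`, says that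
the row `X_i` is contractive. -/
theorem norm_PhiMap_le_of_mem_polyHyperball (hm : ∀ i, 1 ≤ m i) {X : ∀ i, ι i → H →L[ℂ] H}
    (hX : X ∈ polyHyperball ι m H) (i : Fin k) (Z : H →L[ℂ] H) : ‖PhiMap (X i) Z‖ ≤ ‖Z‖ := by
  refine norm_PhiMap_le _ ?_ Z
  have h := hX.2 (Pi.single i 1) fun l => by
    by_cases hl : l = i
    · subst hl; simpa using hm l
    · simp [hl]
  rwa [defectMap_single] at h

theorem isPositive_sum {J E : Type*} [NormedAddCommGroup E] [InnerProductSpace ℂ E]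
    (s : Finset J) (f : J → E →L[ℂ] E)
    (h : ∀ j ∈ s, (f j).IsPositive) : (∑ j ∈ s, f j).IsPositive := by
  classical
  induction s using Finset.induction_on with
  | empty => simp
  | insert a s ha ih =>
    rw [Finset.sum_insert ha]
    exact (h a (Finset.mem_insert_self a s)).add
      (ih fun j hj => h j (Finset.mem_insert_of_mem hj))

/-- Poly-hyperballs are invariant under scaling by `t ∈ [0,1]`, as far as the defect operator of top
order is concerned: `1 - t² Φ = (1 - t²) + t² (1 - Φ)`, so the defect operator of `t X` of order `m`
is a combination with nonnegative coefficients of the defect operators of `X` of orders `≤ m`. -/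
theorem isPositive_defectMap_smul {X : ∀ i, ι i → H →L[ℂ] H} (hX : X ∈ polyHyperball ι m H)
    {t : ℝ} (h0 : 0 ≤ t) (h1 : t ≤ 1) :
    (defectMap (fun i j => (t : ℂ) • X i j) m 1).IsPositive := by
  have hfac : ∀ i, (1 - PhiMap (fun j => (t : ℂ) • X i j)) ^ m i =
      ∑ p ∈ Finset.range (m i + 1),
        (((t ^ 2) ^ p * (1 - t ^ 2) ^ (m i - p) * ((m i).choose p : ℝ) : ℝ) : ℂ) •
          (1 - PhiMap (X i)) ^ p := by
    intro i
    have e : 1 - PhiMap (fun j => (t : ℂ) • X i j) =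
        ((t ^ 2 : ℝ) : ℂ) • (1 - PhiMap (X i)) +
          ((1 - t ^ 2 : ℝ) : ℂ) • (1 : Module.End ℂ (H →L[ℂ] H)) := by
      ext1 Z
      simp only [PhiMap_smul, LinearMap.sub_apply, LinearMap.add_apply, LinearMap.smul_apply,
        Module.End.one_apply, Complex.ofReal_sub, Complex.ofReal_one, sub_smul, smul_sub, one_smul]
      abel
    rw [e, (((Commute.one_right _).smul_right _)).add_pow]
    refine Finset.sum_congr rfl fun p _ => ?_
    rw [smul_pow, smul_pow, one_pow, mul_smul_comm, mul_one, smul_smul, ← nsmul_eq_mul',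
      ← Nat.cast_smul_eq_nsmul ℂ, smul_smul]
    push_cast
    ring_nf
  unfold defectMap
  simp only [hfac]
  rw [List.prod_ofFn_sum]
  simp only [List.prod_ofFn_smul, LinearMap.sum_apply, LinearMap.smul_apply]
  refine isPositive_sum _ _ fun p hp => ?_
  have hpm : p ≤ m := fun i => Finset.mem_range_succ_iff.1 (Fintype.mem_piFinset.1 hp i)
  have hc : 0 ≤ ∏ i, ((t ^ 2) ^ p i * (1 - t ^ 2) ^ (m i - p i) * ((m i).choose (p i) : ℝ)) := by
    refine Finset.prod_nonneg fun i _ => ?_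
    have : 0 ≤ 1 - t ^ 2 := by nlinarith
    positivity
  have := (hX.2 p hpm).smul_of_nonneg (c := ((∏ i, ((t ^ 2) ^ p i * (1 - t ^ 2) ^ (m i - p i) *
    ((m i).choose (p i) : ℝ)) : ℝ) : ℂ)) (by exact_mod_cast hc)
  rw [Complex.ofReal_prod] at this
  exact this

/-- `Φ_X` as a bounded operator on `B(H)`. -/
def PhiL {J : Type*} [Fintype J] (X : J → H →L[ℂ] H) : (H →L[ℂ] H) →L[ℂ] (H →L[ℂ] H) :=
  ∑ j, ContinuousLinearMap.mulLeftRight ℂ (H →L[ℂ] H) (X j) (star (X j))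

theorem PhiL_apply {J : Type*} [Fintype J] (X : J → H →L[ℂ] H) (Z : H →L[ℂ] H) :
    PhiL X Z = PhiMap X Z := by
  simp [PhiL, PhiMap_apply]

theorem toLinearMapRingHom_PhiL {J : Type*} [Fintype J] (X : J → H →L[ℂ] H) :
    ContinuousLinearMap.toLinearMapRingHom (PhiL X) = PhiMap X :=
  LinearMap.ext fun Z => PhiL_apply X Z

theorem PhiL_commute {J J' : Type*} [Fintype J] [Fintype J'] (X : J → H →L[ℂ] H)
    (Y : J' → H →L[ℂ] H) (h : ∀ a b, Commute (X a) (Y b)) : Commute (PhiL X) (PhiL Y) := by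
  ext1 Z
  simpa [PhiL_apply] using DFunLike.congr_fun (PhiMap_commute X Y h).eq Z

/-- The product `∏_i C(m_i + d_i - 1, d_i)`: the coefficient of `x^d` in `∏_i (1 - x_i)^{-m_i}`. -/
def multiCoeff (m d : Fin k → ℕ) : ℝ := ∏ i, (Nat.multichoose (m i) (d i) : ℝ)

theorem one_le_multichoose {n : ℕ} (hn : 1 ≤ n) (l : ℕ) : 1 ≤ Nat.multichoose n l := by
  rw [Nat.multichoose_eq]
  exact Nat.choose_pos (by omega)

theorem multiCoeff_pos (hm : ∀ i, 1 ≤ m i) (d : Fin k → ℕ) : 0 < multiCoeff m d :=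
  Finset.prod_pos fun i _ => by exact_mod_cast one_le_multichoose (hm i) (d i)

theorem multichoose_succ_eq (a n : ℕ) : Nat.multichoose (a + 1) n = (n + a).choose a := by
  rw [Nat.multichoose_eq, show a + 1 + n - 1 = n + a by omega, Nat.choose_symm_add]

theorem summable_multichoose_mul_pow {n : ℕ} (hn : 1 ≤ n) {ρ : ℝ} (h0 : 0 ≤ ρ) (h1 : ρ < 1) :
    Summable fun l => (Nat.multichoose n l : ℝ) * ρ ^ l := by
  obtain ⟨a, rfl⟩ : ∃ a, n = a + 1 := ⟨n - 1, by omega⟩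
  simp only [multichoose_succ_eq]
  exact summable_choose_mul_geometric_of_norm_lt_one a (by rwa [Real.norm_of_nonneg h0])

/-- The term `∏_i C(m_i + d_i - 1, d_i) Φ_{X_i}^{d_i}` of the series of `∏_i (1 - Φ_{X_i})^{-m_i}`,
applied to the defect operator of order `m`. -/
def defectTerm (m : Fin k → ℕ) (X : ∀ i, ι i → H →L[ℂ] H) (d : Fin k → ℕ) : H →L[ℂ] H :=
  (multiCoeff m d : ℂ) • (List.ofFn fun i => PhiMap (X i) ^ d i).prod (defectMap X m 1)

theorem prod_ofFn_multichoose_smul (X : ∀ i, ι i → H →L[ℂ] H) (d : Fin k → ℕ) :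
    (List.ofFn fun i => (Nat.multichoose (m i) (d i) : ℂ) • PhiL (X i) ^ d i).prod
      (defectMap X m 1) = defectTerm m X d := by
  have : ContinuousLinearMap.toLinearMapRingHom
      (List.ofFn fun i => (Nat.multichoose (m i) (d i) : ℂ) • PhiL (X i) ^ d i).prod =
      (multiCoeff m d : ℂ) • (List.ofFn fun i => PhiMap (X i) ^ d i).prod := by
    rw [map_list_prod, List.map_ofFn, multiCoeff]
    push_cast
    rw [← List.prod_ofFn_smul]
    congr 2
    funext i
    rw [← toLinearMapRingHom_PhiL, ← map_pow]
    rfl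
  exact DFunLike.congr_fun this (defectMap X m 1)

theorem norm_defectTerm_le {ρ : ℝ} (h0 : 0 ≤ ρ) (X : ∀ i, ι i → H →L[ℂ] H)
    (hX : ∀ i Z, ‖PhiMap (X i) Z‖ ≤ ρ * ‖Z‖) (d : Fin k → ℕ) :
    ‖defectTerm m X d‖ ≤ (∏ i, (Nat.multichoose (m i) (d i) : ℝ) * ρ ^ d i) *
      ‖defectMap X m 1‖ := by
  have hpow : ∀ i n Z, ‖(PhiMap (X i) ^ n) Z‖ ≤ ρ ^ n * ‖Z‖ := by
    intro i n Z
    induction n with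
    | zero => simp
    | succ n ih =>
      rw [pow_succ', Module.End.mul_apply, pow_succ', mul_assoc]
      exact (hX i _).trans (mul_le_mul_of_nonneg_left ih h0)
  have hprod : ∀ (L : List (Fin k)) Z, ‖(L.map fun i => PhiMap (X i) ^ d i).prod Z‖ ≤
      (L.map fun i => ρ ^ d i).prod * ‖Z‖ := by
    intro L Z
    induction L with
    | nil => simp
    | cons i L ih =>
      rw [List.map_cons, List.prod_cons, Module.End.mul_apply, List.map_cons, List.prod_cons,
        mul_assoc]
      exact (hpow i _ _).trans (mul_le_mul_of_nonneg_left ih (by positivity))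
  rw [defectTerm, norm_smul, Complex.norm_real, multiCoeff, Real.norm_of_nonneg (by positivity),
    Finset.prod_mul_distrib, mul_assoc]
  gcongr
  have := hprod (List.finRange k) (defectMap X m 1)
  rwa [← List.ofFn_eq_map, ← List.ofFn_eq_map, List.prod_ofFn] at this

/-- The Neumann series `∑_d ∏_i C(m_i + d_i - 1, d_i) Φ_{X_i}^{d_i} = ∏_i (1 - Φ_{X_i})^{-m_i}`,
applied to the defect operator `∏_i (1 - Φ_{X_i})^{m_i} (I)`. -/
theorem hasSum_defectTerm (hm : ∀ i, 1 ≤ m i) {ρ : ℝ} (h0 : 0 ≤ ρ) (h1 : ρ < 1)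
    (X : ∀ i, ι i → H →L[ℂ] H) (hc : ∀ p q, p ≠ q → ∀ a b, Commute (X p a) (X q b))
    (hX : ∀ i Z, ‖PhiMap (X i) Z‖ ≤ ρ * ‖Z‖) : HasSum (defectTerm m X) 1 := by
  rcases subsingleton_or_nontrivial H with hH | hH
  · rw [Subsingleton.elim (1 : H →L[ℂ] H) 0]
    convert hasSum_zero with d
    exact Subsingleton.elim _ _
  have hn : ∀ i, ‖PhiL (X i)‖ ≤ ρ := fun i =>
    ContinuousLinearMap.opNorm_le_bound _ h0 fun Z => by rw [PhiL_apply]; exact hX i Z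
  have hsum : ∀ i, HasSum (fun n => (Nat.multichoose (m i) n : ℂ) • PhiL (X i) ^ n)
      (Ring.inverse (1 - PhiL (X i)) ^ m i) := by
    intro i
    obtain ⟨a, ha⟩ : ∃ a, m i = a + 1 := ⟨m i - 1, by have := hm i; omega⟩
    have := hasSum_choose_mul_geometric_of_norm_lt_one' a ((hn i).trans_lt h1)
    rw [ha]
    have e : ∀ (c : ℕ) (Y : (H →L[ℂ] H) →L[ℂ] (H →L[ℂ] H)), (c : ℂ) • Y = (c : _) * Y :=
      fun c Y => (Nat.cast_smul_eq_nsmul ℂ c Y).trans (nsmul_eq_mul c Y)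
    simp only [multichoose_succ_eq, e]
    exact this
  have hsn : ∀ i, Summable fun n => ‖(Nat.multichoose (m i) n : ℂ) • PhiL (X i) ^ n‖ := by
    intro i
    refine .of_nonneg_of_le (fun _ => norm_nonneg _) (fun n => ?_)
      (summable_multichoose_mul_pow (hm i) h0 h1)
    rw [norm_smul, Complex.norm_natCast]
    gcongr
    exact (norm_pow_le _ n).trans (pow_le_pow_left₀ (norm_nonneg _) (hn i) n)
  have hall := hasSum_pi_prod _ _ hsum hsn
  have hinv : (List.ofFn fun i => Ring.inverse (1 - PhiL (X i)) ^ m i).prod *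
      (List.ofFn fun i => (1 - PhiL (X i)) ^ m i).prod = 1 := by
    rw [List.prod_ofFn_mul_prod_ofFn]
    · refine List.prod_eq_one fun x hx => ?_
      obtain ⟨i, rfl⟩ := List.mem_ofFn.1 hx
      have hu : IsUnit (1 - PhiL (X i)) := isUnit_one_sub_of_norm_lt_one ((hn i).trans_lt h1)
      have hl : Ring.inverse (1 - PhiL (X i)) * (1 - PhiL (X i)) = 1 := Ring.inverse_mul_cancel _ hu
      have hr : (1 - PhiL (X i)) * Ring.inverse (1 - PhiL (X i)) = 1 := Ring.mul_inverse_cancel _ hu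
      rw [← (show Commute _ _ from hl.trans hr.symm).mul_pow, hl, one_pow]
    · intro i j hij
      have hu : IsUnit (1 - PhiL (X i)) := isUnit_one_sub_of_norm_lt_one ((hn i).trans_lt h1)
      have h2 : Commute (1 - PhiL (X i)) (1 - PhiL (X j)) :=
        ((Commute.one_left _).sub_left ((Commute.one_right _).sub_right
          (PhiL_commute _ _ (hc i j hij))))
      obtain ⟨x, hx⟩ := hu
      rw [← hx] at h2 ⊢
      rw [Ring.inverse_unit]
      exact (h2.units_inv_left).pow_pow _ _
  have hD : (List.ofFn fun i => (1 - PhiL (X i)) ^ m i).prod 1 = defectMap X m 1 := by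
    have : ContinuousLinearMap.toLinearMapRingHom (List.ofFn fun i => (1 - PhiL (X i)) ^ m i).prod =
        defectMap X m := by
      rw [map_list_prod, List.map_ofFn, defectMap]
      congr 2
      funext i
      simp only [Function.comp_apply, map_pow, map_sub, map_one, toLinearMapRingHom_PhiL]
    rw [← this]
    rfl
  have h3 := (ContinuousLinearMap.apply ℂ (H →L[ℂ] H) (defectMap X m 1)).hasSum hall
  simp only [ContinuousLinearMap.apply_apply, prod_ofFn_multichoose_smul] at h3
  rw [← hD, ← mul_apply_eq_comp, hinv] at h3
  exact h3

end Neumann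

/-! ### The primal and the dual basis of the Fock space -/

section DualBasis

variable {k : ℕ} {ι : Fin k → Type u}

theorem prependLetter_eq (i : Fin k) (j : ι i) (α : MultiWord ι) :
    prependLetter i j α = Pi.mulSingle i (FreeMonoid.of j) * α := by
  funext l
  by_cases hl : l = i
  · subst hl; simp [prependLetter]
  · simp [prependLetter, hl]

theorem appendLetter_eq (i : Fin k) (j : ι i) (α : MultiWord ι) :
    appendLetter i j α = α * Pi.mulSingle i (FreeMonoid.of j) := by
  funext l
  by_cases hl : l = i
  · subst hl; simp [appendLetter]
  · simp [appendLetter, hl]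

theorem inner_fockBasis_left (γ : MultiWord ι) (x : FockTensor ι) :
    inner ℂ (fockBasis γ) x = x γ := by
  classical
  simp only [fockBasis]
  rw [lp.inner_single_left]
  simp

theorem hasSum_fockBasis (x : FockTensor ι) : HasSum (fun γ => x γ • fockBasis γ) x := by
  classical
  have := lp.hasSum_single (p := 2) (by norm_num) x
  convert this using 2 with γ
  rw [fockBasis, ← lp.single_smul]
  simp

theorem rightModel_fockBasis (m : Fin k → ℕ) (i : Fin k) (j : ι i) (α : MultiWord ι) :
    rightModel ι m i j (fockBasis α) =
      (weight (m i) (α i).length : ℂ) • fockBasis (appendLetter i j α) := by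
  classical
  have h2 : shiftIsometry (appendLetter i j) (appendLetter_injective i j) (fockBasis α)
      = fockBasis (appendLetter i j α) := by
    unfold shiftIsometry
    rw [fockBasis, OrthogonalFamily.linearIsometry_apply_single]
    simp
  have h3 : weightOp ι m i (fockBasis α) = (weight (m i) (α i).length : ℂ) • fockBasis α := by
    ext β
    rw [weightOp_apply, lp.coeFn_smul, Pi.smul_apply, smul_eq_mul]
    by_cases h : β = α
    · subst h; rfl
    · simp [fockBasis, h]
  simp only [rightModel, ContinuousLinearMap.comp_apply, h3, map_smul]
  congr 1

/-- The multi-length `(|α_1|, …, |α_k|)` of a multi-word. -/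
def multiLength (α : MultiWord ι) : Fin k → ℕ := fun i => (α i).length

@[simp] theorem multiLength_mul (α β : MultiWord ι) :
    multiLength (α * β) = multiLength α + multiLength β := by
  funext i; simp [multiLength]

@[simp] theorem multiLength_one : multiLength (1 : MultiWord ι) = 0 := by
  funext i; simp [multiLength]

theorem multiLength_mulSingle (i : Fin k) (a : FreeMonoid (ι i)) :
    multiLength (Pi.mulSingle i a) = Pi.single i a.length := by
  funext l
  by_cases hl : l = i
  · subst hl; simp [multiLength]
  · simp [multiLength, hl]

theorem weight_sq (m l : ℕ) (hm : 1 ≤ m) :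
    weight m l ^ 2 = (Nat.multichoose m l : ℝ) / Nat.multichoose m (l + 1) := by
  have h := weight_sq_mul m 0 l hm
  obtain ⟨a, rfl⟩ : ∃ a, m = a + 1 := ⟨m - 1, by omega⟩
  have h1 : ((a + 1).multichoose (l + 1) : ℝ) ≠ 0 := by
    exact_mod_cast Nat.one_le_iff_ne_zero.1 (one_le_multichoose hm (l + 1))
  have h2 : ((a + 1).multichoose l : ℝ) ≠ 0 := by
    exact_mod_cast Nat.one_le_iff_ne_zero.1 (one_le_multichoose hm l)
  have h3 := Nat.multichoose_succ_succ a l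
  have h4 : ((a + 1).multichoose (l + 1) : ℝ) = a.multichoose (l + 1) + (a + 1).multichoose l := by
    exact_mod_cast h3
  simp only [Nat.sub_zero, zero_add, Nat.add_sub_cancel] at h
  rw [div_self h2, div_self h1, mul_one] at h
  rw [eq_div_iff h1]
  rw [eq_div_iff h1] at h
  linarith

theorem multiCoeff_add_single (m : Fin k → ℕ) (d : Fin k → ℕ) (i : Fin k) (n : ℕ) :
    multiCoeff m (d + Pi.single i n) * (m i).multichoose (d i) =
      multiCoeff m d * (m i).multichoose (d i + n) := by
  have h : ∀ e : Fin k → ℕ, multiCoeff m e = ((m i).multichoose (e i) : ℝ) *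
      ∏ l ∈ Finset.univ.erase i, ((m l).multichoose (e l) : ℝ) :=
    fun e => (Finset.mul_prod_erase _ _ (Finset.mem_univ i)).symm
  have h2 : ∏ l ∈ Finset.univ.erase i, ((m l).multichoose ((d + Pi.single i n : Fin k → ℕ) l) : ℝ) =
      ∏ l ∈ Finset.univ.erase i, ((m l).multichoose (d l) : ℝ) := by
    refine Finset.prod_congr rfl fun l hl => ?_
    simp [Finset.ne_of_mem_erase hl]
  rw [h, h d, h2]
  simp only [Pi.add_apply, Pi.single_eq_same]
  ring

/-- The weight satisfies `w(d_i) / √b_d = 1 / √b_{d + ε_i}` for the coefficients `b` of the series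
`∏_i (1 - x_i)^{-m_i}`. -/
theorem weight_mul_inv_sqrt {m : Fin k → ℕ} (hm : ∀ i, 1 ≤ m i) (d : Fin k → ℕ) (i : Fin k) :
    weight (m i) (d i) * (√(multiCoeff m d))⁻¹ = (√(multiCoeff m (d + Pi.single i 1)))⁻¹ := by
  have h0 := multiCoeff_pos hm d
  have h1 := multiCoeff_pos hm (d + Pi.single i 1)
  have h2 : (0 : ℝ) < (m i).multichoose (d i) := by
    exact_mod_cast one_le_multichoose (hm i) (d i)
  have h3 : (0 : ℝ) < (m i).multichoose (d i + 1) := by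
    exact_mod_cast one_le_multichoose (hm i) (d i + 1)
  have hw : weight (m i) (d i) = √(weight (m i) (d i) ^ 2) :=
    (Real.sqrt_sq (Real.sqrt_nonneg _)).symm
  rw [hw, weight_sq _ _ (hm i), ← Real.sqrt_inv, ← Real.sqrt_inv, ← Real.sqrt_mul (by positivity)]
  congr 1
  have := multiCoeff_add_single m d i 1
  field_simp
  linarith

/-- The coefficient `b_α = ∏_i C(m_i + |α_i| - 1, |α_i|)` attached to a multi-word. -/
def wordCoeff (m : Fin k → ℕ) (α : MultiWord ι) : ℝ := multiCoeff m (multiLength α)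

theorem wordCoeff_pos {m : Fin k → ℕ} (hm : ∀ i, 1 ≤ m i) (α : MultiWord ι) : 0 < wordCoeff m α :=
  multiCoeff_pos hm _

@[simp] theorem wordCoeff_one (m : Fin k → ℕ) : wordCoeff m (1 : MultiWord ι) = 1 := by
  simp [wordCoeff, multiCoeff]

/-- The vectors `f_α = e_α / √b_α`, on which the weighted creation operators act as plain
shifts. -/
def primalVec (m : Fin k → ℕ) (α : MultiWord ι) : FockTensor ι :=
  (((√(wordCoeff m α))⁻¹ : ℝ) : ℂ) • fockBasis α

/-- The vectors `f'_α = √b_α e_α`, the dual basis of `f_α = e_α / √b_α`. -/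
def dualVec (m : Fin k → ℕ) (α : MultiWord ι) : FockTensor ι :=
  ((√(wordCoeff m α) : ℝ) : ℂ) • fockBasis α

open Classical in
theorem inner_fockBasis (α β : MultiWord ι) :
    inner ℂ (fockBasis α) (fockBasis β) = if α = β then (1 : ℂ) else 0 :=
  orthonormal_iff_ite.1 orthonormal_fockBasis α β

open Classical in
theorem inner_primalVec_dualVec {m : Fin k → ℕ} (hm : ∀ i, 1 ≤ m i) (α β : MultiWord ι) :
    inner ℂ (primalVec m α) (dualVec m β) = if α = β then (1 : ℂ) else 0 := by
  rw [primalVec, dualVec, inner_smul_left, inner_smul_right, inner_fockBasis]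
  by_cases h : α = β
  · subst h
    have := Real.sqrt_pos.2 (wordCoeff_pos hm α)
    simp only [if_true, mul_one, Complex.conj_ofReal]
    rw [← Complex.ofReal_mul, inv_mul_cancel₀ this.ne', Complex.ofReal_one]
  · simp [h]

open Classical in
theorem inner_dualVec_dualVec {m : Fin k → ℕ} (hm : ∀ i, 1 ≤ m i) (α β : MultiWord ι) :
    inner ℂ (dualVec m α) (dualVec m β) = if α = β then (wordCoeff m α : ℂ) else 0 := by
  rw [dualVec, dualVec, inner_smul_left, inner_smul_right, inner_fockBasis]
  by_cases h : α = β
  · subst h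
    simp only [if_true, mul_one, Complex.conj_ofReal]
    rw [← Complex.ofReal_mul, Real.mul_self_sqrt (wordCoeff_pos hm α).le]
  · simp [h]

theorem ext_inner_primalVec {m : Fin k → ℕ} (hm : ∀ i, 1 ≤ m i) {x y : FockTensor ι}
    (h : ∀ γ, inner ℂ (primalVec m γ) x = inner ℂ (primalVec m γ) y) : x = y := by
  ext γ
  have := h γ
  rw [primalVec, inner_smul_left, inner_smul_left, inner_fockBasis_left,
    inner_fockBasis_left] at this
  refine mul_left_cancel₀ ?_ this
  have := Real.sqrt_pos.2 (wordCoeff_pos hm γ)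
  simpa using this.ne'

theorem leftModel_primalVec {m : Fin k → ℕ} (hm : ∀ i, 1 ≤ m i) (i : Fin k) (j : ι i)
    (γ : MultiWord ι) : leftModel ι m i j (primalVec m γ) =
      primalVec m (Pi.mulSingle i (FreeMonoid.of j) * γ) := by
  rw [primalVec, map_smul, leftModel_fockBasis, smul_smul, ← Complex.ofReal_mul, mul_comm, wordCoeff]
  erw [weight_mul_inv_sqrt hm (multiLength γ) i]
  rw [prependLetter_eq, primalVec, wordCoeff, multiLength_mul, multiLength_mulSingle,
    FreeMonoid.length_of, add_comm]

theorem rightModel_primalVec {m : Fin k → ℕ} (hm : ∀ i, 1 ≤ m i) (i : Fin k) (j : ι i)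
    (γ : MultiWord ι) : rightModel ι m i j (primalVec m γ) =
      primalVec m (γ * Pi.mulSingle i (FreeMonoid.of j)) := by
  rw [primalVec, map_smul, rightModel_fockBasis, smul_smul, ← Complex.ofReal_mul, mul_comm,
    wordCoeff]
  erw [weight_mul_inv_sqrt hm (multiLength γ) i]
  rw [appendLetter_eq, primalVec, wordCoeff, multiLength_mul, multiLength_mulSingle,
    FreeMonoid.length_of]

theorem monomialOp_leftModel_primalVec {m : Fin k → ℕ} (hm : ∀ i, 1 ≤ m i) (α γ : MultiWord ι) :
    monomialOp (leftModel ι m) α (primalVec m γ) = primalVec m (α * γ) := by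
  have hlift : ∀ (i : Fin k) (w : FreeMonoid (ι i)) (γ : MultiWord ι),
      FreeMonoid.lift (leftModel ι m i) w (primalVec m γ) =
        primalVec m (Pi.mulSingle i w * γ) := by
    intro i w
    induction w using FreeMonoid.inductionOn' with
    | one => intro γ; simp
    | of_mul j w ih =>
      intro γ
      rw [map_mul, FreeMonoid.lift_eval_of, mul_apply_eq_comp, ih, leftModel_primalVec hm,
        ← mul_assoc, ← Pi.mulSingle_mul]
  have hlist : ∀ L : List (Fin k),
      (L.map fun i => FreeMonoid.lift (leftModel ι m i) (α i)).prod (primalVec m γ) =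
        primalVec m ((L.map fun i => Pi.mulSingle i (α i)).prod * γ) := by
    intro L
    induction L with
    | nil => simp
    | cons i L ih =>
      rw [List.map_cons, List.prod_cons, mul_apply_eq_comp, ih, hlift, List.map_cons,
        List.prod_cons, mul_assoc]
  rw [monomialOp, List.ofFn_eq_map, hlist, ← List.ofFn_eq_map, List.prod_ofFn_mulSingle]

/-- The adjoint of an injective shift `f_γ ↦ f_{φ(γ)}` is the inverse shift on the dual basis. -/
theorem star_apply_dualVec_of_eq {m : Fin k → ℕ} (hm : ∀ i, 1 ≤ m i)
    {S : FockTensor ι →L[ℂ] FockTensor ι} {φ : MultiWord ι → MultiWord ι}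
    (hφ : Function.Injective φ) (hS : ∀ γ, S (primalVec m γ) = primalVec m (φ γ))
    (γ : MultiWord ι) : star S (dualVec m (φ γ)) = dualVec m γ := by
  refine ext_inner_primalVec hm fun σ => ?_
  rw [ContinuousLinearMap.star_eq_adjoint, ContinuousLinearMap.adjoint_inner_right, hS,
    inner_primalVec_dualVec hm, inner_primalVec_dualVec hm]
  by_cases h : σ = γ
  · rw [h, if_pos rfl, if_pos rfl]
  · rw [if_neg h, if_neg (hφ.ne h)]

theorem star_apply_dualVec_of_ne {m : Fin k → ℕ} (hm : ∀ i, 1 ≤ m i)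
    {S : FockTensor ι →L[ℂ] FockTensor ι} {φ : MultiWord ι → MultiWord ι}
    (hS : ∀ γ, S (primalVec m γ) = primalVec m (φ γ)) {δ : MultiWord ι} (h : ∀ γ, φ γ ≠ δ) :
    star S (dualVec m δ) = 0 := by
  refine ext_inner_primalVec hm fun σ => ?_
  rw [ContinuousLinearMap.star_eq_adjoint, ContinuousLinearMap.adjoint_inner_right, hS,
    inner_primalVec_dualVec hm, if_neg (h σ), inner_zero_right]

end DualBasis

/-! ### Matrix coefficients of operators on `K ⊗ F` -/

section Coefficients

variable {k : ℕ} {ι : Fin k → Type u} (m : Fin k → ℕ)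
  {K : Type v} [NormedAddCommGroup K] [InnerProductSpace ℂ K]

variable (K) in
/-- The isometry `x ↦ x ⊗ e_γ`. -/
def basisEmb (γ : MultiWord ι) : K →ₗᵢ[ℂ] HilbertTensor K (FockTensor ι) where
  toFun x := pureTensor x (fockBasis γ)
  map_add' x y := pureTensor_add_left x y _
  map_smul' c x := pureTensor_smul_left c x _
  norm_map' x := by
    change ‖pureTensor x (fockBasis γ)‖ = ‖x‖
    rw [norm_pureTensor, orthonormal_fockBasis.1, mul_one]

theorem basisEmb_apply (γ : MultiWord ι) (x : K) :
    basisEmb K γ x = pureTensor x (fockBasis γ) := rfl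

variable (K) in
/-- The map `x ↦ x ⊗ f'_γ`, where `f'_γ = √b_γ e_γ`. -/
def dualEmb (γ : MultiWord ι) : K →L[ℂ] HilbertTensor K (FockTensor ι) :=
  ((√(wordCoeff m γ) : ℝ) : ℂ) • (basisEmb K γ).toContinuousLinearMap

theorem dualEmb_apply (γ : MultiWord ι) (x : K) :
    dualEmb m K γ x = pureTensor x (dualVec m γ) := by
  rw [dualVec, pureTensor_smul_right]
  rfl

theorem hilbertTensor_fock_ext {E : Type*} [NormedAddCommGroup E] [InnerProductSpace ℂ E]
    {S T : HilbertTensor K (FockTensor ι) →L[ℂ] E}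
    (h : ∀ x γ, S (basisEmb K γ x) = T (basisEmb K γ x)) : S = T := by
  refine hilbertTensor_ext fun x y => ?_
  have hy := (pureTensorL x).hasSum (hasSum_fockBasis y)
  have e : (fun γ => S (pureTensorL x (y γ • fockBasis γ))) =
      fun γ => T (pureTensorL x (y γ • fockBasis γ)) := by
    funext γ
    simp only [map_smul, pureTensorL_apply]
    rw [← basisEmb_apply, h]
  have hS := S.hasSum hy
  rw [e] at hS
  exact hS.unique (T.hasSum hy)

theorem orthogonalFamily_basisEmb :
    OrthogonalFamily ℂ (fun _ : MultiWord ι => K) (basisEmb K) := by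
  classical
  intro γ δ h x y
  rw [basisEmb_apply, basisEmb_apply, inner_pureTensor, inner_fockBasis, if_neg h, mul_zero]

variable [CompleteSpace K]

theorem isHilbertSum_basisEmb : IsHilbertSum ℂ (fun _ : MultiWord ι => K) (basisEmb K) := by
  refine IsHilbertSum.mk orthogonalFamily_basisEmb ?_
  rw [top_le_iff, Submodule.topologicalClosure_eq_top_iff, Submodule.eq_bot_iff]
  intro z hz
  have : innerSL ℂ z = 0 := by
    refine hilbertTensor_fock_ext fun x γ => ?_
    rw [innerSL_apply_apply]
    refine (Submodule.mem_orthogonal' _ z).1 hz _ ?_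
    exact Submodule.mem_iSup_of_mem γ ⟨x, rfl⟩
  simpa using DFunLike.congr_fun this z

theorem hasSum_norm_sq_adjoint_basisEmb (z : HilbertTensor K (FockTensor ι)) :
    HasSum (fun γ => ‖ContinuousLinearMap.adjoint (basisEmb K γ).toContinuousLinearMap z‖ ^ 2)
      (‖z‖ ^ 2) := by
  classical
  set U := (isHilbertSum_basisEmb (K := K) (ι := ι)).linearIsometryEquiv with hU
  have hc : ∀ γ, ContinuousLinearMap.adjoint (basisEmb K γ).toContinuousLinearMap z = U z γ := by
    intro γ
    refine ext_inner_left ℂ fun x => ?_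
    rw [ContinuousLinearMap.adjoint_inner_right]
    have h1 : (basisEmb K γ).toContinuousLinearMap x = U.symm (lp.single 2 γ x) := by
      rw [hU, IsHilbertSum.linearIsometryEquiv_symm_apply_single]
      rfl
    rw [h1, ← U.inner_map_map, U.apply_symm_apply, lp.inner_single_left]
  simp only [hc]
  have h := lp.hasSum_inner (𝕜 := ℂ) (U z) (U z)
  rw [U.inner_map_map, inner_self_eq_norm_sq_to_K] at h
  simp only [inner_self_eq_norm_sq_to_K] at h
  exact_mod_cast h

/-- The matrix coefficient `T_{γ,δ} = (f'_γ)^* T f'_δ ∈ B(K)` of `T ∈ B(K ⊗ F)` with respect to the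
dual basis `f'_γ = √b_γ e_γ`. -/
def coeffOp (T : HilbertTensor K (FockTensor ι) →L[ℂ] HilbertTensor K (FockTensor ι))
    (γ δ : MultiWord ι) : K →L[ℂ] K :=
  ContinuousLinearMap.adjoint (dualEmb m K γ) ∘L T ∘L dualEmb m K δ

theorem inner_coeffOp (T : HilbertTensor K (FockTensor ι) →L[ℂ] HilbertTensor K (FockTensor ι))
    (γ δ : MultiWord ι) (x y : K) :
    inner ℂ x (coeffOp m T γ δ y) =
      inner ℂ (pureTensor x (dualVec m γ)) (T (pureTensor y (dualVec m δ))) := by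
  rw [coeffOp, ContinuousLinearMap.comp_apply, ContinuousLinearMap.adjoint_inner_right,
    dualEmb_apply, ContinuousLinearMap.comp_apply, dualEmb_apply]

theorem coeffOp_eq_smul (T : HilbertTensor K (FockTensor ι) →L[ℂ] HilbertTensor K (FockTensor ι))
    (γ δ : MultiWord ι) (y : K) :
    coeffOp m T γ δ y = ((√(wordCoeff m γ) * √(wordCoeff m δ) : ℝ) : ℂ) •
      ContinuousLinearMap.adjoint (basisEmb K γ).toContinuousLinearMap (T (basisEmb K δ y)) := by
  refine ext_inner_left ℂ fun x => ?_
  rw [inner_coeffOp, inner_smul_right, ContinuousLinearMap.adjoint_inner_right, dualVec, dualVec,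
    pureTensor_smul_right, pureTensor_smul_right, map_smul, inner_smul_left, inner_smul_right,
    Complex.conj_ofReal, Complex.ofReal_mul, mul_assoc]
  rfl

variable {m}

theorem ext_coeffOp (hm : ∀ i, 1 ≤ m i)
    {S T : HilbertTensor K (FockTensor ι) →L[ℂ] HilbertTensor K (FockTensor ι)}
    (h : ∀ γ δ, coeffOp m S γ δ = coeffOp m T γ δ) : S = T := by
  refine hilbertTensor_fock_ext fun x δ => ?_
  rw [← sub_eq_zero, ← norm_eq_zero, ← sq_eq_zero_iff]
  refine (hasSum_norm_sq_adjoint_basisEmb _).unique ?_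
  convert hasSum_zero with γ
  have := DFunLike.congr_fun (h γ δ) x
  rw [coeffOp_eq_smul, coeffOp_eq_smul] at this
  have hne : ((√(wordCoeff m γ) * √(wordCoeff m δ) : ℝ) : ℂ) ≠ 0 := by
    have h1 := Real.sqrt_pos.2 (wordCoeff_pos hm γ)
    have h2 := Real.sqrt_pos.2 (wordCoeff_pos hm δ)
    exact_mod_cast (mul_pos h1 h2).ne'
  rw [map_sub, smul_right_injective K hne this, sub_self, norm_zero]
  simp

variable (m)

theorem coeffOp_add (S T : HilbertTensor K (FockTensor ι) →L[ℂ] HilbertTensor K (FockTensor ι))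
    (γ δ : MultiWord ι) : coeffOp m (S + T) γ δ = coeffOp m S γ δ + coeffOp m T γ δ := by
  ext x
  simp [coeffOp]

theorem coeffOp_smul (c : ℂ)
    (T : HilbertTensor K (FockTensor ι) →L[ℂ] HilbertTensor K (FockTensor ι))
    (γ δ : MultiWord ι) : coeffOp m (c • T) γ δ = c • coeffOp m T γ δ := by
  ext x
  simp [coeffOp]

/-- The matrix coefficient `T ↦ T_{γ,δ}` as a homomorphism of additive groups. -/
def coeffHom (γ δ : MultiWord ι) :
    (HilbertTensor K (FockTensor ι) →L[ℂ] HilbertTensor K (FockTensor ι)) →+ (K →L[ℂ] K) where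
  toFun T := coeffOp m T γ δ
  map_add' S T := coeffOp_add m S T γ δ
  map_zero' := by ext x; simp [coeffOp]

theorem coeffHom_apply (γ δ : MultiWord ι)
    (T : HilbertTensor K (FockTensor ι) →L[ℂ] HilbertTensor K (FockTensor ι)) :
    coeffHom m γ δ T = coeffOp m T γ δ := rfl

theorem continuous_coeffHom (γ δ : MultiWord ι) :
    Continuous (coeffHom m γ δ : (HilbertTensor K (FockTensor ι) →L[ℂ] _) →+ (K →L[ℂ] K)) := by
  refine AddMonoidHomClass.continuous_of_bound (coeffHom m γ δ)
    (‖ContinuousLinearMap.adjoint (dualEmb m K γ)‖ * ‖dualEmb m K δ‖) fun T => ?_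
  refine (ContinuousLinearMap.opNorm_comp_le _ _).trans ?_
  rw [mul_assoc, mul_comm ‖dualEmb m K δ‖]
  exact mul_le_mul_of_nonneg_left (ContinuousLinearMap.opNorm_comp_le _ _) (norm_nonneg _)

theorem coeffOp_tensorOp (C : K →L[ℂ] K) (S : FockTensor ι →L[ℂ] FockTensor ι)
    (γ δ : MultiWord ι) :
    coeffOp m (tensorOp C S) γ δ = inner ℂ (dualVec m γ) (S (dualVec m δ)) • C := by
  ext y
  refine ext_inner_left ℂ fun x => ?_
  rw [inner_coeffOp, tensorOp_pureTensor, inner_pureTensor, smul_apply, inner_smul_right, mul_comm]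

end Coefficients

/-! ### Monomials and multi-words -/

section Monomials

variable {k : ℕ} {ι : Fin k → Type u}

theorem commute_lift_right {J M : Type*} [Monoid M] (x : M) (g : J → M)
    (h : ∀ b, Commute x (g b)) (w : FreeMonoid J) : Commute x (FreeMonoid.lift g w) := by
  induction w using FreeMonoid.inductionOn' with
  | one => simp
  | of_mul b w ih =>
    rw [map_mul, FreeMonoid.lift_eval_of]
    exact (h b).mul_right ih

theorem commute_lift_lift {J J' M : Type*} [Monoid M] (f : J → M) (g : J' → M)
    (h : ∀ a b, Commute (f a) (g b)) (w : FreeMonoid J) (w' : FreeMonoid J') :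
    Commute (FreeMonoid.lift f w) (FreeMonoid.lift g w') :=
  commute_lift_right _ _ (fun b => (commute_lift_right _ _ (fun a => (h a b).symm) w).symm) w'

variable {H : Type w} [NormedAddCommGroup H] [InnerProductSpace ℂ H]

theorem monomialOp_mul {X : ∀ i, ι i → H →L[ℂ] H}
    (hc : ∀ p q, p ≠ q → ∀ a b, Commute (X p a) (X q b)) (α β : MultiWord ι) :
    monomialOp X (α * β) = monomialOp X α * monomialOp X β := by
  unfold monomialOp
  rw [List.prod_ofFn_mul_prod_ofFn _ _ fun i j hij => commute_lift_lift _ _ (hc i j hij) _ _]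
  simp

theorem lift_smul {J A : Type*} [Ring A] [Algebra ℂ A] (c : ℂ) (X : J → A) (w : FreeMonoid J) :
    FreeMonoid.lift (fun j => c • X j) w = c ^ w.length • FreeMonoid.lift X w := by
  induction w using FreeMonoid.inductionOn' with
  | one => simp
  | of_mul j w ih =>
    rw [map_mul, map_mul, FreeMonoid.lift_eval_of, FreeMonoid.lift_eval_of, ih,
      FreeMonoid.length_mul, FreeMonoid.length_of, smul_mul_smul_comm, pow_add, pow_one]

theorem monomialOp_smul (c : ℂ) (X : ∀ i, ι i → H →L[ℂ] H) (α : MultiWord ι) :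
    monomialOp (fun i j => c • X i j) α = c ^ (∑ i, multiLength α i) • monomialOp X α := by
  have h : ∀ L : List (Fin k), (L.map fun i => FreeMonoid.lift (fun j => c • X i j) (α i)).prod =
      (L.map fun i => c ^ multiLength α i).prod •
        (L.map fun i => FreeMonoid.lift (X i) (α i)).prod := by
    intro L
    induction L with
    | nil => simp
    | cons i L ih =>
      rw [List.map_cons, List.prod_cons, ih, lift_smul, smul_mul_smul_comm]
      rfl
  unfold monomialOp
  rw [List.ofFn_eq_map, h, ← List.ofFn_eq_map, ← List.ofFn_eq_map, List.prod_ofFn,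
    Finset.prod_pow_eq_pow_sum]

theorem exists_mul_of_length_eq_add {J : Type*} (a b : ℕ) (w : FreeMonoid J)
    (h : w.length = a + b) : ∃ x y : FreeMonoid J, x.length = a ∧ y.length = b ∧ x * y = w := by
  refine ⟨FreeMonoid.ofList (w.toList.take a), FreeMonoid.ofList (w.toList.drop a), ?_, ?_, ?_⟩
  · exact (List.length_take ..).trans (min_eq_left (by have : w.toList.length = a + b := h; omega))
  · exact (List.length_drop ..).trans (by have : w.toList.length = a + b := h; omega)
  · exact List.take_append_drop a w.toList

theorem mul_inj_of_multiLength_eq {α α' β β' : MultiWord ι} (h : α * β = α' * β')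
    (hl : multiLength α = multiLength α') : α = α' ∧ β = β' := by
  have : ∀ i, α i = α' i ∧ β i = β' i := fun i =>
    List.append_inj (congrFun h i) (congrFun hl i)
  exact ⟨funext fun i => (this i).1, funext fun i => (this i).2⟩

theorem exists_mul_of_multiLength_eq_add {γ : MultiWord ι} {a b : Fin k → ℕ}
    (h : multiLength γ = a + b) :
    ∃ α β : MultiWord ι, multiLength α = a ∧ multiLength β = b ∧ α * β = γ := by
  choose x y hx hy hxy using fun i => exists_mul_of_length_eq_add (a i) (b i) (γ i) (congrFun h i)
  exact ⟨x, y, funext hx, funext hy, funext hxy⟩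

variable [∀ i, Fintype (ι i)]

variable (ι) in
/-- The finite set of multi-words of multi-length `d`. -/
def multiWords (d : Fin k → ℕ) : Finset (MultiWord ι) :=
  Fintype.piFinset fun i => wordsOfLength (ι i) (d i)

theorem mem_multiWords {d : Fin k → ℕ} {α : MultiWord ι} :
    α ∈ multiWords ι d ↔ multiLength α = d := by
  simp only [multiWords, Fintype.mem_piFinset, mem_wordsOfLength, funext_iff]
  rfl

theorem sum_multiWords_add {M : Type*} [AddCommMonoid M] (a b : Fin k → ℕ) (f : MultiWord ι → M) :
    ∑ γ ∈ multiWords ι (a + b), f γ = ∑ α ∈ multiWords ι a, ∑ β ∈ multiWords ι b, f (α * β) := by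
  rw [← Finset.sum_product']
  symm
  refine Finset.sum_bij (fun p _ => p.1 * p.2) ?_ ?_ ?_ fun _ _ => rfl
  · rintro ⟨α, β⟩ h
    simp only [Finset.mem_product, mem_multiWords] at h ⊢
    rw [multiLength_mul, h.1, h.2]
  · rintro ⟨α, β⟩ h ⟨α', β'⟩ h' heq
    simp only [Finset.mem_product, mem_multiWords] at h h'
    obtain ⟨h1, h2⟩ := mul_inj_of_multiLength_eq heq (h.1.trans h'.1.symm)
    exact Prod.ext h1 h2
  · intro γ hγ
    obtain ⟨α, β, h1, h2, h3⟩ := exists_mul_of_multiLength_eq_add (mem_multiWords.1 hγ)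
    exact ⟨(α, β), by simp [mem_multiWords, h1, h2], h3⟩

variable [CompleteSpace H]

theorem prod_ofFn_PhiMap_pow (X : ∀ i, ι i → H →L[ℂ] H) (d : Fin k → ℕ) (Z : H →L[ℂ] H) :
    (List.ofFn fun i => PhiMap (X i) ^ d i).prod Z =
      ∑ α ∈ multiWords ι d, monomialOp X α * Z * star (monomialOp X α) := by
  have h : ∀ L : List (H →L[ℂ] H),
      (L.map fun a => LinearMap.mulLeftRight ℂ (a, star a)).prod =
        LinearMap.mulLeftRight ℂ (L.prod, star L.prod) := by
    intro L
    induction L with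
    | nil => ext1 Z; simp
    | cons a L ih =>
      rw [List.map_cons, List.prod_cons, ih, mulLeftRight_mul, List.prod_cons, star_mul]
  simp only [PhiMap_pow]
  rw [List.prod_ofFn_sum, LinearMap.sum_apply]
  refine Finset.sum_congr rfl fun α _ => ?_
  have := h (List.ofFn fun i => FreeMonoid.lift (X i) (α i))
  rw [List.map_ofFn] at this
  exact (DFunLike.congr_fun this Z).trans (by simp [monomialOp])

theorem defectTerm_eq_sum (m : Fin k → ℕ) (X : ∀ i, ι i → H →L[ℂ] H) (d : Fin k → ℕ) :
    defectTerm m X d = (multiCoeff m d : ℂ) •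
      ∑ α ∈ multiWords ι d, monomialOp X α * defectMap X m 1 * star (monomialOp X α) := by
  rw [defectTerm, prod_ofFn_PhiMap_pow]

end Monomials

/-! ### Sums of compressions -/

section Compression

variable {E₁ E₂ : Type*} [NormedAddCommGroup E₁] [InnerProductSpace ℂ E₁] [CompleteSpace E₁]
  [NormedAddCommGroup E₂] [InnerProductSpace ℂ E₂] [CompleteSpace E₂]

theorem adjoint_sum_comp_comp_sum {J : Type*} (s t : Finset J) (V : J → E₁ →L[ℂ] E₂)
    (S : E₂ →L[ℂ] E₂) :
    ContinuousLinearMap.adjoint (∑ i ∈ s, V i) ∘L S ∘L ∑ j ∈ t, V j =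
      ∑ i ∈ s, ∑ j ∈ t, ContinuousLinearMap.adjoint (V i) ∘L S ∘L V j := by
  rw [map_sum]
  simp only [ContinuousLinearMap.finsetSum_comp, ContinuousLinearMap.comp_finsetSum]
  exact Finset.sum_comm

theorem hasSum_adjoint_comp_comp {J : Type*} {V : J → E₁ →L[ℂ] E₂} {V₀ : E₁ →L[ℂ] E₂}
    (hs : Summable fun j => ‖V j‖) (hV : HasSum V V₀) (S : E₂ →L[ℂ] E₂) :
    HasSum (fun p : J × J => ContinuousLinearMap.adjoint (V p.1) ∘L S ∘L V p.2)
      (ContinuousLinearMap.adjoint V₀ ∘L S ∘L V₀) := by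
  have hsum : Summable fun p : J × J => ContinuousLinearMap.adjoint (V p.1) ∘L S ∘L V p.2 := by
    refine Summable.of_norm_bounded (g := fun p : J × J => ‖S‖ * (‖V p.1‖ * ‖V p.2‖))
      ((hs.mul_of_nonneg hs (fun _ => norm_nonneg _) fun _ => norm_nonneg _).mul_left _) fun p => ?_
    refine (ContinuousLinearMap.opNorm_comp_le _ _).trans ?_
    rw [LinearIsometryEquiv.norm_map]
    refine (mul_le_mul_of_nonneg_left (ContinuousLinearMap.opNorm_comp_le _ _)
      (norm_nonneg _)).trans_eq ?_
    ring
  have h1 : HasSum (fun i => ContinuousLinearMap.adjoint (V i) ∘L S ∘L V₀)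
      (ContinuousLinearMap.adjoint V₀ ∘L S ∘L V₀) := by
    have ha : HasSum (fun i => ContinuousLinearMap.adjoint (V i))
        (ContinuousLinearMap.adjoint V₀) :=
      hV.map (ContinuousLinearMap.adjoint (𝕜 := ℂ) (E := E₁) (F := E₂))
        (LinearIsometryEquiv.continuous _)
    exact ((ContinuousLinearMap.compL ℂ E₁ E₂ E₁).flip (S ∘L V₀)).hasSum ha
  have h2 : ∀ i, HasSum (fun j => ContinuousLinearMap.adjoint (V i) ∘L S ∘L V j)
      (ContinuousLinearMap.adjoint (V i) ∘L S ∘L V₀) := fun i =>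
    (ContinuousLinearMap.compL ℂ E₁ E₂ E₁ (ContinuousLinearMap.adjoint (V i))).hasSum
      ((ContinuousLinearMap.compL ℂ E₁ E₂ E₂ S).hasSum hV)
  have h3 := hsum.hasSum.prod_fiberwise h2
  rw [h1.unique h3]
  exact hsum.hasSum

theorem norm_le_one_of_adjoint_comp_self_eq_one {V : E₁ →L[ℂ] E₂}
    (h : ContinuousLinearMap.adjoint V ∘L V = 1) : ‖V‖ ≤ 1 := by
  have h1 := ContinuousLinearMap.norm_adjoint_comp_self V
  rw [h] at h1
  have h2 : ‖(1 : E₁ →L[ℂ] E₁)‖ ≤ 1 := ContinuousLinearMap.norm_id_le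
  nlinarith [norm_nonneg V]

/-- If the blocks `V_d` have mutually orthogonal ranges and `∑ V_d^* V_d = 1`, then `∑ V_d` is an
isometry. Grouping the double series of the compression `(∑ V_d)^* S (∑ V_d)` in any way gives a
series whose sum has norm at most `‖S‖`. -/
theorem exists_hasSum_compression {I J J' : Type*} [DecidableEq J] {V : J → E₁ →L[ℂ] E₂}
    (hs : Summable fun j => ‖V j‖) {D : J → E₁ →L[ℂ] E₁}
    (hVD : ∀ i j, ContinuousLinearMap.adjoint (V i) ∘L V j = if i = j then D i else 0)
    (hD : HasSum D 1) (S : E₂ →L[ℂ] E₂) (e : I × J' ≃ J × J) {Q : I → E₁ →L[ℂ] E₁}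
    (hQ : ∀ s, HasSum (fun n => ContinuousLinearMap.adjoint (V (e (s, n)).1) ∘L S ∘L
      V (e (s, n)).2) (Q s)) :
    ∃ S₀, HasSum Q S₀ ∧ ‖S₀‖ ≤ ‖S‖ := by
  obtain ⟨V₀, hV⟩ : ∃ V₀, HasSum V V₀ := ⟨_, hs.of_norm.hasSum⟩
  have hV1 : ContinuousLinearMap.adjoint V₀ ∘L V₀ = 1 := by
    have h2 : HasSum (fun p : J × J => if p.1 = p.2 then D p.1 else 0)
        (ContinuousLinearMap.adjoint V₀ ∘L V₀) := by
      simp only [← hVD]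
      exact hasSum_adjoint_comp_comp hs hV 1
    have hinj : Function.Injective fun d : J => (d, d) := fun a b h => (Prod.mk.inj h).1
    rw [← hinj.hasSum_iff] at h2
    · have e : (fun p : J × J => if p.1 = p.2 then D p.1 else 0) ∘ (fun d : J => (d, d)) = D :=
        funext fun d => if_pos rfl
      rw [e] at h2
      exact h2.unique hD
    · rintro ⟨d, d'⟩ hd
      exact if_neg fun h => hd ⟨d, Prod.ext rfl h⟩
  have hVn := norm_le_one_of_adjoint_comp_self_eq_one hV1
  refine ⟨ContinuousLinearMap.adjoint V₀ ∘L S ∘L V₀, ?_, ?_⟩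
  · have h2 := hasSum_adjoint_comp_comp hs hV S
    rw [← e.hasSum_iff] at h2
    exact h2.prod_fiberwise hQ
  · calc _ ≤ ‖ContinuousLinearMap.adjoint V₀‖ * (‖S‖ * ‖V₀‖) :=
          (ContinuousLinearMap.opNorm_comp_le _ _).trans (mul_le_mul_of_nonneg_left
            (ContinuousLinearMap.opNorm_comp_le _ _) (norm_nonneg _))
      _ ≤ 1 * (‖S‖ * 1) := by
          rw [LinearIsometryEquiv.norm_map]
          gcongr
      _ = ‖S‖ := by ring

end Compression

/-! ### The Berezin transform of a Toeplitz operator -/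

section Berezin

variable {k : ℕ} {ι : Fin k → Type u} (m : Fin k → ℕ)
  {K : Type v} [NormedAddCommGroup K] [InnerProductSpace ℂ K] [CompleteSpace K]

open Classical in
/-- The coefficients of `T` with respect to the dual basis are those of the formal series
`∑ A_{α,β} ⊗ W_α W_β^*`. Every pair of multi-words is of the form `(α γ, β δ)` with `(α, β) ∈ J` and
`γ`, `δ` of the same multi-length. -/
def HasToeplitzCoeffs (A : MultiWord ι → MultiWord ι → K →L[ℂ] K)
    (T : HilbertTensor K (FockTensor ι) →L[ℂ] HilbertTensor K (FockTensor ι)) : Prop :=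
  ∀ α β γ δ : MultiWord ι, (α, β) ∈ pairsJ ι → multiLength γ = multiLength δ →
    coeffOp m T (α * γ) (β * δ) = if γ = δ then (wordCoeff m γ : ℂ) • A α β else 0

theorem coeffOp_one (hm : ∀ i, 1 ≤ m i) (γ δ : MultiWord ι) [Decidable (γ = δ)] :
    coeffOp m (1 : HilbertTensor K (FockTensor ι) →L[ℂ] _) γ δ =
      if γ = δ then (wordCoeff m γ : ℂ) • (1 : K →L[ℂ] K) else 0 := by
  have h := coeffOp_tensorOp m (1 : K →L[ℂ] K) (1 : FockTensor ι →L[ℂ] FockTensor ι) γ δ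
  rw [tensorOp_eq_tensorMap, tensorMap_one_one, one_apply_eq_self, inner_dualVec_dualVec hm] at h
  rw [h]
  split_ifs <;> simp

variable [∀ i, Fintype (ι i)]
  {H : Type w} [NormedAddCommGroup H] [InnerProductSpace ℂ H] [CompleteSpace H]

/-- The component of degree `d` of the Berezin kernel
`x ⊗ h ↦ ∑_α (x ⊗ f'_α) ⊗ B X_α^* h`, where `B^* B` is the defect operator of `X`. -/
def berezinBlock (X : ∀ i, ι i → H →L[ℂ] H) (B : H →L[ℂ] H) (d : Fin k → ℕ) :
    HilbertTensor K H →L[ℂ] HilbertTensor (HilbertTensor K (FockTensor ι)) H :=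
  ∑ α ∈ multiWords ι d, tensorMap (dualEmb m K α) (B * star (monomialOp X α))

theorem berezinBlock_compression (X : ∀ i, ι i → H →L[ℂ] H) (B : H →L[ℂ] H)
    (T : HilbertTensor K (FockTensor ι) →L[ℂ] HilbertTensor K (FockTensor ι)) (d d' : Fin k → ℕ) :
    ContinuousLinearMap.adjoint (berezinBlock m (K := K) X B d) ∘L
      tensorMap T (1 : H →L[ℂ] H) ∘L berezinBlock m X B d' =
    ∑ γ ∈ multiWords ι d, ∑ δ ∈ multiWords ι d',
      tensorMap (coeffOp m T γ δ)
        (monomialOp X γ * (star B * B) * star (monomialOp X δ)) := by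
  rw [berezinBlock, berezinBlock, adjoint_sum_comp_comp_sum]
  refine Finset.sum_congr rfl fun γ _ => Finset.sum_congr rfl fun δ _ => ?_
  rw [adjoint_tensorMap, tensorMap_comp, tensorMap_comp, ← ContinuousLinearMap.star_eq_adjoint,
    star_mul, star_star]
  rfl

variable {m}

theorem adjoint_berezinBlock_comp (hm : ∀ i, 1 ≤ m i) (X : ∀ i, ι i → H →L[ℂ] H) (B : H →L[ℂ] H)
    (hB : star B * B = defectMap X m 1) (d d' : Fin k → ℕ) :
    ContinuousLinearMap.adjoint (berezinBlock m (K := K) X B d) ∘L berezinBlock m X B d' =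
      if d = d' then tensorMap 1 (defectTerm m X d) else 0 := by
  classical
  have h := berezinBlock_compression m X B (1 : HilbertTensor K (FockTensor ι) →L[ℂ] _) d d'
  rw [tensorMap_one_one] at h
  refine (show _ = _ from h).trans ?_
  rw [hB]
  simp only [coeffOp_one m hm]
  split_ifs with hd
  · subst hd
    rw [defectTerm_eq_sum, tensorMap_smul_right, tensorMap_sum_right, Finset.smul_sum]
    refine Finset.sum_congr rfl fun γ hγ => ?_
    rw [Finset.sum_eq_single_of_mem γ hγ fun δ _ hδ => by
      rw [if_neg hδ.symm, tensorMap_zero_left], if_pos rfl, tensorMap_smul_left, wordCoeff,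
      mem_multiWords.1 hγ]
  · refine Finset.sum_eq_zero fun γ hγ => Finset.sum_eq_zero fun δ hδ => ?_
    rw [if_neg, tensorMap_zero_left]
    rintro rfl
    exact hd ((mem_multiWords.1 hγ).symm.trans (mem_multiWords.1 hδ))

theorem norm_berezinBlock_sq_le (hm : ∀ i, 1 ≤ m i) (X : ∀ i, ι i → H →L[ℂ] H) (B : H →L[ℂ] H)
    (hB : star B * B = defectMap X m 1) (d : Fin k → ℕ) :
    ‖berezinBlock m (K := K) X B d‖ ^ 2 ≤ ‖defectTerm m X d‖ := by
  have h := ContinuousLinearMap.norm_adjoint_comp_self (berezinBlock m (K := K) X B d)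
  rw [adjoint_berezinBlock_comp hm X B hB, if_pos rfl] at h
  rw [sq, ← h]
  refine (norm_tensorMap_le _ _).trans ?_
  exact mul_le_of_le_one_left (norm_nonneg _) ContinuousLinearMap.norm_id_le

theorem summable_norm_berezinBlock (hm : ∀ i, 1 ≤ m i) {ρ : ℝ} (h0 : 0 ≤ ρ) (h1 : ρ < 1)
    (X : ∀ i, ι i → H →L[ℂ] H) (hX : ∀ i Z, ‖PhiMap (X i) Z‖ ≤ ρ * ‖Z‖) (B : H →L[ℂ] H)
    (hB : star B * B = defectMap X m 1) :
    Summable fun d => ‖berezinBlock m (K := K) X B d‖ := by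
  have hr0 : 0 ≤ √ρ := Real.sqrt_nonneg ρ
  have hr1 : √ρ < 1 := by rw [Real.sqrt_lt' one_pos]; simpa using h1
  refine .of_nonneg_of_le (fun _ => ContinuousLinearMap.opNorm_nonneg _) (fun d => ?_)
    ((summable_pi_prod (fun i n => ((m i).multichoose n : ℝ) * √ρ ^ n) (fun _ _ => by positivity)
      fun i => summable_multichoose_mul_pow (hm i) hr0 hr1).mul_right (√‖defectMap X m 1‖))
  refine le_of_sq_le_sq ?_ (by positivity)
  refine (norm_berezinBlock_sq_le hm X B hB d).trans ((norm_defectTerm_le h0 X hX d).trans ?_)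
  rw [mul_pow, Real.sq_sqrt (norm_nonneg _), ← Finset.prod_pow]
  refine mul_le_mul_of_nonneg_right (Finset.prod_le_prod (fun _ _ => by positivity)
    fun i _ => ?_) (norm_nonneg _)
  -- `b ρ^l ≤ (b √ρ^l)²` since the coefficient `b` is at least `1`
  have hb : (1 : ℝ) ≤ (m i).multichoose (d i) := by exact_mod_cast one_le_multichoose (hm i) (d i)
  rw [mul_pow, ← pow_mul, mul_comm (d i) 2, pow_mul, Real.sq_sqrt h0]
  exact mul_le_mul_of_nonneg_right (by nlinarith) (by positivity)

/-- Pairs of multi-degrees are parametrized by their difference `s ∈ ℤ^k` and their minimum. -/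
def degreeEquiv (k : ℕ) : (Fin k → ℤ) × (Fin k → ℕ) ≃ (Fin k → ℕ) × (Fin k → ℕ) where
  toFun p := ((fun i => (p.1 i).toNat) + p.2, (fun i => (-p.1 i).toNat) + p.2)
  invFun q := (fun i => (q.1 i : ℤ) - q.2 i, fun i => min (q.1 i) (q.2 i))
  left_inv p := by
    ext i <;> simp only [Pi.add_apply] <;> omega
  right_inv q := by
    ext i <;> simp only [Pi.add_apply] <;> omega

theorem sum_compression_eq {A : MultiWord ι → MultiWord ι → K →L[ℂ] K}
    {T : HilbertTensor K (FockTensor ι) →L[ℂ] HilbertTensor K (FockTensor ι)}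
    (hT : HasToeplitzCoeffs m A T) (X : ∀ i, ι i → H →L[ℂ] H)
    (hc : ∀ p q, p ≠ q → ∀ a b, Commute (X p a) (X q b)) (s : Fin k → ℤ) (n : Fin k → ℕ) :
    ∑ γ ∈ multiWords ι ((fun i => (s i).toNat) + n),
      ∑ δ ∈ multiWords ι ((fun i => (-s i).toNat) + n),
        tensorMap (coeffOp m T γ δ) (monomialOp X γ * defectMap X m 1 * star (monomialOp X δ)) =
    ∑ α ∈ multiWords ι (fun i => (s i).toNat), ∑ β ∈ multiWords ι (fun i => (-s i).toNat),
      tensorMap (A α β) (monomialOp X α * defectTerm m X n * star (monomialOp X β)) := by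
  classical
  rw [sum_multiWords_add]
  refine Finset.sum_congr rfl fun α hα => ?_
  simp only [sum_multiWords_add]
  rw [Finset.sum_comm]
  refine Finset.sum_congr rfl fun β hβ => ?_
  have hJ : (α, β) ∈ pairsJ ι := ⟨s, fun i => ⟨congrFun (mem_multiWords.1 hα) i,
    congrFun (mem_multiWords.1 hβ) i⟩⟩
  rw [defectTerm_eq_sum, mul_smul_comm, smul_mul_assoc, tensorMap_smul_right, Finset.mul_sum,
    Finset.sum_mul, tensorMap_sum_right, Finset.smul_sum]
  refine Finset.sum_congr rfl fun γ hγ => ?_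
  rw [Finset.sum_eq_single_of_mem γ hγ]
  · rw [hT α β γ γ hJ rfl, if_pos rfl, tensorMap_smul_left, wordCoeff, mem_multiWords.1 hγ,
      monomialOp_mul hc, monomialOp_mul hc, star_mul]
    simp only [mul_assoc]
  · intro δ hδ hne
    rw [hT α β γ δ hJ ((mem_multiWords.1 hγ).trans (mem_multiWords.1 hδ).symm), if_neg hne.symm,
      tensorMap_zero_left]

/-- If `T` has Toeplitz coefficients `A`, then at every commuting tuple `X` with strictly contractive
rows and positive defect operator the pluriharmonic series with coefficients `A` converges, and its
sum, the compression of `T ⊗ I` by the Berezin kernel of `X`, has norm at most `‖T‖`. -/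
theorem exists_hasSum_homogeneousPart (hm : ∀ i, 1 ≤ m i)
    {A : MultiWord ι → MultiWord ι → K →L[ℂ] K}
    {T : HilbertTensor K (FockTensor ι) →L[ℂ] HilbertTensor K (FockTensor ι)}
    (hT : HasToeplitzCoeffs m A T) {ρ : ℝ} (h0 : 0 ≤ ρ) (h1 : ρ < 1)
    (X : ∀ i, ι i → H →L[ℂ] H) (hc : ∀ p q, p ≠ q → ∀ a b, Commute (X p a) (X q b))
    (hX : ∀ i Z, ‖PhiMap (X i) Z‖ ≤ ρ * ‖Z‖) (hpos : (defectMap X m 1).IsPositive) :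
    ∃ S, HasSum (fun s => homogeneousPart A s X) S ∧ ‖S‖ ≤ ‖T‖ := by
  classical
  obtain ⟨B, hB'⟩ := CStarAlgebra.nonneg_iff_eq_star_mul_self.1
    ((ContinuousLinearMap.nonneg_iff_isPositive _).2 hpos)
  have hB : star B * B = defectMap X m 1 := hB'.symm
  have hZ := hasSum_defectTerm hm h0 h1 X hc hX
  have hZ1 : HasSum (fun d => tensorMap (1 : K →L[ℂ] K) (defectTerm m X d)) 1 := by
    have h := hZ.tensorMap_right (1 : K →L[ℂ] K)
    rwa [tensorMap_one_one] at h
  have hQ : ∀ s : Fin k → ℤ, HasSum (fun n : Fin k → ℕ =>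
      ContinuousLinearMap.adjoint (berezinBlock m (K := K) X B (degreeEquiv k (s, n)).1) ∘L
        tensorMap T (1 : H →L[ℂ] H) ∘L berezinBlock m X B (degreeEquiv k (s, n)).2)
      (homogeneousPart A s X) := by
    intro s
    simp only [berezinBlock_compression, hB, degreeEquiv, Equiv.coe_fn_mk,
      sum_compression_eq hT X hc]
    refine hasSum_sum fun α _ => hasSum_sum fun β _ => ?_
    have h3 := ((hZ.mul_left (monomialOp X α)).mul_right (star (monomialOp X β))).tensorMap_right
      (A α β)
    rwa [mul_one] at h3
  obtain ⟨S, hS, hn⟩ := exists_hasSum_compression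
    (summable_norm_berezinBlock (K := K) hm h0 h1 X hX B hB)
    (adjoint_berezinBlock_comp hm X B hB) hZ1 (tensorMap T (1 : H →L[ℂ] H)) (degreeEquiv k) hQ
  exact ⟨S, hS, hn.trans ((norm_tensorMap_le _ _).trans
    (mul_le_of_le_one_right (norm_nonneg _) ContinuousLinearMap.norm_id_le))⟩

/-- The tuples of the radial poly-hyperball satisfy the assumptions under which the Berezin
transform is defined. -/
theorem exists_of_mem_radialPolyHyperball (hm : ∀ i, 1 ≤ m i) {X : ∀ i, ι i → H →L[ℂ] H}
    (hX : X ∈ radialPolyHyperball ι m H) :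
    ∃ ρ : ℝ, 0 ≤ ρ ∧ ρ < 1 ∧ (∀ p q, p ≠ q → ∀ a b, Commute (X p a) (X q b)) ∧
      (∀ i Z, ‖PhiMap (X i) Z‖ ≤ ρ * ‖Z‖) ∧ (defectMap X m 1).IsPositive := by
  obtain ⟨t, h0, h1, Y, hY, rfl⟩ := hX
  refine ⟨t ^ 2, by positivity, by nlinarith, fun p q hpq a b => ?_, fun i Z => ?_,
    isPositive_defectMap_smul hY h0 h1.le⟩
  · exact ((hY.1 p q hpq a b).smul_left _).smul_right _
  · rw [PhiMap_smul, LinearMap.smul_apply, norm_smul, Complex.norm_real,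
      Real.norm_of_nonneg (by positivity)]
    exact mul_le_mul_of_nonneg_left (norm_PhiMap_le_of_mem_polyHyperball hm hY i Z) (by positivity)

end Berezin

/-! ### Strong and weak operator closures -/

section Closures

variable {E : Type v} [NormedAddCommGroup E] [InnerProductSpace ℂ E]

theorem sotClosure_subset_wotClosure (S : Set (E →L[ℂ] E)) : sotClosure S ⊆ wotClosure S := by
  intro T hT
  let Ψ : PointwiseConvergenceCLM (RingHom.id ℂ) E E → (E →WOT[ℂ] E) := fun A =>
    ContinuousLinearMapWOT.ofCLM (show E →L[ℂ] E from A)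
  have hΨ : Continuous Ψ := ContinuousLinearMapWOT.continuous_of_dual_apply_continuous fun x y =>
    y.continuous.comp (continuous_eval_const (F := PointwiseConvergenceCLM (RingHom.id ℂ) E E) x)
  have h := image_closure_subset_closure_image hΨ (Set.mem_image_of_mem Ψ hT)
  rwa [Set.image_image] at h

theorem mem_sotClosure_of_tendsto {I : Type*} {l : Filter I} [l.NeBot] {S : Set (E →L[ℂ] E)}
    {f : I → E →L[ℂ] E} {T : E →L[ℂ] E} (hf : ∀ i, f i ∈ closure S)
    (hT : ∀ ξ, Tendsto (fun i => f i ξ) l (𝓝 (T ξ))) : T ∈ sotClosure S := by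
  let Ψ := ContinuousLinearMap.toPointwiseConvergenceCLM ℂ (RingHom.id ℂ) E E
  have h : ∀ i, Ψ (f i) ∈ closure (Ψ '' S) := fun i =>
    image_closure_subset_closure_image Ψ.continuous (Set.mem_image_of_mem Ψ (hf i))
  have h2 : Tendsto (fun i => Ψ (f i)) l (𝓝 (Ψ T)) :=
    PointwiseConvergenceCLM.tendsto_iff_forall_tendsto.2 hT
  have := mem_closure_of_tendsto h2 (Eventually.of_forall h)
  rwa [closure_closure] at this

theorem inner_eq_mul_inner_of_mem_wotClosure {S : Set (E →L[ℂ] E)} {x₁ y₁ x₂ y₂ : E} {c : ℂ}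
    (h : ∀ T ∈ S, inner ℂ x₁ (T y₁) = c * inner ℂ x₂ (T y₂)) {T : E →L[ℂ] E}
    (hT : T ∈ wotClosure S) : inner ℂ x₁ (T y₁) = c * inner ℂ x₂ (T y₂) := by
  have hcl : IsClosed {A : E →WOT[ℂ] E | innerSL ℂ x₁ (A y₁) = c * innerSL ℂ x₂ (A y₂)} :=
    isClosed_eq (ContinuousLinearMapWOT.continuous_dual_apply _ _)
      (continuous_const.mul (ContinuousLinearMapWOT.continuous_dual_apply _ _))
  have hsub : closure (ContinuousLinearMapWOT.ofCLM '' S) ⊆ _ := closure_minimal (by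
    rintro _ ⟨A, hA, rfl⟩
    exact h A hA) hcl
  exact hsub hT

end Closures
/-! ### Toeplitz coefficients of the model monomials -/

section ModelCoefficients

variable {k : ℕ} {ι : Fin k → Type u} {m : Fin k → ℕ}

theorem mem_pairsJ_iff {α β : MultiWord ι} :
    (α, β) ∈ pairsJ ι ↔ ∀ i, multiLength α i = 0 ∨ multiLength β i = 0 := by
  constructor
  · rintro ⟨s, hs⟩ i
    have : (α i).length = (s i).toNat ∧ (β i).length = (-s i).toNat := hs i
    simp only [multiLength]
    omega
  · intro h
    refine ⟨fun i => (multiLength α i : ℤ) - multiLength β i, fun i => ?_⟩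
    have := h i
    simp only [multiLength] at this ⊢
    omega

/-- Every pair of multi-words is of the form `(α γ, β δ)` with `(α, β) ∈ J` and `γ`, `δ` of the same
multi-length. -/
theorem exists_eq_mul_mul (γ δ : MultiWord ι) : ∃ α β γ' δ' : MultiWord ι, (α, β) ∈ pairsJ ι ∧
    multiLength γ' = multiLength δ' ∧ α * γ' = γ ∧ β * δ' = δ := by
  set n : Fin k → ℕ := fun i => min (multiLength γ i) (multiLength δ i)
  obtain ⟨α, γ', h1, h2, h3⟩ := exists_mul_of_multiLength_eq_add (γ := γ)
    (a := fun i => multiLength γ i - n i) (b := n) (funext fun i => by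
      simp only [Pi.add_apply, n]; omega)
  obtain ⟨β, δ', h4, h5, h6⟩ := exists_mul_of_multiLength_eq_add (γ := δ)
    (a := fun i => multiLength δ i - n i) (b := n) (funext fun i => by
      simp only [Pi.add_apply, n]; omega)
  refine ⟨α, β, γ', δ', mem_pairsJ_iff.2 fun i => ?_, h2.trans h5.symm, h3, h6⟩
  rw [h1, h4]
  simp only [n]
  omega

open Classical in
/-- In terms of the dual basis, `W_α^*` removes the prefix `α`. For pairs in `J` the coefficients of
`W_α W_β^*` are therefore supported on the pairs `(α γ, β γ)`. -/
theorem inner_dualVec_monomialOp (hm : ∀ i, 1 ≤ m i) {α β α₀ β₀ γ δ : MultiWord ι}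
    (h : (α, β) ∈ pairsJ ι) (h₀ : (α₀, β₀) ∈ pairsJ ι) (hγ : multiLength γ = multiLength δ) :
    inner ℂ (dualVec m (α₀ * γ)) ((monomialOp (leftModel ι m) α *
      star (monomialOp (leftModel ι m) β)) (dualVec m (β₀ * δ))) =
      if (α₀ = α ∧ β₀ = β) ∧ γ = δ then (wordCoeff m γ : ℂ) else 0 := by
  rw [mul_apply_eq_comp, ← ContinuousLinearMap.adjoint_inner_left,
    ← ContinuousLinearMap.star_eq_adjoint]
  rw [mem_pairsJ_iff] at h h₀
  have hW := fun α : MultiWord ι => monomialOp_leftModel_primalVec hm α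
  by_cases h1 : ∃ σ, α * σ = α₀ * γ
  · obtain ⟨σ, h1⟩ := h1
    by_cases h2 : ∃ τ, β * τ = β₀ * δ
    · obtain ⟨τ, h2⟩ := h2
      rw [← h1, ← h2, star_apply_dualVec_of_eq hm (mul_right_injective α) (hW α),
        star_apply_dualVec_of_eq hm (mul_right_injective β) (hW β), inner_dualVec_dualVec hm]
      have hl1 := congrArg multiLength h1
      have hl2 := congrArg multiLength h2
      rw [multiLength_mul, multiLength_mul] at hl1 hl2
      by_cases hστ : σ = τ
      · subst hστ
        have hl : multiLength α = multiLength α₀ ∧ multiLength β = multiLength β₀ := by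
          constructor <;> funext i <;>
          · have a1 := congrFun hl1 i
            have a2 := congrFun hl2 i
            have a3 := congrFun hγ i
            have a4 := h i
            have a5 := h₀ i
            simp only [Pi.add_apply] at a1 a2
            omega
        obtain ⟨rfl, rfl⟩ := mul_inj_of_multiLength_eq h1 hl.1
        obtain ⟨rfl, rfl⟩ := mul_inj_of_multiLength_eq h2 hl.2
        simp
      · rw [if_neg hστ, if_neg]
        rintro ⟨⟨rfl, rfl⟩, rfl⟩
        exact hστ ((mul_left_cancel h1).trans (mul_left_cancel h2).symm)
    · rw [star_apply_dualVec_of_ne hm (hW β) (by simpa using h2), inner_zero_right, if_neg]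
      rintro ⟨⟨-, rfl⟩, -⟩
      exact h2 ⟨_, rfl⟩
  · rw [star_apply_dualVec_of_ne hm (hW α) (by simpa using h1), inner_zero_left, if_neg]
    rintro ⟨⟨rfl, -⟩, -⟩
    exact h1 ⟨_, rfl⟩

variable {K : Type v} [NormedAddCommGroup K] [InnerProductSpace ℂ K]

theorem homogeneousPart_mem_toeplitzSpan [∀ i, Fintype (ι i)] (A : MultiWord ι → MultiWord ι → K →L[ℂ] K)
    (s : Fin k → ℤ) (c : ℂ) :
    homogeneousPart A s (fun i j => c • leftModel ι m i j) ∈ toeplitzSpan ι m K := by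
  refine Submodule.sum_mem _ fun α hα => Submodule.sum_mem _ fun β hβ => ?_
  have hJ : (α, β) ∈ pairsJ ι := ⟨s, fun i => ⟨congrFun (mem_multiWords.1 hα) i,
    congrFun (mem_multiWords.1 hβ) i⟩⟩
  rw [monomialOp_smul, monomialOp_smul, star_smul, smul_mul_smul_comm, tensorOp_eq_tensorMap,
    tensorMap_smul_right]
  exact Submodule.smul_mem _ _ (Submodule.subset_span ⟨_, _, _, hJ, rfl⟩)

variable [CompleteSpace K]

theorem HasToeplitzCoeffs.coeff_eq {A : MultiWord ι → MultiWord ι → K →L[ℂ] K}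
    {T : HilbertTensor K (FockTensor ι) →L[ℂ] HilbertTensor K (FockTensor ι)}
    (hT : HasToeplitzCoeffs m A T) {α β : MultiWord ι} (h : (α, β) ∈ pairsJ ι) :
    coeffOp m T α β = A α β := by
  have := hT α β 1 1 h rfl
  simpa using this

open Classical in
theorem coeffOp_tensorOp_monomialOp (hm : ∀ i, 1 ≤ m i) (C : K →L[ℂ] K) {α β α₀ β₀ γ δ : MultiWord ι}
    (h : (α, β) ∈ pairsJ ι) (h₀ : (α₀, β₀) ∈ pairsJ ι) (hγ : multiLength γ = multiLength δ) :
    coeffOp m (tensorOp C (monomialOp (leftModel ι m) α * star (monomialOp (leftModel ι m) β)))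
      (α₀ * γ) (β₀ * δ) = if (α₀ = α ∧ β₀ = β) ∧ γ = δ then (wordCoeff m γ : ℂ) • C else 0 := by
  rw [coeffOp_tensorOp, inner_dualVec_monomialOp hm h h₀ hγ, ite_smul, zero_smul]

theorem hasToeplitzCoeffs_of_mem_toeplitzSpan (hm : ∀ i, 1 ≤ m i)
    {T : HilbertTensor K (FockTensor ι) →L[ℂ] HilbertTensor K (FockTensor ι)}
    (hT : T ∈ toeplitzSpan ι m K) : HasToeplitzCoeffs m (coeffOp m T) T := by
  classical
  intro α₀ β₀ γ δ h₀ hl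
  induction hT using Submodule.span_induction with
  | mem S hS =>
    obtain ⟨C, α, β, h, rfl⟩ := hS
    have h1 := coeffOp_tensorOp_monomialOp hm C h h₀ hl
    have h2 := coeffOp_tensorOp_monomialOp hm C h h₀ (rfl : multiLength (1 : MultiWord ι) = _)
    simp only [mul_one, and_true] at h2
    rw [h1, h2, wordCoeff_one]
    by_cases hγ : γ = δ <;> by_cases hα : α₀ = α ∧ β₀ = β <;> simp [hγ, hα]
  | zero =>
    have : ∀ γ δ, coeffOp m (0 : HilbertTensor K (FockTensor ι) →L[ℂ] _) γ δ = 0 := fun γ δ =>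
      map_zero (coeffHom m γ δ)
    simp [this]
  | add S T _ _ h1 h2 =>
    rw [coeffOp_add, coeffOp_add, h1, h2]
    split_ifs <;> simp
  | smul c T _ h1 =>
    rw [coeffOp_smul, coeffOp_smul, h1]
    split_ifs
    · rw [smul_comm]
    · simp

theorem hasToeplitzCoeffs_of_mem_wotClosure (hm : ∀ i, 1 ≤ m i)
    {T : HilbertTensor K (FockTensor ι) →L[ℂ] HilbertTensor K (FockTensor ι)}
    (hT : T ∈ wotClosure (toeplitzSpan ι m K : Set (HilbertTensor K (FockTensor ι) →L[ℂ] _))) :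
    HasToeplitzCoeffs m (coeffOp m T) T := by
  classical
  intro α β γ δ h hl
  ext y
  refine ext_inner_left ℂ fun x => ?_
  have key := inner_eq_mul_inner_of_mem_wotClosure (x₁ := pureTensor x (dualVec m (α * γ)))
    (y₁ := pureTensor y (dualVec m (β * δ))) (x₂ := pureTensor x (dualVec m α))
    (y₂ := pureTensor y (dualVec m β)) (c := if γ = δ then (wordCoeff m γ : ℂ) else 0)
    (fun S hS => ?_) hT
  · simp only [← inner_coeffOp] at key
    rw [key]
    split_ifs
    · rw [smul_apply, inner_smul_right]
    · simp
  · have h1 := hasToeplitzCoeffs_of_mem_toeplitzSpan hm hS α β γ δ h hl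
    simp only [← inner_coeffOp]
    rw [h1]
    split_ifs
    · rw [smul_apply, inner_smul_right]
    · simp

end ModelCoefficients
/-! ### Radial limits -/

section RadialLimits

variable {k : ℕ} {ι : Fin k → Type u} {m : Fin k → ℕ}
  {K : Type v} [NormedAddCommGroup K] [InnerProductSpace ℂ K]

theorem tendsto_apply_of_tendsto_basisEmb {I : Type*} {l : Filter I} {C : ℝ}
    {S : I → HilbertTensor K (FockTensor ι) →L[ℂ] HilbertTensor K (FockTensor ι)}
    {T : HilbertTensor K (FockTensor ι) →L[ℂ] HilbertTensor K (FockTensor ι)}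
    (hC : ∀ i, ‖S i‖ ≤ C)
    (h : ∀ δ x, Tendsto (fun i => S i (basisEmb K δ x)) l (𝓝 (T (basisEmb K δ x))))
    (ξ : HilbertTensor K (FockTensor ι)) : Tendsto (fun i => S i ξ) l (𝓝 (T ξ)) := by
  have hcl : IsClosed {ξ | Tendsto (fun i => S i ξ) l (𝓝 (T ξ))} := by
    have heq : (∃ C, ∀ i, ‖S i‖ ≤ C) ↔ Equicontinuous fun i => ⇑(S i) :=
      (NormedSpace.equicontinuous_TFAE S).out 5 1
    exact (heq.1 ⟨C, hC⟩).isClosed_setOfPred_tendsto T.continuous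
  let P : Submodule ℂ (HilbertTensor K (FockTensor ι)) :=
    { carrier := {ξ | Tendsto (fun i => S i ξ) l (𝓝 (T ξ))}
      add_mem' := fun {a b} ha hb => by
        have := Tendsto.add ha hb
        simpa only [Set.mem_ofPred_eq, map_add] using this
      zero_mem' := by simpa using tendsto_const_nhds
      smul_mem' := fun c a ha => by
        have := Tendsto.const_smul ha c
        simpa only [Set.mem_ofPred_eq, map_smul] using this }
  have hP : P.topologicalClosure = ⊤ := by
    rw [Submodule.topologicalClosure_eq_top_iff, Submodule.eq_bot_iff]
    intro z hz
    have : innerSL ℂ z = 0 := by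
      refine hilbertTensor_fock_ext fun x γ => ?_
      rw [innerSL_apply_apply]
      exact (Submodule.mem_orthogonal' _ z).1 hz _ (h γ x)
    simpa using DFunLike.congr_fun this z
  have hξ : ξ ∈ P.topologicalClosure := hP ▸ Submodule.mem_top
  exact closure_minimal subset_rfl hcl hξ

variable [CompleteSpace K]

open Classical in
/-- The part of degree `s` contributes only to the coefficients `(α₀ γ, β₀ γ)` with
`s = |α₀| - |β₀|`. -/
theorem coeffOp_homogeneousPart [∀ i, Fintype (ι i)] (hm : ∀ i, 1 ≤ m i)
    (A : MultiWord ι → MultiWord ι → K →L[ℂ] K) (s : Fin k → ℤ) (r : ℝ) {α₀ β₀ γ δ : MultiWord ι}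
    (h₀ : (α₀, β₀) ∈ pairsJ ι) (hγ : multiLength γ = multiLength δ) :
    coeffOp m (homogeneousPart A s fun i j => (r : ℂ) • leftModel ι m i j) (α₀ * γ) (β₀ * δ) =
      if s = fun i => (multiLength α₀ i : ℤ) - multiLength β₀ i then
        if γ = δ then (wordCoeff m γ : ℂ) • (r : ℂ) ^ (∑ i, multiLength α₀ i +
          ∑ i, multiLength β₀ i) • A α₀ β₀ else 0
      else 0 := by
  have hterm : ∀ α ∈ multiWords ι fun i => (s i).toNat, ∀ β ∈ multiWords ι fun i => (-s i).toNat,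
      coeffHom m (α₀ * γ) (β₀ * δ) (tensorOp (A α β)
        (monomialOp (fun i j => (r : ℂ) • leftModel ι m i j) α *
          star (monomialOp (fun i j => (r : ℂ) • leftModel ι m i j) β))) =
      (r : ℂ) ^ (∑ i, multiLength α i + ∑ i, multiLength β i) •
        if (α₀ = α ∧ β₀ = β) ∧ γ = δ then (wordCoeff m γ : ℂ) • A α β else 0 := by
    intro α hα β hβ
    have hJ : (α, β) ∈ pairsJ ι := ⟨s, fun i => ⟨congrFun (mem_multiWords.1 hα) i,
      congrFun (mem_multiWords.1 hβ) i⟩⟩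
    rw [← coeffOp_tensorOp_monomialOp hm (A α β) hJ h₀ hγ, monomialOp_smul, monomialOp_smul,
      star_smul, smul_mul_smul_comm, tensorOp_eq_tensorMap, tensorMap_smul_right, coeffHom_apply,
      coeffOp_smul, pow_add]
    simp [tensorOp_eq_tensorMap]
  rw [← coeffHom_apply]
  refine (map_sum (coeffHom m _ _) _ _).trans ?_
  simp only [map_sum]
  refine (Finset.sum_congr rfl fun α hα => Finset.sum_congr rfl fun β hβ =>
    hterm α hα β hβ).trans ?_
  have h₁ := mem_pairsJ_iff.1 h₀
  split_ifs with hs hγδ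
  · have hα₀ : α₀ ∈ multiWords ι fun i => (s i).toNat := by
      rw [mem_multiWords, hs]; funext i; have := h₁ i; simp only; omega
    have hβ₀ : β₀ ∈ multiWords ι fun i => (-s i).toNat := by
      rw [mem_multiWords, hs]; funext i; have := h₁ i; simp only; omega
    rw [Finset.sum_eq_single_of_mem α₀ hα₀, Finset.sum_eq_single_of_mem β₀ hβ₀,
      if_pos ⟨⟨rfl, rfl⟩, hγδ⟩, smul_comm]
    · intro β _ hβ
      rw [if_neg fun h => hβ h.1.2.symm, smul_zero]
    · intro α _ hα
      refine Finset.sum_eq_zero fun β _ => ?_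
      rw [if_neg fun h => hα h.1.1.symm, smul_zero]
  · refine Finset.sum_eq_zero fun α _ => Finset.sum_eq_zero fun β _ => ?_
    rw [if_neg fun h => hγδ h.2, smul_zero]
  · refine Finset.sum_eq_zero fun α hα => Finset.sum_eq_zero fun β hβ => ?_
    rw [if_neg, smul_zero]
    rintro ⟨⟨rfl, rfl⟩, -⟩
    refine hs (funext fun i => ?_)
    have h2 := congrFun (mem_multiWords.1 hα) i
    have h3 := congrFun (mem_multiWords.1 hβ) i
    omega

/-- The value at `r W` of a pluriharmonic series with coefficients `A_{α,β}` has the Toeplitz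
coefficients `r^{|α| + |β|} A_{α,β}`. -/
theorem hasToeplitzCoeffs_of_hasSum [∀ i, Fintype (ι i)] (hm : ∀ i, 1 ≤ m i)
    {A : MultiWord ι → MultiWord ι → K →L[ℂ] K} {r : ℝ}
    {S : HilbertTensor K (FockTensor ι) →L[ℂ] HilbertTensor K (FockTensor ι)}
    (hS : HasSum (fun s => homogeneousPart A s fun i j => (r : ℂ) • leftModel ι m i j) S) :
    HasToeplitzCoeffs m (fun α β => (r : ℂ) ^ (∑ i, multiLength α i + ∑ i, multiLength β i) •
      A α β) S := by
  intro α β γ δ hJ hl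
  have h1 := hS.map (coeffHom m (α * γ) (β * δ)) (continuous_coeffHom m _ _)
  refine (h1.unique (hasSum_single (fun i => (multiLength α i : ℤ) - multiLength β i)
    fun s hs => ?_)).trans ?_
  · rw [Function.comp_apply, coeffHom_apply, coeffOp_homogeneousPart hm A s r hJ hl, if_neg hs]
  · rw [Function.comp_apply, coeffHom_apply, coeffOp_homogeneousPart hm A _ r hJ hl, if_pos rfl]

/-- On a vector `x ⊗ e_δ` the squared distance of `S_i` to `T` is, by Parseval's identity, the sum of
`(1 - r_i^n)² ‖t_γ‖²` with exponents `n` depending on `γ`, which tends to zero by dominated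
convergence. The uniform bound extends the convergence to all vectors. -/
theorem tendsto_of_hasToeplitzCoeffs (hm : ∀ i, 1 ≤ m i) {I : Type*} {l : Filter I} {r : I → ℝ}
    (h0 : ∀ i, 0 ≤ r i) (h1 : ∀ i, r i ≤ 1) (hr : Tendsto r l (𝓝 1))
    {A : MultiWord ι → MultiWord ι → K →L[ℂ] K} {C : ℝ}
    {S : I → HilbertTensor K (FockTensor ι) →L[ℂ] HilbertTensor K (FockTensor ι)}
    {T : HilbertTensor K (FockTensor ι) →L[ℂ] HilbertTensor K (FockTensor ι)}
    (hT : HasToeplitzCoeffs m A T) (hS : ∀ i, HasToeplitzCoeffs m (fun α β =>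
      (r i : ℂ) ^ (∑ i, multiLength α i + ∑ i, multiLength β i) • A α β) (S i))
    (hC : ∀ i, ‖S i‖ ≤ C) (ξ : HilbertTensor K (FockTensor ι)) :
    Tendsto (fun i => S i ξ) l (𝓝 (T ξ)) := by
  refine tendsto_apply_of_tendsto_basisEmb hC (fun δ x => ?_) ξ
  have hex : ∀ γ, ∃ n : ℕ, ∀ i, coeffOp m (S i) γ δ = (r i : ℂ) ^ n • coeffOp m T γ δ := by
    intro γ
    obtain ⟨α, β, γ', δ', hJ, hl, rfl, rfl⟩ := exists_eq_mul_mul γ δ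
    refine ⟨∑ i, multiLength α i + ∑ i, multiLength β i, fun i => ?_⟩
    rw [hT α β γ' δ' hJ hl, hS i α β γ' δ' hJ hl]
    split_ifs
    · rw [smul_comm]
    · rw [smul_zero]
  choose n hn using hex
  set t : MultiWord ι → K := fun γ =>
    ContinuousLinearMap.adjoint (basisEmb K γ).toContinuousLinearMap (T (basisEmb K δ x)) with ht
  have hcoeff : ∀ i γ, ContinuousLinearMap.adjoint (basisEmb K γ).toContinuousLinearMap
      (S i (basisEmb K δ x) - T (basisEmb K δ x)) = ((r i ^ n γ - 1 : ℝ) : ℂ) • t γ := by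
    intro i γ
    have h2 := DFunLike.congr_fun (hn γ i) x
    rw [smul_apply, coeffOp_eq_smul, coeffOp_eq_smul, smul_comm] at h2
    have hne : ((√(wordCoeff m γ) * √(wordCoeff m δ) : ℝ) : ℂ) ≠ 0 := by
      have h3 := Real.sqrt_pos.2 (wordCoeff_pos hm γ)
      have h4 := Real.sqrt_pos.2 (wordCoeff_pos hm δ)
      exact_mod_cast (mul_pos h3 h4).ne'
    have h5 := smul_right_injective K hne h2
    rw [map_sub, h5, ht, Complex.ofReal_sub, sub_smul, Complex.ofReal_pow, Complex.ofReal_one,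
      one_smul]
  have hnorm : ∀ i, ‖S i (basisEmb K δ x) - T (basisEmb K δ x)‖ ^ 2 =
      ∑' γ, (r i ^ n γ - 1) ^ 2 * ‖t γ‖ ^ 2 := by
    intro i
    rw [← (hasSum_norm_sq_adjoint_basisEmb _).tsum_eq]
    refine tsum_congr fun γ => ?_
    rw [hcoeff, norm_smul, mul_pow, Complex.norm_real, Real.norm_eq_abs, sq_abs]
  have hlim : Tendsto (fun i => ∑' γ, (r i ^ n γ - 1) ^ 2 * ‖t γ‖ ^ 2) l
      (𝓝 (∑' _ : MultiWord ι, (0 : ℝ))) := by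
    refine tendsto_tsum_of_dominated_convergence
      (hasSum_norm_sq_adjoint_basisEmb (T (basisEmb K δ x))).summable (fun γ => ?_)
      (Eventually.of_forall fun i γ => ?_)
    · have := (((hr.pow (n γ)).sub_const 1).pow 2).mul_const (‖t γ‖ ^ 2)
      simpa using this
    · rw [Real.norm_of_nonneg (by positivity)]
      refine mul_le_of_le_one_left (sq_nonneg _) ?_
      have h2 := pow_nonneg (h0 i) (n γ)
      have h3 := pow_le_one₀ (n := n γ) (h0 i) (h1 i)
      nlinarith
  rw [tsum_zero] at hlim
  rw [tendsto_iff_norm_sub_tendsto_zero]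
  have := hlim.sqrt
  rw [Real.sqrt_zero] at this
  refine this.congr fun i => ?_
  rw [← hnorm, Real.sqrt_sq (norm_nonneg _)]

/-- The coefficients of a radial limit are the limits of the coefficients. -/
theorem hasToeplitzCoeffs_of_tendsto {I : Type*} {l : Filter I} [l.NeBot] {r : I → ℝ}
    (hr : Tendsto r l (𝓝 1)) {A : MultiWord ι → MultiWord ι → K →L[ℂ] K}
    {S : I → HilbertTensor K (FockTensor ι) →L[ℂ] HilbertTensor K (FockTensor ι)}
    {T : HilbertTensor K (FockTensor ι) →L[ℂ] HilbertTensor K (FockTensor ι)}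
    (hS : ∀ i, HasToeplitzCoeffs m (fun α β =>
      (r i : ℂ) ^ (∑ i, multiLength α i + ∑ i, multiLength β i) • A α β) (S i))
    (h : ∀ ξ, Tendsto (fun i => S i ξ) l (𝓝 (T ξ))) : HasToeplitzCoeffs m A T := by
  intro α β γ δ hJ hl
  ext y
  have h1 : Tendsto (fun i => coeffOp m (S i) (α * γ) (β * δ) y) l
      (𝓝 (coeffOp m T (α * γ) (β * δ) y)) :=
    ((ContinuousLinearMap.adjoint (dualEmb m K (α * γ))).continuous.tendsto _).comp
      (h (dualEmb m K (β * δ) y))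
  refine tendsto_nhds_unique h1 ?_
  have h2 : ∀ i, coeffOp m (S i) (α * γ) (β * δ) = _ := fun i => hS i α β γ δ hJ hl
  simp only [h2]
  split_ifs with hγ
  · have h3 : Tendsto (fun i => (r i : ℂ) ^ (∑ i, multiLength α i + ∑ i, multiLength β i)) l
        (𝓝 1) := by
      have := ((Complex.continuous_ofReal.tendsto _).comp hr).pow
        (∑ i, multiLength α i + ∑ i, multiLength β i)
      rwa [Complex.ofReal_one, one_pow] at this
    have h4 := (h3.smul_const (A α β y)).const_smul (wordCoeff m γ : ℂ)
    rw [one_smul] at h4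
    exact h4
  · exact tendsto_const_nhds

end RadialLimits

/-! ### Row operators -/

section RowOperators

variable {J : Type u} [Fintype J] {E : Type v} [NormedAddCommGroup E] [InnerProductSpace ℂ E]

theorem rowOp_apply (X : J → E →L[ℂ] E) (x : PiLp 2 fun _ : J => E) :
    rowOp X x = ∑ j, X j (x j) := by
  simp [rowOp]

theorem diagOp_apply (A : E →L[ℂ] E) (x : PiLp 2 fun _ : J => E) (j : J) :
    diagOp J A x j = A (x j) := rfl

theorem diagOp_mul (A B : E →L[ℂ] E) : diagOp J A * diagOp J B = diagOp J (A * B) := rfl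

theorem diagOp_one : diagOp J (1 : E →L[ℂ] E) = 1 := rfl

theorem ring_inverse_diagOp {A B : E →L[ℂ] E} (hAB : A * B = 1) (hBA : B * A = 1) :
    Ring.inverse (diagOp J A) = diagOp J B :=
  Ring.inverse_unit (⟨diagOp J A, diagOp J B, by rw [diagOp_mul, hAB, diagOp_one],
    by rw [diagOp_mul, hBA, diagOp_one]⟩ : (PiLp 2 (fun _ : J => E) →L[ℂ] _)ˣ)

theorem rowOp_comp_diagOp (X : J → E →L[ℂ] E) (A : E →L[ℂ] E) :
    rowOp X ∘L diagOp J A = rowOp fun j => X j * A := by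
  ext x
  simp only [ContinuousLinearMap.comp_apply, rowOp_apply, diagOp_apply, mul_apply_eq_comp]

variable [CompleteSpace E]

theorem adjoint_rowOp_comp_comp_eq_diagOp_iff [DecidableEq J] (X : J → E →L[ℂ] E)
    (T S : E →L[ℂ] E) :
    ContinuousLinearMap.adjoint (rowOp X) ∘L T ∘L rowOp X = diagOp J S ↔
      ∀ j j', star (X j) * T * X j' = if j = j' then S else 0 := by
  have hinner : ∀ x y : PiLp 2 fun _ : J => E,
      inner ℂ x ((ContinuousLinearMap.adjoint (rowOp X) ∘L T ∘L rowOp X) y) =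
        ∑ j, ∑ j', inner ℂ (x j) ((star (X j) * T * X j') (y j')) := by
    intro x y
    rw [ContinuousLinearMap.comp_apply, ContinuousLinearMap.adjoint_inner_right,
      ContinuousLinearMap.comp_apply, rowOp_apply, rowOp_apply, sum_inner]
    simp only [map_sum, inner_sum, mul_apply_eq_comp, ContinuousLinearMap.star_eq_adjoint,
      ContinuousLinearMap.adjoint_inner_right]
  constructor
  · intro h j j'
    ext y
    refine ext_inner_left ℂ fun x => ?_
    have h1 := hinner (WithLp.toLp 2 (Pi.single j x)) (WithLp.toLp 2 (Pi.single j' y))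
    rw [h, PiLp.inner_apply, Finset.sum_eq_single_of_mem j (Finset.mem_univ _),
      Finset.sum_eq_single_of_mem j (Finset.mem_univ _),
      Finset.sum_eq_single_of_mem j' (Finset.mem_univ _)] at h1
    · simp only [diagOp_apply, Pi.single_eq_same] at h1
      rw [← h1]
      by_cases hj : j = j'
      · subst hj; simp
      · simp [hj]
    · intro l _ hl; simp [hl]
    · intro l _ hl; simp [hl]
    · intro l _ hl; simp [hl]
  · intro h
    ext1 y
    refine ext_inner_left ℂ fun x => ?_
    rw [hinner, PiLp.inner_apply]
    refine Finset.sum_congr rfl fun j _ => ?_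
    rw [Finset.sum_eq_single_of_mem j (Finset.mem_univ _), h, if_pos rfl, diagOp_apply]
    intro l _ hl
    rw [h, if_neg hl.symm, zero_apply, inner_zero_right]

end RowOperators

/-! ### The Cauchy dual of the right universal model -/

section CauchyDual

variable {k : ℕ} {ι : Fin k → Type u} {m : Fin k → ℕ}

theorem ext_dualVec (hm : ∀ i, 1 ≤ m i) {S T : FockTensor ι →L[ℂ] FockTensor ι}
    (h : ∀ γ, S (dualVec m γ) = T (dualVec m γ)) : S = T := by
  ext1 x
  have hx := hasSum_fockBasis x
  refine (S.hasSum hx).unique ?_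
  have e : (fun γ => S (x γ • fockBasis γ)) = fun γ => T (x γ • fockBasis γ) := by
    funext γ
    have h1 := h γ
    rw [dualVec, map_smul, map_smul] at h1
    have hne : ((√(wordCoeff m γ) : ℝ) : ℂ) ≠ 0 := by
      exact_mod_cast (Real.sqrt_pos.2 (wordCoeff_pos hm γ)).ne'
    rw [map_smul, map_smul, smul_right_injective _ hne h1]
  rw [e]
  exact T.hasSum hx

theorem weight_pos {m : ℕ} (hm : 1 ≤ m) (l : ℕ) : 0 < weight m l := by
  have : (0 : ℝ) < m := by exact_mod_cast hm
  exact Real.sqrt_pos.2 (by positivity)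

theorem weight_inv_bound (m l : ℕ) :
    ‖((((weight m l)⁻¹ : ℝ) : ℂ) ^ 2) • ContinuousLinearMap.id ℂ ℂ‖ ≤ m + 1 := by
  rw [norm_smul, ContinuousLinearMap.norm_id, mul_one, norm_pow, Complex.norm_real,
    Real.norm_eq_abs, sq_abs, inv_pow, weight, Real.sq_sqrt (by positivity), inv_div,
    div_le_iff₀ (by positivity)]
  have hm : (0 : ℝ) ≤ m := Nat.cast_nonneg m
  have hl : (0 : ℝ) ≤ l := Nat.cast_nonneg l
  nlinarith [mul_nonneg hm hl]

variable (ι) in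
/-- The inverse `e_α ↦ ((|α_i| + m_i) / (|α_i| + 1)) e_α` of the square of the weight operator. -/
def invWeightSqOp (m : Fin k → ℕ) (i : Fin k) : FockTensor ι →L[ℂ] FockTensor ι :=
  lp.mapCLM 2 (fun α : MultiWord ι =>
    ((((weight (m i) (α i).length)⁻¹ : ℝ) : ℂ) ^ 2) • ContinuousLinearMap.id ℂ ℂ)
    (K := (m i : NNReal) + 1) (by positivity) (fun _ => weight_inv_bound _ _)

theorem invWeightSqOp_apply (m : Fin k → ℕ) (i : Fin k) (f : FockTensor ι) (α : MultiWord ι) :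
    invWeightSqOp ι m i f α = (((weight (m i) (α i).length)⁻¹ : ℝ) : ℂ) ^ 2 * f α := by
  simp [invWeightSqOp]

theorem weightOp_sq_mul_invWeightSqOp (hm : ∀ i, 1 ≤ m i) (i : Fin k) :
    weightOp ι m i ^ 2 * invWeightSqOp ι m i = 1 := by
  ext f α
  have := (weight_pos (hm i) (α i).length).ne'
  rw [sq, mul_apply_eq_comp, mul_apply_eq_comp, weightOp_apply, weightOp_apply,
    invWeightSqOp_apply, one_apply_eq_self]
  push_cast
  have : ((weight (m i) (α i).length : ℝ) : ℂ) ≠ 0 := by exact_mod_cast this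
  field_simp

theorem invWeightSqOp_mul_weightOp_sq (hm : ∀ i, 1 ≤ m i) (i : Fin k) :
    invWeightSqOp ι m i * weightOp ι m i ^ 2 = 1 := by
  ext f α
  have := (weight_pos (hm i) (α i).length).ne'
  rw [sq, mul_apply_eq_comp, mul_apply_eq_comp, invWeightSqOp_apply, weightOp_apply,
    weightOp_apply, one_apply_eq_self]
  push_cast
  have : ((weight (m i) (α i).length : ℝ) : ℂ) ≠ 0 := by exact_mod_cast this
  field_simp

theorem apply_dualVec_of_diagonal {S : FockTensor ι →L[ℂ] FockTensor ι} {g : MultiWord ι → ℂ}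
    (hS : ∀ f α, S f α = g α * f α) (γ : MultiWord ι) :
    S (dualVec m γ) = g γ • dualVec m γ := by
  classical
  ext α
  rw [hS, lp.coeFn_smul, Pi.smul_apply, smul_eq_mul]
  by_cases h : α = γ
  · rw [h]
  · have : (dualVec m γ : FockTensor ι) α = 0 := by
      rw [← inner_fockBasis_left, dualVec, inner_smul_right, inner_fockBasis, if_neg h, mul_zero]
    rw [this, mul_zero, mul_zero]

theorem rightModel_dualVec (hm : ∀ i, 1 ≤ m i) (i : Fin k) (j : ι i) (γ : MultiWord ι) :
    rightModel ι m i j (dualVec m γ) =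
      ((weight (m i) (γ i).length : ℝ) : ℂ) ^ 2 •
        dualVec m (γ * Pi.mulSingle i (FreeMonoid.of j)) := by
  rw [dualVec, map_smul, rightModel_fockBasis, appendLetter_eq, dualVec, smul_smul, smul_smul]
  congr 1
  have h := weight_mul_inv_sqrt hm (multiLength γ) i
  have h0 : √(multiCoeff m (multiLength γ)) ≠ 0 := (Real.sqrt_pos.2 (multiCoeff_pos hm _)).ne'
  have h1 : √(multiCoeff m (multiLength γ + Pi.single i 1)) ≠ 0 :=
    (Real.sqrt_pos.2 (multiCoeff_pos hm _)).ne'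
  rw [wordCoeff, wordCoeff, multiLength_mul, multiLength_mulSingle, FreeMonoid.length_of]
  rw [show multiLength γ i = (γ i).length from rfl] at h
  have h2 : √(multiCoeff m (multiLength γ)) * weight (m i) (γ i).length =
      weight (m i) (γ i).length ^ 2 * √(multiCoeff m (multiLength γ + Pi.single i 1)) := by
    field_simp at h
    rw [mul_comm, ← h]
    ring
  exact_mod_cast h2

theorem mul_mulSingle_of_inj {i : Fin k} {j j' : ι i} {γ δ : MultiWord ι}
    (h : γ * Pi.mulSingle i (FreeMonoid.of j) = δ * Pi.mulSingle i (FreeMonoid.of j')) :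
    γ = δ ∧ j = j' := by
  have hl := congrArg multiLength h
  rw [multiLength_mul, multiLength_mul, multiLength_mulSingle, multiLength_mulSingle,
    FreeMonoid.length_of, FreeMonoid.length_of] at hl
  obtain ⟨h1, h2⟩ := mul_inj_of_multiLength_eq h (add_right_cancel hl)
  exact ⟨h1, FreeMonoid.of_injective (Pi.mulSingle_injective i h2)⟩

theorem star_rightModel_dualVec (hm : ∀ i, 1 ≤ m i) (i : Fin k) (j : ι i) (γ : MultiWord ι) :
    star (rightModel ι m i j) (dualVec m (γ * Pi.mulSingle i (FreeMonoid.of j))) =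
      dualVec m γ := by
  have hinj : Function.Injective fun γ : MultiWord ι => γ * Pi.mulSingle i (FreeMonoid.of j) :=
    fun γ δ h => (mul_mulSingle_of_inj h).1
  exact star_apply_dualVec_of_eq hm hinj (rightModel_primalVec hm i j) γ

theorem star_rightModel_dualVec_of_ne (hm : ∀ i, 1 ≤ m i) {i : Fin k} {j j' : ι i} (h : j ≠ j')
    (γ : MultiWord ι) :
    star (rightModel ι m i j) (dualVec m (γ * Pi.mulSingle i (FreeMonoid.of j'))) = 0 :=
  star_apply_dualVec_of_ne hm (rightModel_primalVec hm i j)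
    fun _ hδ => h (mul_mulSingle_of_inj hδ).2

theorem star_rightModel_dualVec_of_eq_one (hm : ∀ i, 1 ≤ m i) {i : Fin k} (j : ι i)
    {γ : MultiWord ι} (h : γ i = 1) : star (rightModel ι m i j) (dualVec m γ) = 0 :=
  star_apply_dualVec_of_ne hm (rightModel_primalVec hm i j) fun δ hδ => by
    have := congrArg FreeMonoid.length (congrFun hδ i)
    simp [h] at this

open Classical in
theorem star_rightModel_mul_rightModel (hm : ∀ i, 1 ≤ m i) {i : Fin k} (j j' : ι i) :
    star (rightModel ι m i j) * rightModel ι m i j' =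
      if j = j' then weightOp ι m i ^ 2 else 0 := by
  refine ext_dualVec hm fun γ => ?_
  rw [mul_apply_eq_comp, rightModel_dualVec hm, map_smul]
  split_ifs with h
  · subst h
    rw [star_rightModel_dualVec hm, apply_dualVec_of_diagonal fun f α => ?_]
    rw [sq, mul_apply_eq_comp, weightOp_apply, weightOp_apply, ← mul_assoc, ← sq]
  · rw [star_rightModel_dualVec_of_ne hm h, smul_zero, zero_apply]

variable (ι m) in
/-- The entry `Λ_{i,j}'` of the Cauchy dual of the row `[Λ_{i,1} ⋯ Λ_{i,n_i}]`. It acts on the dual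
basis as the plain shift `f'_γ ↦ f'_{γ g_j}`. -/
def dualRightModel (i : Fin k) (j : ι i) : FockTensor ι →L[ℂ] FockTensor ι :=
  rightModel ι m i j * invWeightSqOp ι m i

theorem dualRightModel_dualVec (hm : ∀ i, 1 ≤ m i) (i : Fin k) (j : ι i) (γ : MultiWord ι) :
    dualRightModel ι m i j (dualVec m γ) = dualVec m (γ * Pi.mulSingle i (FreeMonoid.of j)) := by
  have h : ((weight (m i) (γ i).length : ℝ) : ℂ) ≠ 0 := by
    exact_mod_cast (weight_pos (hm i) (γ i).length).ne'
  rw [dualRightModel, mul_apply_eq_comp, apply_dualVec_of_diagonal (invWeightSqOp_apply m i),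
    map_smul, rightModel_dualVec hm, smul_smul, Complex.ofReal_inv, ← mul_pow, inv_mul_cancel₀ h,
    one_pow, one_smul]

variable (m) {K : Type v} [NormedAddCommGroup K] [InnerProductSpace ℂ K] [CompleteSpace K]
  [∀ i, Fintype (ι i)]

/-- Since `Λ_{i,j}^* Λ_{i,j'} = δ_{j,j'} D_i²` with the weight operator `D_i`, the inverse in the Cauchy
dual is the direct sum of the copies of `D_i^{-2}`. -/
theorem cauchyDual_eq_rowOp (hm : ∀ i, 1 ≤ m i) (i : Fin k) :
    cauchyDual ι m K i = rowOp fun j => tensorOp (1 : K →L[ℂ] K) (dualRightModel ι m i j) := by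
  classical
  have hG : ContinuousLinearMap.adjoint (rowOp (ampRightModel ι m K i)) ∘L
      rowOp (ampRightModel ι m K i) = diagOp (ι i) (tensorOp 1 (weightOp ι m i ^ 2)) := by
    refine (adjoint_rowOp_comp_comp_eq_diagOp_iff _ 1 _).2 fun j j' => ?_
    rw [mul_one, ampRightModel, ampRightModel, star_tensorOp, star_one, ← tensorOp_one_mul,
      star_rightModel_mul_rightModel hm]
    split_ifs
    · rfl
    · rw [tensorOp_eq_tensorMap, tensorMap_zero_right]
  have h1 : tensorOp (1 : K →L[ℂ] K) (1 : FockTensor ι →L[ℂ] FockTensor ι) = 1 := by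
    rw [tensorOp_eq_tensorMap, tensorMap_one_one]
  rw [cauchyDual, hG, ring_inverse_diagOp (B := tensorOp 1 (invWeightSqOp ι m i)),
    rowOp_comp_diagOp]
  · simp only [ampRightModel, dualRightModel, tensorOp_one_mul]
  · rw [← tensorOp_one_mul, weightOp_sq_mul_invWeightSqOp hm, h1]
  · rw [← tensorOp_one_mul, invWeightSqOp_mul_weightOp_sq hm, h1]

end CauchyDual

/-! ### The recursion for the coefficients of `(1 - x)^{-m}` -/

section Combinatorics

open PowerSeries in
theorem mk_multichoose_mul_one_sub_X_pow (m : ℕ) :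
    (PowerSeries.mk fun n => (m.multichoose n : ℂ)) * (1 - PowerSeries.X) ^ m = 1 := by
  induction m with
  | zero =>
    ext n
    rcases n with _ | n <;> simp [Nat.multichoose_zero_right, Nat.multichoose_zero_succ, coeff_one]
  | succ m ih =>
    have h : (PowerSeries.mk fun n => ((m + 1).multichoose n : ℂ)) * (1 - PowerSeries.X) =
        PowerSeries.mk fun n => (m.multichoose n : ℂ) := by
      ext n
      rcases n with _ | n
      · simp [Nat.multichoose_zero_right]
      · rw [mul_sub, mul_one, map_sub, coeff_succ_mul_X, coeff_mk, coeff_mk, coeff_mk,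
          Nat.multichoose_succ_succ]
        push_cast
        ring
    rw [pow_succ', ← mul_assoc, h, ih]

open PowerSeries in
theorem coeff_one_sub_X_pow (m n : ℕ) :
    coeff n ((1 - PowerSeries.X : PowerSeries ℂ) ^ m) = (-1) ^ n * (m.choose n : ℂ) := by
  induction m generalizing n with
  | zero => rcases n with _ | n <;> simp [coeff_one]
  | succ m ih =>
    rw [pow_succ, mul_sub, mul_one, map_sub]
    rcases n with _ | n
    · simp
    · rw [coeff_succ_mul_X, ih, ih, Nat.choose_succ_succ]
      push_cast
      ring

/-- The coefficients `b_n` of `(1 - x)^{-m}` satisfy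
`b_{n+1} = ∑_{l < m} (-1)^l C(m, l+1) b_{n-l}`. -/
theorem sum_choose_mul_multichoose (m n : ℕ) :
    ∑ l ∈ Finset.range m, (-1 : ℂ) ^ l * (m.choose (l + 1) : ℂ) *
      (if l ≤ n then (m.multichoose (n - l) : ℂ) else 0) = m.multichoose (n + 1) := by
  have h := congrArg (PowerSeries.coeff (n + 1)) (mk_multichoose_mul_one_sub_X_pow m)
  rw [mul_comm, PowerSeries.coeff_mul, Finset.Nat.sum_antidiagonal_eq_sum_range_succ_mk,
    Finset.sum_range_succ', PowerSeries.coeff_one, if_neg n.succ_ne_zero] at h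
  simp only [coeff_one_sub_X_pow, PowerSeries.coeff_mk] at h
  set f : ℕ → ℂ := fun l => (-1 : ℂ) ^ l * (m.choose (l + 1) : ℂ) *
    (if l ≤ n then (m.multichoose (n - l) : ℂ) else 0) with hf
  have h1 : ∑ l ∈ Finset.range m, f l = ∑ l ∈ Finset.range (n + 1), f l := by
    refine (Finset.sum_subset (Finset.range_subset_range.2 (le_max_left m (n + 1)))
      fun l _ hl => ?_).trans (Finset.sum_subset
      (Finset.range_subset_range.2 (le_max_right m (n + 1))) fun l _ hl => ?_).symm
    · have hl : m < l + 1 := by simpa [Nat.lt_succ_iff] using hl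
      simp [hf, Nat.choose_eq_zero_of_lt hl]
    · have hl : ¬ l ≤ n := by simpa [Nat.lt_succ_iff] using hl
      simp [hf, hl]
  have h2 : ∑ l ∈ Finset.range (n + 1), f l = -∑ l ∈ Finset.range (n + 1),
      (-1 : ℂ) ^ (l + 1) * (m.choose (l + 1) : ℂ) * (m.multichoose (n + 1 - (l + 1)) : ℂ) := by
    rw [← Finset.sum_neg_distrib]
    refine Finset.sum_congr rfl fun l hl => ?_
    have hl : l ≤ n := Nat.lt_succ_iff.1 (Finset.mem_range.1 hl)
    rw [hf, Nat.add_sub_add_right]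
    simp only [if_pos hl]
    ring
  rw [h1, h2]
  simp only [pow_zero, Nat.choose_zero_right, Nat.cast_one, one_mul, Nat.sub_zero] at h
  linear_combination -h

end Combinatorics

/-! ### The Brown–Halmos condition in terms of coefficients -/

theorem mul_of_eq_mul_of_iff {J : Type*} {a b : FreeMonoid J} {j j' : J}
    (hab : a.length = b.length) :
    a * FreeMonoid.of j = b * FreeMonoid.of j' ↔ j = j' ∧ a = b := by
  constructor
  · intro h
    obtain ⟨h1, h2⟩ := List.append_inj h hab
    exact ⟨FreeMonoid.of_injective h2, h1⟩
  · rintro ⟨rfl, rfl⟩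
    rfl

section Recursion

variable {k : ℕ} {ι : Fin k → Type u} {m : Fin k → ℕ}
  {K : Type v} [NormedAddCommGroup K] [InnerProductSpace ℂ K] [CompleteSpace K]

theorem wordCoeff_mul_mulSingle (m : Fin k → ℕ) {i : Fin k} {γ : MultiWord ι} (h : γ i = 1)
    (a : FreeMonoid (ι i)) :
    wordCoeff m (γ * Pi.mulSingle i a) = (m i).multichoose a.length * wordCoeff m γ := by
  have h1 := multiCoeff_add_single m (multiLength γ) i a.length
  have h2 : multiLength γ i = 0 := by simp [multiLength, h]
  rw [h2, Nat.multichoose_zero_right, Nat.cast_one, mul_one, zero_add] at h1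
  rw [wordCoeff, multiLength_mul, multiLength_mulSingle, h1, mul_comm, wordCoeff]

theorem mul_mulSingle_inj {i : Fin k} {γ δ : MultiWord ι} {a b : FreeMonoid (ι i)}
    (hl : multiLength γ = multiLength δ) :
    γ * Pi.mulSingle i a = δ * Pi.mulSingle i b ↔ a = b ∧ γ = δ := by
  constructor
  · intro h
    obtain ⟨h1, h2⟩ := mul_inj_of_multiLength_eq h hl
    exact ⟨Pi.mulSingle_injective i h2, h1⟩
  · rintro ⟨rfl, rfl⟩
    rfl

theorem exists_eq_mul_mulSingle (i : Fin k) (γ : MultiWord ι) {p q : ℕ}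
    (h : (γ i).length = p + q) : ∃ (α : MultiWord ι) (a : FreeMonoid (ι i)), (α i).length = p ∧
      a.length = q ∧ α * Pi.mulSingle i a = γ := by
  obtain ⟨x, a, hx, ha, hxa⟩ := exists_mul_of_length_eq_add p q (γ i) h
  refine ⟨Function.update γ i x, a, by simpa using hx, ha, ?_⟩
  funext l
  by_cases hl : l = i
  · subst hl; simpa using hxa
  · simp [hl]

theorem coeffOp_star_mul_mul
    {X Y T : HilbertTensor K (FockTensor ι) →L[ℂ] HilbertTensor K (FockTensor ι)}
    {γ δ γ' δ' : MultiWord ι}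
    (hX : ∀ x : K, X (pureTensor x (dualVec m γ)) = pureTensor x (dualVec m γ'))
    (hY : ∀ x : K, Y (pureTensor x (dualVec m δ)) = pureTensor x (dualVec m δ')) :
    coeffOp m (star X * T * Y) γ δ = coeffOp m T γ' δ' := by
  ext y
  refine ext_inner_left ℂ fun x => ?_
  rw [inner_coeffOp, inner_coeffOp, mul_apply_eq_comp, mul_apply_eq_comp,
    ContinuousLinearMap.star_eq_adjoint, ContinuousLinearMap.adjoint_inner_right, hX, hY]

theorem coeffOp_star_mul_mul_eq_zero
    {X Y T : HilbertTensor K (FockTensor ι) →L[ℂ] HilbertTensor K (FockTensor ι)}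
    {γ δ : MultiWord ι} (h : (∀ x : K, X (pureTensor x (dualVec m γ)) = 0) ∨
      ∀ x : K, Y (pureTensor x (dualVec m δ)) = 0) :
    coeffOp m (star X * T * Y) γ δ = 0 := by
  ext y
  refine ext_inner_left ℂ fun x => ?_
  rw [inner_coeffOp, mul_apply_eq_comp, mul_apply_eq_comp,
    ContinuousLinearMap.star_eq_adjoint, ContinuousLinearMap.adjoint_inner_right]
  rcases h with h | h <;> simp [h]

theorem star_ampRightModel_pureTensor (i : Fin k) (j : ι i) (x : K) (f : FockTensor ι) :
    star (ampRightModel ι m K i j) (pureTensor x f) =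
      pureTensor x (star (rightModel ι m i j) f) := by
  rw [ampRightModel, star_tensorOp, tensorOp_pureTensor, star_one, one_apply_eq_self]

variable (m) in
open Classical in
/-- The Toeplitz relations between the coefficients of `T` in the single coordinate `i`. -/
def IsToeplitzAt (i : Fin k)
    (T : HilbertTensor K (FockTensor ι) →L[ℂ] HilbertTensor K (FockTensor ι)) : Prop :=
  ∀ (α β : MultiWord ι) (a b : FreeMonoid (ι i)), (α i = 1 ∨ β i = 1) → a.length = b.length →
    coeffOp m T (α * Pi.mulSingle i a) (β * Pi.mulSingle i b) =
      if a = b then ((m i).multichoose a.length : ℂ) • coeffOp m T α β else 0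

theorem forall_isToeplitzAt_iff
    (T : HilbertTensor K (FockTensor ι) →L[ℂ] HilbertTensor K (FockTensor ι)) :
    (∀ i, IsToeplitzAt m i T) ↔ HasToeplitzCoeffs m (coeffOp m T) T := by
  classical
  constructor
  · intro h α β γ δ hJ hl
    -- the coordinates are treated one after the other
    have key : ∀ (s : Finset (Fin k)) (γ δ : MultiWord ι), (∀ i ∉ s, γ i = 1 ∧ δ i = 1) →
        multiLength γ = multiLength δ → coeffOp m T (α * γ) (β * δ) =
          if γ = δ then (wordCoeff m γ : ℂ) • coeffOp m T α β else 0 := by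
      intro s
      induction s using Finset.induction_on with
      | empty =>
        intro γ δ hγδ _
        obtain rfl : γ = 1 := funext fun i => (hγδ i (by simp)).1
        obtain rfl : δ = 1 := funext fun i => (hγδ i (by simp)).2
        simp
      | insert i s hi ih =>
        intro γ δ hγδ hl
        obtain ⟨γ, a, hγ, ha, rfl⟩ := exists_eq_mul_mulSingle i γ (zero_add _).symm
        obtain ⟨δ, b, hδ, hb, rfl⟩ := exists_eq_mul_mulSingle i δ (zero_add _).symm
        rw [FreeMonoid.length_eq_zero] at hγ hδ
        have hne : ∀ l, l ≠ i → ∀ (γ : MultiWord ι) (a : FreeMonoid (ι i)),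
            (γ * (Pi.mulSingle i a : MultiWord ι)) l = γ l := fun l hl γ a => by simp [hl]
        have h₁ : (α * γ) i = 1 ∨ (β * δ) i = 1 := by
          rw [Pi.mul_apply, Pi.mul_apply, hγ, hδ, mul_one, mul_one, ← FreeMonoid.length_eq_zero,
            ← FreeMonoid.length_eq_zero]
          exact mem_pairsJ_iff.1 hJ i
        have hl' : multiLength γ = multiLength δ := by
          funext l
          by_cases hli : l = i
          · subst hli
            simp [multiLength, hγ, hδ]
          · have := congrFun hl l
            simpa only [multiLength, hne l hli] using this
        have hab : a.length = b.length := by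
          simpa [multiLength, hγ, hδ] using congrFun hl i
        rw [← mul_assoc, ← mul_assoc, h i _ _ a b h₁ hab, ih γ δ (fun l hls => ?_) hl',
          wordCoeff_mul_mulSingle m hγ]
        · simp only [mul_mulSingle_inj hl', ite_and]
          split_ifs
          · rw [smul_smul]
            push_cast
            rfl
          · rw [smul_zero]
          · rfl
        · by_cases hli : l = i
          · subst hli
            exact ⟨hγ, hδ⟩
          · have := hγδ l (by simp [hli, hls])
            rwa [hne l hli, hne l hli] at this
    exact key Finset.univ γ δ (by simp) hl
  · intro h i α β a b h₁ hab
    obtain ⟨α, β, γ, δ, hJ, hl, rfl, rfl⟩ := exists_eq_mul_mul α β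
    have hli : (γ i).length = (δ i).length := congrFun hl i
    have hγ : γ i = 1 ∧ δ i = 1 := by
      rw [← FreeMonoid.length_eq_zero, ← FreeMonoid.length_eq_zero, ← hli, and_self,
        FreeMonoid.length_eq_zero]
      rcases h₁ with h₁ | h₁
      · have := congrArg FreeMonoid.length h₁
        rw [Pi.mul_apply, FreeMonoid.length_mul, FreeMonoid.length_one] at this
        exact FreeMonoid.length_eq_zero.1 (by omega)
      · have := congrArg FreeMonoid.length h₁
        rw [Pi.mul_apply, FreeMonoid.length_mul, FreeMonoid.length_one] at this
        exact FreeMonoid.length_eq_zero.1 (by omega)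
    rw [mul_assoc, mul_assoc, h α β _ _ hJ (by
      rw [multiLength_mul, multiLength_mul, hl, multiLength_mulSingle, multiLength_mulSingle, hab]),
      h α β γ δ hJ hl, wordCoeff_mul_mulSingle m hγ.1]
    simp only [mul_mulSingle_inj hl, ite_and]
    split_ifs
    · rw [smul_smul]
      push_cast
      rfl
    · rw [smul_zero]
    · rfl

variable [∀ i, Fintype (ι i)]

theorem coeffOp_PhiMap_eq_sum (i : Fin k)
    (T : HilbertTensor K (FockTensor ι) →L[ℂ] HilbertTensor K (FockTensor ι)) (γ δ : MultiWord ι) :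
    coeffOp m (PhiMap (ampRightModel ι m K i) T) γ δ = ∑ j, coeffOp m
      (star (star (ampRightModel ι m K i j)) * T * star (ampRightModel ι m K i j)) γ δ := by
  rw [PhiMap_apply, ← coeffHom_apply, map_sum]
  exact Finset.sum_congr rfl fun j _ => congrArg (fun R => coeffOp m
    (R * T * star (ampRightModel ι m K i j)) γ δ) (star_star (ampRightModel ι m K i j)).symm

open Classical in
/-- The operators `Λ_{i,j}^*` remove a last letter `g_j` in the coordinate `i`, so `Φ(T)` has at
`(γ g_j, δ g_j)` the coefficient of `T` at `(γ, δ)`. -/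
theorem coeffOp_PhiMap_mul_of (hm : ∀ i, 1 ≤ m i) (i : Fin k) (j j' : ι i)
    (T : HilbertTensor K (FockTensor ι) →L[ℂ] HilbertTensor K (FockTensor ι)) (γ δ : MultiWord ι) :
    coeffOp m (PhiMap (ampRightModel ι m K i) T) (γ * Pi.mulSingle i (FreeMonoid.of j))
      (δ * Pi.mulSingle i (FreeMonoid.of j')) = if j = j' then coeffOp m T γ δ else 0 := by
  rw [coeffOp_PhiMap_eq_sum, Finset.sum_eq_single_of_mem j (Finset.mem_univ _)]
  · split_ifs with h
    · subst h
      exact coeffOp_star_mul_mul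
        (fun x => by rw [star_ampRightModel_pureTensor, star_rightModel_dualVec hm])
        (fun x => by rw [star_ampRightModel_pureTensor, star_rightModel_dualVec hm])
    · exact coeffOp_star_mul_mul_eq_zero (.inr fun x => by
        rw [star_ampRightModel_pureTensor, star_rightModel_dualVec_of_ne hm h, ← pureTensorL_apply,
          map_zero])
  · intro l _ hl
    exact coeffOp_star_mul_mul_eq_zero (.inl fun x => by
      rw [star_ampRightModel_pureTensor, star_rightModel_dualVec_of_ne hm hl, ← pureTensorL_apply,
        map_zero])

theorem coeffOp_PhiMap_of_eq_one (hm : ∀ i, 1 ≤ m i) (i : Fin k)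
    (T : HilbertTensor K (FockTensor ι) →L[ℂ] HilbertTensor K (FockTensor ι)) {γ δ : MultiWord ι}
    (h : γ i = 1 ∨ δ i = 1) : coeffOp m (PhiMap (ampRightModel ι m K i) T) γ δ = 0 := by
  rw [coeffOp_PhiMap_eq_sum]
  refine Finset.sum_eq_zero fun j _ => coeffOp_star_mul_mul_eq_zero (h.imp ?_ ?_) <;>
  · intro h x
    rw [star_ampRightModel_pureTensor, star_rightModel_dualVec_of_eq_one hm j h,
      ← pureTensorL_apply, map_zero]

variable (m) in
/-- The operator `∑_{l < m_i} (-1)^l C(m_i, l+1) Φ^l(T)` on the right of the Brown–Halmos condition,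
where `Φ(T) = ∑_j Λ_{i,j} T Λ_{i,j}^*`. -/
def brownHalmosSum (i : Fin k)
    (T : HilbertTensor K (FockTensor ι) →L[ℂ] HilbertTensor K (FockTensor ι)) :
    HilbertTensor K (FockTensor ι) →L[ℂ] HilbertTensor K (FockTensor ι) :=
  ∑ l ∈ Finset.range (m i), ((-1 : ℂ) ^ l * ((m i).choose (l + 1) : ℂ)) •
    (PhiMap (ampRightModel ι m K i) ^ l) T

theorem coeffOp_brownHalmosSum (i : Fin k)
    (T : HilbertTensor K (FockTensor ι) →L[ℂ] HilbertTensor K (FockTensor ι)) (γ δ : MultiWord ι) :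
    coeffOp m (brownHalmosSum m i T) γ δ =
      ∑ l ∈ Finset.range (m i), ((-1 : ℂ) ^ l * ((m i).choose (l + 1) : ℂ)) •
        coeffOp m ((PhiMap (ampRightModel ι m K i) ^ l) T) γ δ := by
  rw [brownHalmosSum, ← coeffHom_apply, map_sum]
  simp only [coeffHom_apply, coeffOp_smul]

open Classical in
/-- The Brown–Halmos condition, read off the dual basis. -/
theorem brownHalmos_iff (hm : ∀ i, 1 ≤ m i)
    (T : HilbertTensor K (FockTensor ι) →L[ℂ] HilbertTensor K (FockTensor ι)) :
    BrownHalmos m T ↔ ∀ (i : Fin k) (j j' : ι i) (γ δ : MultiWord ι),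
      coeffOp m T (γ * Pi.mulSingle i (FreeMonoid.of j)) (δ * Pi.mulSingle i (FreeMonoid.of j')) =
        if j = j' then coeffOp m (brownHalmosSum m i T) γ δ else 0 := by
  refine forall_congr' fun i => ?_
  have hsum : (∑ j ∈ Finset.range (m i), ((-1 : ℂ) ^ j * ((m i).choose (j + 1) : ℂ)) •
      ∑ β ∈ wordsOfLength (ι i) j, FreeMonoid.lift (ampRightModel ι m K i) β * T *
        star (FreeMonoid.lift (ampRightModel ι m K i) β)) = brownHalmosSum m i T := by
    simp only [brownHalmosSum, PhiMap_pow_apply]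
  rw [hsum, cauchyDual_eq_rowOp m hm, adjoint_rowOp_comp_comp_eq_diagOp_iff]
  refine forall_congr' fun j => forall_congr' fun j' => ?_
  have hY : ∀ (j : ι i) (γ : MultiWord ι) (x : K),
      tensorOp (1 : K →L[ℂ] K) (dualRightModel ι m i j) (pureTensor x (dualVec m γ)) =
        pureTensor x (dualVec m (γ * Pi.mulSingle i (FreeMonoid.of j))) := fun j γ x => by
    rw [tensorOp_pureTensor, dualRightModel_dualVec hm, one_apply_eq_self]
  have hc : ∀ γ δ, coeffOp m (star (tensorOp (1 : K →L[ℂ] K) (dualRightModel ι m i j)) * T *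
      tensorOp (1 : K →L[ℂ] K) (dualRightModel ι m i j')) γ δ =
      coeffOp m T (γ * Pi.mulSingle i (FreeMonoid.of j))
        (δ * Pi.mulSingle i (FreeMonoid.of j')) := fun γ δ =>
    coeffOp_star_mul_mul (hY j γ) (hY j' δ)
  have h0 : ∀ γ δ, coeffOp m (if j = j' then brownHalmosSum m i T else 0) γ δ =
      if j = j' then coeffOp m (brownHalmosSum m i T) γ δ else 0 := fun γ δ => by
    split_ifs
    · rfl
    · exact map_zero (coeffHom m γ δ)
  constructor
  · intro h γ δ
    rw [← hc, h, h0]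
  · intro h
    exact ext_coeffOp hm fun γ δ => by rw [hc, h, h0]

open Classical in
/-- Under the Toeplitz relations for suffixes of length at most `n` in the coordinate `i`, the
coefficients of `Φ^l(T)` satisfy the relations shifted by `l`. -/
theorem coeffOp_PhiMap_pow (hm : ∀ i, 1 ≤ m i) {i : Fin k}
    {T : HilbertTensor K (FockTensor ι) →L[ℂ] HilbertTensor K (FockTensor ι)} {α β : MultiWord ι}
    (h₁ : α i = 1 ∨ β i = 1) {n : ℕ}
    (hT : ∀ a b : FreeMonoid (ι i), a.length = b.length → a.length ≤ n →
      coeffOp m T (α * Pi.mulSingle i a) (β * Pi.mulSingle i b) =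
        if a = b then ((m i).multichoose a.length : ℂ) • coeffOp m T α β else 0)
    (l : ℕ) (a b : FreeMonoid (ι i)) (hab : a.length = b.length) (ha : a.length ≤ n) :
    coeffOp m ((PhiMap (ampRightModel ι m K i) ^ l) T) (α * Pi.mulSingle i a)
      (β * Pi.mulSingle i b) = if a = b then
        (if l ≤ a.length then ((m i).multichoose (a.length - l) : ℂ) else 0) • coeffOp m T α β
        else 0 := by
  induction l generalizing a b with
  | zero => simpa using hT a b hab ha
  | succ l ih =>
    rw [pow_succ', Module.End.mul_apply]
    rcases hlen : a.length with _ | p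
    · obtain rfl : a = 1 := FreeMonoid.length_eq_zero.1 hlen
      obtain rfl : b = 1 := FreeMonoid.length_eq_zero.1 (hab.symm.trans hlen)
      rw [coeffOp_PhiMap_of_eq_one hm i _ (by simpa using h₁)]
      simp
    · obtain ⟨a, x, ha1, hx, rfl⟩ := exists_mul_of_length_eq_add p 1 a hlen
      obtain ⟨b, y, hb1, hy, rfl⟩ := exists_mul_of_length_eq_add p 1 b (hab.symm.trans hlen)
      obtain ⟨j, rfl⟩ := FreeMonoid.length_eq_one.1 hx
      obtain ⟨j', rfl⟩ := FreeMonoid.length_eq_one.1 hy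
      rw [Pi.mulSingle_mul, Pi.mulSingle_mul, ← mul_assoc, ← mul_assoc, coeffOp_PhiMap_mul_of hm,
        ih a b (ha1.trans hb1.symm) (by omega), ha1]
      simp only [mul_of_eq_mul_of_iff (ha1.trans hb1.symm), Nat.add_le_add_iff_right, Nat.add_sub_add_right, ite_and]

open Classical in
theorem coeffOp_brownHalmosSum_of_forall_le (hm : ∀ i, 1 ≤ m i) {i : Fin k}
    {T : HilbertTensor K (FockTensor ι) →L[ℂ] HilbertTensor K (FockTensor ι)} {α β : MultiWord ι}
    (h₁ : α i = 1 ∨ β i = 1) {n : ℕ}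
    (hT : ∀ a b : FreeMonoid (ι i), a.length = b.length → a.length ≤ n →
      coeffOp m T (α * Pi.mulSingle i a) (β * Pi.mulSingle i b) =
        if a = b then ((m i).multichoose a.length : ℂ) • coeffOp m T α β else 0)
    (a b : FreeMonoid (ι i)) (hab : a.length = b.length) (ha : a.length = n) :
    coeffOp m (brownHalmosSum m i T) (α * Pi.mulSingle i a) (β * Pi.mulSingle i b) =
      if a = b then ((m i).multichoose (n + 1) : ℂ) • coeffOp m T α β else 0 := by
  rw [coeffOp_brownHalmosSum]
  simp only [coeffOp_PhiMap_pow hm h₁ hT _ a b hab ha.le]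
  split_ifs with h
  · simp only [ha, smul_smul, ← Finset.sum_smul]
    rw [sum_choose_mul_multichoose]
  · simp

/-- The Brown–Halmos condition determines the coefficients with suffixes of length `n + 1` from
those with shorter suffixes, by the recursion that the coefficients of `(1 - x)^{-m_i}` satisfy. -/
theorem brownHalmos_iff_isToeplitzAt (hm : ∀ i, 1 ≤ m i)
    (T : HilbertTensor K (FockTensor ι) →L[ℂ] HilbertTensor K (FockTensor ι)) :
    BrownHalmos m T ↔ ∀ i, IsToeplitzAt m i T := by
  classical
  rw [brownHalmos_iff hm]
  refine forall_congr' fun i => ⟨fun h => ?_, fun h => ?_⟩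
  · intro α β a b h₁ hab
    have key : ∀ n (a b : FreeMonoid (ι i)), a.length = b.length → a.length ≤ n →
        coeffOp m T (α * Pi.mulSingle i a) (β * Pi.mulSingle i b) =
          if a = b then ((m i).multichoose a.length : ℂ) • coeffOp m T α β else 0 := by
      intro n
      induction n with
      | zero =>
        intro a b hab ha
        obtain rfl : a = 1 := FreeMonoid.length_eq_zero.1 (by omega)
        obtain rfl : b = 1 := FreeMonoid.length_eq_zero.1 (by omega)
        simp
      | succ n ih =>
        intro a b hab ha
        rcases ha.lt_or_eq with ha | ha
        · exact ih a b hab (by omega)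
        obtain ⟨a, x, ha1, hx, rfl⟩ := exists_mul_of_length_eq_add n 1 a ha
        obtain ⟨b, y, hb1, hy, rfl⟩ := exists_mul_of_length_eq_add n 1 b (hab.symm.trans ha)
        obtain ⟨j, rfl⟩ := FreeMonoid.length_eq_one.1 hx
        obtain ⟨j', rfl⟩ := FreeMonoid.length_eq_one.1 hy
        rw [Pi.mulSingle_mul, Pi.mulSingle_mul, ← mul_assoc, ← mul_assoc, h,
          coeffOp_brownHalmosSum_of_forall_le hm h₁ ih a b (ha1.trans hb1.symm) ha1, ha]
        simp only [mul_of_eq_mul_of_iff (ha1.trans hb1.symm), ite_and]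
    exact key _ a b hab le_rfl
  · intro j j' γ δ
    obtain ⟨p, q, n, hp, hq, hpq⟩ : ∃ p q n, (γ i).length = p + n ∧ (δ i).length = q + n ∧
        (p = 0 ∨ q = 0) :=
      ⟨(γ i).length - (δ i).length, (δ i).length - (γ i).length, min (γ i).length (δ i).length,
        by omega, by omega, by omega⟩
    obtain ⟨α, a, hα, ha, rfl⟩ := exists_eq_mul_mulSingle i γ hp
    obtain ⟨β, b, hβ, hb, rfl⟩ := exists_eq_mul_mulSingle i δ hq
    have h₁ : α i = 1 ∨ β i = 1 := by
      rw [← FreeMonoid.length_eq_zero, ← FreeMonoid.length_eq_zero, hα, hβ]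
      exact hpq
    rw [coeffOp_brownHalmosSum_of_forall_le hm h₁ (fun a b hab _ => h α β a b h₁ hab) a b
      (ha.trans hb.symm) ha, mul_assoc, mul_assoc, ← Pi.mulSingle_mul, ← Pi.mulSingle_mul,
      h α β _ _ h₁ (by simp [ha, hb])]
    simp only [mul_of_eq_mul_of_iff (ha.trans hb.symm), ite_and, FreeMonoid.length_mul,
      FreeMonoid.length_of, ha]

/-- The Brown–Halmos condition holds exactly for the operators whose coefficients are constant, up to
the weights, along the diagonals `(α γ, β γ)`. -/
theorem brownHalmos_iff_hasToeplitzCoeffs (hm : ∀ i, 1 ≤ m i)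
    (T : HilbertTensor K (FockTensor ι) →L[ℂ] HilbertTensor K (FockTensor ι)) :
    BrownHalmos m T ↔ HasToeplitzCoeffs m (coeffOp m T) T :=
  (brownHalmos_iff_isToeplitzAt hm T).trans (forall_isToeplitzAt_iff T)

end Recursion

/-! ### The bounded pluriharmonic function of a Toeplitz operator -/

section Pluriharmonic

variable {k : ℕ} {ι : Fin k → Type u} [∀ i, Fintype (ι i)] {m : Fin k → ℕ}
  {K : Type v} [NormedAddCommGroup K] [InnerProductSpace ℂ K]

instance : (comap (fun r : Set.Ico (0 : ℝ) 1 => (r : ℝ)) (𝓝 1)).NeBot := by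
  rw [← mem_closure_iff_comap_neBot, closure_Ico zero_ne_one]
  exact Set.right_mem_Icc.2 zero_le_one

theorem homogeneousPart_congr {H : Type w} [NormedAddCommGroup H] [InnerProductSpace ℂ H]
    [CompleteSpace H] {A B : MultiWord ι → MultiWord ι → K →L[ℂ] K}
    (h : ∀ α β, (α, β) ∈ pairsJ ι → A α β = B α β) (s : Fin k → ℤ) (X : ∀ i, ι i → H →L[ℂ] H) :
    homogeneousPart A s X = homogeneousPart B s X := by
  refine Finset.sum_congr rfl fun α hα => Finset.sum_congr rfl fun β hβ => ?_
  rw [h α β ⟨s, fun i => ⟨congrFun (mem_multiWords.1 hα) i, congrFun (mem_multiWords.1 hβ) i⟩⟩]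

theorem mem_sotClosure_of_pluriharmonic (hm : ∀ i, 1 ≤ m i)
    {T : HilbertTensor K (FockTensor ι) →L[ℂ] HilbertTensor K (FockTensor ι)}
    {F : RadialFunction ι m K} (hF : IsFreePluriharmonic F)
    (hT : ∀ ξ : HilbertTensor K (FockTensor ι),
      Tendsto (fun r : Set.Ico (0 : ℝ) 1 => F (FockTensor ι) (radialModel ι m hm r) ξ)
        (comap (fun r : Set.Ico (0 : ℝ) 1 => (r : ℝ)) (𝓝 1)) (𝓝 (T ξ))) :
    T ∈ sotClosure (toeplitzSpan ι m K : Set (HilbertTensor K (FockTensor ι) →L[ℂ] _)) := by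
  obtain ⟨A, hA⟩ := hF
  refine mem_sotClosure_of_tendsto (fun r => ?_) hT
  refine mem_closure_of_tendsto (hA _ (radialModel ι m hm r)) (Eventually.of_forall fun s => ?_)
  exact Submodule.sum_mem _ fun s _ => homogeneousPart_mem_toeplitzSpan A s _

variable [CompleteSpace K]

theorem tendsto_coe_Ico :
    Tendsto (fun r : Set.Ico (0 : ℝ) 1 => (r : ℝ)) (comap (fun r => (r : ℝ)) (𝓝 1)) (𝓝 1) :=
  tendsto_comap

theorem hasToeplitzCoeffs_radialModel (hm : ∀ i, 1 ≤ m i) {F : RadialFunction ι m K}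
    {A : MultiWord ι → MultiWord ι → K →L[ℂ] K}
    (hA : ∀ X : radialPolyHyperball ι m (FockTensor ι),
      HasSum (fun s : Fin k → ℤ => homogeneousPart A s X.1) (F (FockTensor ι) X))
    (r : Set.Ico (0 : ℝ) 1) :
    HasToeplitzCoeffs m (fun α β => ((r : ℝ) : ℂ) ^ (∑ i, multiLength α i + ∑ i, multiLength β i) •
      A α β) (F (FockTensor ι) (radialModel ι m hm r)) :=
  hasToeplitzCoeffs_of_hasSum (r := r) hm (hA (radialModel ι m hm r))

variable (m) in
/-- The pluriharmonic function `X ↦ ∑_s ∑ A_{α,β} ⊗ X_α X_β^*`, with junk values at the tuples where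
the series diverges. -/
def pluriharmonicSum (A : MultiWord ι → MultiWord ι → K →L[ℂ] K) : RadialFunction ι m K :=
  fun _ _ _ _ X => ∑' s : Fin k → ℤ, homogeneousPart A s X.1

/-- A Toeplitz operator is the radial limit of exactly one bounded pluriharmonic function: the
coefficients of the function are those of the operator. -/
theorem existsUnique_of_hasToeplitzCoeffs (hm : ∀ i, 1 ≤ m i)
    {T : HilbertTensor K (FockTensor ι) →L[ℂ] HilbertTensor K (FockTensor ι)}
    (hT : HasToeplitzCoeffs m (coeffOp m T) T) :
    ∃! F : RadialFunction ι m K, IsFreePluriharmonic F ∧ IsBoundedRadial F ∧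
        ∀ ξ : HilbertTensor K (FockTensor ι),
          Tendsto (fun r : Set.Ico (0 : ℝ) 1 => F (FockTensor ι) (radialModel ι m hm r) ξ)
            (comap (fun r : Set.Ico (0 : ℝ) 1 => (r : ℝ)) (𝓝 1)) (𝓝 (T ξ)) := by
  have key : ∀ (H : Type u) [NormedAddCommGroup H] [InnerProductSpace ℂ H] [CompleteSpace H]
      (X : radialPolyHyperball ι m H),
      HasSum (fun s : Fin k → ℤ => homogeneousPart (coeffOp m T) s X.1)
        (pluriharmonicSum m (coeffOp m T) H X) ∧ ‖pluriharmonicSum m (coeffOp m T) H X‖ ≤ ‖T‖ := by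
    intro H _ _ _ X
    obtain ⟨ρ, h0, h1, hc, hX, hpos⟩ := exists_of_mem_radialPolyHyperball hm X.2
    obtain ⟨S, hS, hn⟩ := exists_hasSum_homogeneousPart hm hT h0 h1 X.1 hc hX hpos
    have e : pluriharmonicSum m (coeffOp m T) H X = S := hS.tsum_eq
    rw [e]
    exact ⟨hS, hn⟩
  refine ⟨pluriharmonicSum m (coeffOp m T), ⟨⟨coeffOp m T, fun H _ _ _ X => (key H X).1⟩,
    ⟨‖T‖, fun H _ _ _ X => (key H X).2⟩, ?_⟩, ?_⟩
  · exact tendsto_of_hasToeplitzCoeffs hm (fun r => r.2.1) (fun r => r.2.2.le) tendsto_coe_Ico hT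
      (hasToeplitzCoeffs_radialModel hm fun X => (key _ X).1) fun r => (key _ _).2
  · rintro F ⟨⟨A, hA⟩, -, hF⟩
    have h := hasToeplitzCoeffs_of_tendsto tendsto_coe_Ico
      (hasToeplitzCoeffs_radialModel hm fun X => hA _ X) hF
    funext H _ _ _ X
    refine (hA H X).unique ?_
    have e : (fun s : Fin k → ℤ => homogeneousPart A s X.1) =
        fun s => homogeneousPart (coeffOp m T) s X.1 :=
      funext fun s => homogeneousPart_congr (fun α β hJ => (h.coeff_eq hJ).symm) s X.1
    rw [e]
    exact (key H X).1

end Pluriharmonic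

end

theorem mainTheorem1 {k : ℕ} (ι : Fin k → Type u) [∀ i, Fintype (ι i)] [∀ i, Nonempty (ι i)]
    (m : Fin k → ℕ) (hm : ∀ i, 1 ≤ m i)
    (K : Type v) [NormedAddCommGroup K] [InnerProductSpace ℂ K] [CompleteSpace K]
    [TopologicalSpace.SeparableSpace K]
    (T : HilbertTensor K (FockTensor ι) →L[ℂ] HilbertTensor K (FockTensor ι)) :
    List.TFAE [
      BrownHalmos m T,
      ∃! F : RadialFunction ι m K, IsFreePluriharmonic F ∧ IsBoundedRadial F ∧
        ∀ ξ : HilbertTensor K (FockTensor ι),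
          Tendsto (fun r : Set.Ico (0 : ℝ) 1 => F (FockTensor ι) (radialModel ι m hm r) ξ)
            (comap (fun r : Set.Ico (0 : ℝ) 1 => (r : ℝ)) (𝓝 1)) (𝓝 (T ξ)),
      T ∈ sotClosure (toeplitzSpan ι m K : Set _),
      T ∈ wotClosure (toeplitzSpan ι m K : Set _)] := by
  tfae_have 1 → 2 := fun h =>
    existsUnique_of_hasToeplitzCoeffs hm ((brownHalmos_iff_hasToeplitzCoeffs hm T).1 h)
  tfae_have 2 → 3 := fun ⟨_, ⟨hF, _, hT⟩, _⟩ => mem_sotClosure_of_pluriharmonic hm hF hT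
  tfae_have 3 → 4 := fun h => sotClosure_subset_wotClosure _ h
  tfae_have 4 → 1 := fun h =>
    (brownHalmos_iff_hasToeplitzCoeffs hm T).2 (hasToeplitzCoeffs_of_mem_wotClosure hm h)
  tfae_finish
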